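/- Let $d\ge 1$, let $\lambda\neq 0$ be a Lévy measure on $\mathbb{R}$ (so $\lambda(\{0\})=0$) with $\int_{\mathbb R}|z|\,\lambda(\mathrm dz)<\infty$, let $m\in\mathbb{R}$ and $m_0=m-\int_{\mathbb R} z\,\lambda(\mathrm dz)$. Let $\mu$ be a Poisson random measure on $(0,\infty)\times\mathbb{R}^d\times\mathbb{R}$ with intensity $\mathrm dt\,\mathrm dx\,\lambda(\mathrm dz)$, and let $\Lambda(\mathrm dt,\mathrm dx)=m_0\,\mathrm dt\,\mathrm dx+\int_{\mathbb R} z\,\mu(\mathrm dt,\mathrm dx,\mathrm dz)$ be the Lévy space-time white noise with mean $m$ and Lévy measure $\lambda$. Let $g(t,x)=(4\pi t)^{-d/2}e^{-|x|^2/(4t)}\mathbf 1_{t>0}$ be the heat kernel and let $$Y_0(t)=\int_0^t\int_{\mathbb{R}^d} g(t-s,-y)\,\Lambda(\mathrm ds,\mathrm dy)=m_0t+\int_{(0,t)\times\mathbb R^d\times\mathbb R} g(t-s,y)\,z\,\mu(\mathrm ds,\mathrm dy,\mathrm dz)$$ be the value at $x=0$ of the mild solution of the stochastic heat equation $\partial_tY=\Delta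 Y+\dot\Lambda$ on $\mathbb R^d$, $Y(0,\cdot)=0$. Assume that $\int_{\mathbb{R}}|z|^{1+\varepsilon}\,\lambda(\mathrm dz)<\infty$ for some $\varepsilon>0$ and $\int_{[-1,1]}\bigl|z\log|z|\bigr|\,\lambda(\mathrm dz)<\infty$. Let $f\colon(0,\infty)\to(0,\infty)$ be nondecreasing, let $(t_n)_{n\ge1}$ be a nondecreasing sequence in $(0,\infty)$ with $t_n\to\infty$, and put $t_0=0$, $\Delta t_n=t_n-t_{n-1}$. Consider $$S_+=\sum_{n=1}^\infty\int_{(0,\infty)}\Bigl(\Bigl(\frac{z}{f(t_n)}\Bigr)^{2/d}\wedge\Delta t_n\Bigr)\frac{z}{f(t_n)}\,\lambda(\mathrm dz),\qquad S_-=\sum_{n=1}^\infty\int_{(-\infty,0)}\Bigl(\Bigl(\frac{|z|}{f(t_n)}\Bigr)^{2/d}\wedge\Delta t_n\Bigr)\frac{|z|}{f(t_n)}\,\lambda(\mathrm dz).$$ 1. If $S_+=\infty$ (resp. $S_-=\infty$) and $\liminf_{n\to\infty} f(t_n)/t_n>0$, then almost surely $\limsup_{n\to\infty} Y_0(t_n)/f(t_n)=\infty$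 (resp. $\liminf_{n\to\infty} Y_0(t_n)/f(t_n)=-\infty$). 2. Suppose that $S_+<\infty$ (resp. $S_-<\infty$), that $f$ is unbounded, and that $t_n/f(t_n)\to\kappa\in[0,\infty]$, where $\kappa<\infty$ if $m=0$. Then almost surely $\limsup_{n\to\infty} Y_0(t_n)/f(t_n)=\kappa m$ (resp. $\liminf_{n\to\infty} Y_0(t_n)/f(t_n)=\kappa m$). -/

import Mathlib

open MeasureTheory ProbabilityTheory Filter Topology
open scoped ENNReal NNReal

noncomputable section

namespace LevySHE

/-- Space `ℝ^d` with the Euclidean norm. -/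
abbrev Space (d : ℕ) : Type := EuclideanSpace ℝ (Fin d)

/-- Space of marked points `(s, y, z)`: jump time, jump location, jump size. -/
abbrev JumpSpace (d : ℕ) : Type := ℝ × Space d × ℝ

/-- `μ` is a Poisson random measure with intensity `ν` under `P`: a measurable random measure
whose value on every measurable set `A` of finite intensity is Poisson distributed with parameter
`ν A`, and whose values on disjoint measurable sets are independent. -/
structure IsPoissonRandomMeasure {Ω E : Type*} [MeasurableSpace Ω] [MeasurableSpace E]
    (P : Measure Ω) (ν : Measure E) (μ : Ω → Measure E) : Prop where
  measurable : Measurable μ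
  law : ∀ A : Set E, MeasurableSet A → ν A ≠ ∞ →
    HasLaw (fun ω => μ ω A)
      ((poissonMeasure (ν A).toNNReal).map (Nat.cast : ℕ → ℝ≥0∞)) P
  indep : ∀ (n : ℕ) (A : Fin n → Set E), (∀ i, MeasurableSet (A i)) →
    Pairwise (fun i j => Disjoint (A i) (A j)) →
      iIndepFun (fun i ω => μ ω (A i)) P

/-- A Lévy measure on `ℝ`. -/
structure IsLevyMeasure (lam : Measure ℝ) : Prop where
  zero : lam {0} = 0
  lintegral_lt : ∫⁻ z, ENNReal.ofReal (min 1 (z ^ 2)) ∂lam < ∞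

/-- The intensity `dt dx λ(dz)` on `(0, ∞) × ℝ^d × ℝ`. -/
def intensity (d : ℕ) (lam : Measure ℝ) : Measure (JumpSpace d) :=
  ((volume : Measure ℝ).restrict (Set.Ioi 0)).prod
    ((volume : Measure (Space d)).prod lam)

/-- The heat kernel `g(t, x) = (4πt)^{-d/2} exp(-|x|²/(4t)) 1_{t > 0}`. -/
def heatKernel {d : ℕ} (t : ℝ) (x : Space d) : ℝ :=
  if 0 < t then
    (4 * Real.pi * t) ^ (-((d : ℝ) / 2)) * Real.exp (-(‖x‖ ^ 2 / (4 * t)))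
  else 0

/-- The drift `m₀ = m - ∫ z λ(dz)` of a noise with mean `m` and Lévy measure `λ`. -/
def drift (m : ℝ) (lam : Measure ℝ) : ℝ := m - ∫ z, z ∂lam

/-- The integral `∫ φ dΛ` of a function on `(0, ∞) × ℝ^d` with respect to
`Λ(dt, dx) = m₀ dt dx + ∫ z N(dt, dx, dz)`, where `N` is a realization of the jump measure. -/
def noiseIntegral {d : ℕ} (m : ℝ) (lam : Measure ℝ) (N : Measure (JumpSpace d))
    (φ : ℝ → Space d → ℝ) : ℝ :=
  drift m lam * (∫ p in (Set.Ioi (0 : ℝ)) ×ˢ (Set.univ : Set (Space d)), φ p.1 p.2) +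
    ∫ q, φ q.1 q.2.1 * q.2.2 ∂N

/-- The mild solution `Y(t, x) = ∫_0^t ∫ g(t - s, x - y) Λ(ds, dy)` of the stochastic heat
equation with additive noise (`σ ≡ 1`) and zero initial condition. The kernel vanishes
for `s ≥ t`. -/
def mildSolution {d : ℕ} (m : ℝ) (lam : Measure ℝ) (N : Measure (JumpSpace d))
    (t : ℝ) (x : Space d) : ℝ :=
  noiseIntegral m lam N (fun s y => heatKernel (t - s) (x - y))

/-- The series `∑_{n ≥ 1} ∫_S ((|z| / f(t_n))^{2/d} ∧ (t_n - t_{n-1})) |z| / f(t_n) λ(dz)`, with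
values in `[0, ∞]`. -/
def jumpSeries (d : ℕ) (lam : Measure ℝ) (f : ℝ → ℝ) (t : ℕ → ℝ) (S : Set ℝ) : ℝ≥0∞ :=
  ∑' n : ℕ, ∫⁻ z in S, ENNReal.ofReal
    (min ((|z| / f (t (n + 1))) ^ (2 / (d : ℝ))) (t (n + 1) - t n) *
      (|z| / f (t (n + 1)))) ∂lam

end LevySHE

end

namespace LevySHE

/-! ### Poisson random measures -/

section Poisson

/-! Write `Y₀(t)` as a drift plus the sum of `g·|z|` over positive jumps minus the same sum over
negative jumps (`mildSolution_zero`). The two sums are independent, and each is a `jumpSum` of a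
Poisson random measure. The case of the lower limit follows by exchanging the roles of the signs.

By parabolic scaling, a jump of size `z` contributes at least a constant times `f(t_n)` at time
`t_n` essentially when its age and its squared distance to the origin are at most of order
`(|z|/f(t_n))^{2/d}`. The part of this region lying after `t_{n-1}` has volume comparable to the
`n`-th summand of the series. Hence the series decides whether the set of jumps that are ever large
(the union of `bigJumps`) has finite or infinite intensity.

Divergence. Regions of different times may overlap. A greedy choice of times separated by more than
the height of the regions makes disjoint boxes whose total volume still dominates the series, up to
early times where the boxes would start before time zero. Those cost a logarithm, which the moment
of order `1 + ε` absorbs (`tsum_le_spaceTime`). The intensity is therefore infinite, and a Poisson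
random measure charges every tail of the union, for every level `K` (`ae_frequently_le_jumpSum`).
The jumps of the other sign are of order `t_n`, hence `O(f(t_n))` in probability, and by
independence they cannot cancel all of these peaks (`ae_frequently_le_sub`).

Convergence. The large jumps now have finite intensity, so almost surely they are finitely many and
contribute a bounded amount. The remaining contributions are at most `δ f`. They are controlled
simultaneously on time windows of length `f^{-2/d}` by an exponential Chebyshev inequality with
parameter of order `log f`, which gives a failure probability of order `f^{-(1+2/d)}`. Over greedily
chosen windows these probabilities are summable because the series is finite. This bounds the jump
sum by its mean up to a small multiple of `f` (`ae_eventually_jumpSum_le`).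

For the jumps of the other sign no series is assumed. A law of large numbers from below always holds
(`ae_eventually_le_jumpSum`), since truncated old jumps concentrate, and Fatou's lemma shows that
this lower bound is approached infinitely often (`ae_frequently_jumpSum_lt`). This suffices for an
upper limit. If `κ = ∞`, the same argument is run with the weight `t` in place of `f`. -/

lemma lintegral_poissonMeasure (r : ℝ≥0) (φ : ℕ → ℝ≥0∞) :
    ∫⁻ n, φ n ∂(poissonMeasure r) =
      ∑' n : ℕ, ENNReal.ofReal (Real.exp (-r) * r ^ n / n.factorial) * φ n := by
  simp [poissonMeasure, lintegral_sum_measure, lintegral_smul_measure]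

lemma lintegral_exp_poissonMeasure (r : ℝ≥0) (c : ℝ) :
    ∫⁻ n, ENNReal.ofReal (Real.exp (c * (n : ℝ))) ∂(poissonMeasure r) =
      ENNReal.ofReal (Real.exp (r * (Real.exp c - 1))) := by
  rw [lintegral_poissonMeasure]
  have h1 : HasSum (fun n : ℕ => Real.exp (-r) * r ^ n / n.factorial * Real.exp (c * n))
      (Real.exp (r * (Real.exp c - 1))) := by
    have := (NormedSpace.expSeries_div_hasSum_exp (r * Real.exp c : ℝ)).mul_left (Real.exp (-r))
    rw [← Real.exp_eq_exp_ℝ, ← Real.exp_add] at this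
    convert! this using 1
    · funext n
      rw [mul_pow, ← Real.exp_nat_mul, mul_comm (n : ℝ) c]
      ring
    · ring_nf
  rw [← h1.tsum_eq, ENNReal.ofReal_tsum_of_nonneg (fun n => by positivity) h1.summable]
  exact tsum_congr fun n => by rw [ENNReal.ofReal_mul (by positivity)]

lemma lintegral_natCast_poissonMeasure (r : ℝ≥0) :
    ∫⁻ n, (n : ℝ≥0∞) ∂(poissonMeasure r) = r := by
  rw [lintegral_poissonMeasure]
  have h1 : HasSum (fun n : ℕ => Real.exp (-r) * r ^ n / n.factorial * (n : ℝ)) (r : ℝ) := by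
    rw [← hasSum_nat_add_iff' 1]
    have := ((NormedSpace.expSeries_div_hasSum_exp (r : ℝ)).mul_left (Real.exp (-r))).mul_left (r : ℝ)
    rw [← Real.exp_eq_exp_ℝ, ← Real.exp_add] at this
    simp only [neg_add_cancel, Real.exp_zero, mul_one] at this
    convert! this using 1
    · funext n
      rw [Nat.factorial_succ]
      push_cast
      have : (n : ℝ) + 1 ≠ 0 := by positivity
      have h2 : ((n.factorial : ℕ) : ℝ) ≠ 0 := by positivity
      field_simp
      ring
    · simp
  have h3 : (r : ℝ≥0∞) = ENNReal.ofReal (r : ℝ) := by simp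
  conv_rhs => rw [h3, ← h1.tsum_eq, ENNReal.ofReal_tsum_of_nonneg (fun n => by positivity) h1.summable]
  exact tsum_congr fun n => by rw [ENNReal.ofReal_mul (by positivity), ENNReal.ofReal_natCast]

namespace IsPoissonRandomMeasure

variable {Ω E : Type*} [MeasurableSpace Ω] [MeasurableSpace E] {P : Measure Ω} {ν : Measure E}
  {μ : Ω → Measure E}

lemma measurable_apply (hμ : IsPoissonRandomMeasure P ν μ) {A : Set E} (hA : MeasurableSet A) :
    Measurable fun ω => μ ω A :=
  (Measure.measurable_coe hA).comp hμ.measurable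

lemma measurable_lintegral (hμ : IsPoissonRandomMeasure P ν μ) {h : E → ℝ≥0∞}
    (hh : Measurable h) : Measurable fun ω => ∫⁻ q, h q ∂(μ ω) :=
  (Measure.measurable_lintegral hh).comp hμ.measurable

lemma lintegral_comp_apply (hμ : IsPoissonRandomMeasure P ν μ) {A : Set E} (hA : MeasurableSet A)
    (hν : ν A ≠ ∞) {φ : ℝ≥0∞ → ℝ≥0∞} (hφ : Measurable φ) :
    ∫⁻ ω, φ (μ ω A) ∂P = ∫⁻ n : ℕ, φ n ∂(poissonMeasure (ν A).toNNReal) := by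
  have h := (hμ.law A hA hν)
  rw [← lintegral_map (f := φ) hφ (hμ.measurable_apply hA), h.map_eq,
    lintegral_map hφ (Measurable.of_discrete)]

lemma lintegral_apply (hμ : IsPoissonRandomMeasure P ν μ) {A : Set E} (hA : MeasurableSet A)
    (hν : ν A ≠ ∞) : ∫⁻ ω, μ ω A ∂P = ν A := by
  have := hμ.lintegral_comp_apply hA hν (φ := id) measurable_id
  simp only [id] at this
  rw [this, lintegral_natCast_poissonMeasure, ENNReal.coe_toNNReal hν]

lemma lintegral_exp_apply (hμ : IsPoissonRandomMeasure P ν μ) {A : Set E} (hA : MeasurableSet A)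
    (hν : ν A ≠ ∞) (c : ℝ) :
    ∫⁻ ω, ENNReal.ofReal (Real.exp (c * (μ ω A).toReal)) ∂P =
      ENNReal.ofReal (Real.exp ((ν A).toReal * (Real.exp c - 1))) := by
  rw [hμ.lintegral_comp_apply hA hν (φ := fun x => ENNReal.ofReal (Real.exp (c * x.toReal)))
    (by fun_prop)]
  simp only [ENNReal.toReal_natCast]
  rw [lintegral_exp_poissonMeasure]
  rfl

lemma measure_apply_eq_zero (hμ : IsPoissonRandomMeasure P ν μ) {A : Set E}
    (hA : MeasurableSet A) (hν : ν A ≠ ∞) :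
    P {ω | μ ω A = 0} = ENNReal.ofReal (Real.exp (-(ν A).toReal)) := by
  rw [(hμ.law A hA hν).measure_eq (p := fun x => x = 0) (measurableSet_singleton _),
    Measure.map_apply Measurable.of_discrete (s := {x | x = 0}) (measurableSet_singleton 0)]
  have : (Nat.cast : ℕ → ℝ≥0∞) ⁻¹' {x | x = 0} = {0} := by ext; simp
  rw [this, poissonMeasure_singleton]
  simp only [pow_zero, mul_one, Nat.factorial_zero, Nat.cast_one, div_one]
  rfl

lemma ae_exists_natCast (hμ : IsPoissonRandomMeasure P ν μ) {A : Set E} (hA : MeasurableSet A)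
    (hν : ν A ≠ ∞) : ∀ᵐ ω ∂P, ∃ n : ℕ, μ ω A = n := by
  have hmeas : MeasurableSet (Set.range (Nat.cast : ℕ → ℝ≥0∞)) := (Set.countable_range _).measurableSet
  have h : ∀ᵐ x ∂((poissonMeasure (ν A).toNNReal).map (Nat.cast : ℕ → ℝ≥0∞)),
      x ∈ Set.range (Nat.cast : ℕ → ℝ≥0∞) := by
    rw [ae_map_iff (p := fun x => x ∈ Set.range (Nat.cast : ℕ → ℝ≥0∞))
      (Measurable.of_discrete).aemeasurable hmeas]
    exact ae_of_all _ fun n => ⟨n, rfl⟩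
  rw [← (hμ.law A hA hν).map_eq,
    ae_map_iff (p := fun x => x ∈ Set.range (Nat.cast : ℕ → ℝ≥0∞)) (hμ.measurable_apply hA).aemeasurable hmeas] at h
  filter_upwards [h] with ω hω
  obtain ⟨n, hn⟩ := hω
  exact ⟨n, hn.symm⟩

/-- The law prescribes means only on sets of finite intensity, so the two measures are compared
along an exhaustion by spanning sets. Campbell's formula and the transfer of null sets then become
facts about `Measure.bind`. -/
lemma bind_eq [SigmaFinite ν] (hμ : IsPoissonRandomMeasure P ν μ) : P.bind μ = ν := by
  ext A hA
  have key : ∀ n, P.bind μ (A ∩ spanningSets ν n) = ν (A ∩ spanningSets ν n) := fun n => by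
    have hm := hA.inter (measurableSet_spanningSets ν n)
    rw [Measure.bind_apply hm hμ.measurable.aemeasurable]
    exact hμ.lintegral_apply hm
      ((measure_mono Set.inter_subset_right).trans_lt (measure_spanningSets_lt_top ν n)).ne
  have hU : A = ⋃ n, A ∩ spanningSets ν n := by
    rw [← Set.inter_iUnion, iUnion_spanningSets, Set.inter_univ]
  have hmono : Monotone fun n => A ∩ spanningSets ν n :=
    fun i j hij => Set.inter_subset_inter_right _ (monotone_spanningSets ν hij)
  rw [hU, hmono.measure_iUnion, hmono.measure_iUnion]
  exact iSup_congr key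

/-- Campbell's formula. -/
lemma lintegral_lintegral [SigmaFinite ν] (hμ : IsPoissonRandomMeasure P ν μ) {h : E → ℝ≥0∞}
    (hh : Measurable h) : ∫⁻ ω, ∫⁻ q, h q ∂(μ ω) ∂P = ∫⁻ q, h q ∂ν := by
  rw [← hμ.bind_eq, Measure.lintegral_bind hμ.measurable.aemeasurable hh.aemeasurable]

lemma ae_ae [SigmaFinite ν] (hμ : IsPoissonRandomMeasure P ν μ) {p : E → Prop}
    (h : ∀ᵐ q ∂ν, p q) : ∀ᵐ ω ∂P, ∀ᵐ q ∂(μ ω), p q := by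
  rw [← hμ.bind_eq] at h
  exact Measure.ae_ae_of_ae_bind hμ.measurable.aemeasurable h

/-- The void probabilities of truncations of `A` are `exp (-ν)`, and they tend to zero. This plays
the part of a second Borel–Cantelli lemma in the divergent case, without any independence of events
in time. -/
lemma ae_apply_ne_zero [SigmaFinite ν] [IsProbabilityMeasure P] (hμ : IsPoissonRandomMeasure P ν μ)
    {A : Set E} (hA : MeasurableSet A) (hν : ν A = ∞) : ∀ᵐ ω ∂P, μ ω A ≠ 0 := by
  have hm := fun n => hA.inter (measurableSet_spanningSets ν n)
  have hfin : ∀ n, ν (A ∩ spanningSets ν n) ≠ ∞ := fun n =>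
    ((measure_mono Set.inter_subset_right).trans_lt (measure_spanningSets_lt_top ν n)).ne
  have hU : A = ⋃ n, A ∩ spanningSets ν n := by
    rw [← Set.inter_iUnion, iUnion_spanningSets, Set.inter_univ]
  have hmono : Monotone fun n => A ∩ spanningSets ν n :=
    fun i j hij => Set.inter_subset_inter_right _ (monotone_spanningSets ν hij)
  have hlim : Tendsto (fun n => ν (A ∩ spanningSets ν n)) atTop (𝓝 ∞) := by
    have := tendsto_measure_iUnion_atTop (μ := ν) hmono
    rwa [← hU, hν] at this
  have hlim' : Tendsto (fun n => (ν (A ∩ spanningSets ν n)).toReal) atTop atTop :=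
    ENNReal.tendsto_ofReal_nhds_top.1 (by simpa only [ENNReal.ofReal_toReal (hfin _)] using hlim)
  have h0 : Tendsto (fun n => P {ω | μ ω (A ∩ spanningSets ν n) = 0}) atTop (𝓝 0) := by
    simp_rw [fun n => hμ.measure_apply_eq_zero (hm n) (hfin n)]
    have := (Real.tendsto_exp_neg_atTop_nhds_zero.comp hlim')
    simpa using ENNReal.tendsto_ofReal this
  rw [ae_iff]
  simp only [ne_eq, not_not]
  refine le_antisymm (ge_of_tendsto' h0 fun n => measure_mono fun ω hω => ?_) zero_le
  exact measure_mono_null Set.inter_subset_left hω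

lemma iIndepFun_apply {ι : Type*} [Fintype ι] (hμ : IsPoissonRandomMeasure P ν μ) (A : ι → Set E)
    (hA : ∀ i, MeasurableSet (A i)) (hd : Pairwise fun i j => Disjoint (A i) (A j)) :
    iIndepFun (fun i ω => μ ω (A i)) P := by
  let e := Fintype.equivFin ι
  have := hμ.indep _ (fun k => A (e.symm k)) (fun k => hA _)
    (fun i j hij => hd (e.symm.injective.ne hij))
  have h2 := this.precomp (g := e) e.injective
  simpa using h2

lemma lintegral_exp_sum {ι : Type*} [Fintype ι] (hμ : IsPoissonRandomMeasure P ν μ) (A : ι → Set E)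
    (hA : ∀ i, MeasurableSet (A i)) (hd : Pairwise fun i j => Disjoint (A i) (A j))
    (hν : ∀ i, ν (A i) ≠ ∞) (c : ι → ℝ) :
    ∫⁻ ω, ENNReal.ofReal (Real.exp (∑ i, c i * (μ ω (A i)).toReal)) ∂P =
      ENNReal.ofReal (Real.exp (∑ i, (ν (A i)).toReal * (Real.exp (c i) - 1))) := by
  have hind := (hμ.iIndepFun_apply A hA hd).comp
    (fun i x => ENNReal.ofReal (Real.exp (c i * x.toReal))) (fun i => by fun_prop)
  have hm : ∀ i, Measurable fun ω => μ ω (A i) := fun i => hμ.measurable_apply (hA i)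
  have := lintegral_prod_eq_prod_lintegral_of_indepFun Finset.univ _ hind
    (fun i => by simp only [Function.comp_def]; have := hm i; fun_prop)
  simp only [Function.comp_def] at this
  simp_rw [Real.exp_sum]
  rw [ENNReal.ofReal_prod_of_nonneg (fun i _ => by positivity)]
  simp_rw [fun i => (hμ.lintegral_exp_apply (hA i) (hν i) (c i))] at this
  rw [← this]
  exact lintegral_congr fun ω => ENNReal.ofReal_prod_of_nonneg (fun i _ => by positivity)

end IsPoissonRandomMeasure

end Poisson

/-! ### Exponential tail bounds for Poisson integrals and independence of restrictions. -/

section PoissonConcentration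

namespace IsPoissonRandomMeasure

variable {Ω E : Type*} [MeasurableSpace Ω] [MeasurableSpace E] {P : Measure Ω} {ν : Measure E}
  {μ : Ω → Measure E}

/-- Counts on sets of finite intensity are almost surely natural numbers, hence finite, which allows
passing to real sums. The fibre over `0` may have infinite intensity and is left out. -/
lemma ae_simple_toReal (hμ : IsPoissonRandomMeasure P ν μ) (φ : SimpleFunc E ℝ≥0∞)
    (hfin : ∀ q, φ q ≠ ∞) (hν : ∀ v, v ≠ 0 → ν (φ ⁻¹' {v}) ≠ ∞) :
    ∀ᵐ ω ∂P, φ.lintegral (μ ω) ≠ ∞ ∧ (φ.lintegral (μ ω)).toReal =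
      ∑ v : (φ.range.filter (· ≠ 0)), (v : ℝ≥0∞).toReal * (μ ω (φ ⁻¹' {(v : ℝ≥0∞)})).toReal := by
  have h : ∀ᵐ ω ∂P, ∀ v : (φ.range.filter (· ≠ 0)), ∃ n : ℕ, μ ω (φ ⁻¹' {(v : ℝ≥0∞)}) = n := by
    rw [ae_all_iff]
    intro v
    exact hμ.ae_exists_natCast (φ.measurableSet_fiber _) (hν _ (Finset.mem_filter.1 v.2).2)
  filter_upwards [h] with ω hω
  have hsum : φ.lintegral (μ ω) =
      ∑ v : (φ.range.filter (· ≠ 0)), (v : ℝ≥0∞) * μ ω (φ ⁻¹' {(v : ℝ≥0∞)}) := by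
    rw [SimpleFunc.lintegral,
      Finset.sum_coe_sort (φ.range.filter (· ≠ 0)) fun v => v * μ ω (φ ⁻¹' {v}), Finset.sum_filter]
    refine Finset.sum_congr rfl fun v _ => ?_
    by_cases hv : v = 0 <;> simp [hv]
  have hne : ∀ v : (φ.range.filter (· ≠ 0)), (v : ℝ≥0∞) * μ ω (φ ⁻¹' {(v : ℝ≥0∞)}) ≠ ∞ := by
    intro v
    obtain ⟨n, hn⟩ := hω v
    obtain ⟨q, hq⟩ := SimpleFunc.mem_range.1 (Finset.mem_filter.1 v.2).1
    rw [hn, ← hq]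
    exact ENNReal.mul_ne_top (hfin q) (ENNReal.natCast_ne_top n)
  rw [hsum]
  refine ⟨ENNReal.sum_ne_top.2 fun v _ => hne v, ?_⟩
  rw [ENNReal.toReal_sum fun v _ => hne v]
  simp only [ENNReal.toReal_mul]

lemma lintegral_exp_simple (hμ : IsPoissonRandomMeasure P ν μ) (φ : SimpleFunc E ℝ≥0∞)
    (hfin : ∀ q, φ q ≠ ∞) (hν : ∀ v, v ≠ 0 → ν (φ ⁻¹' {v}) ≠ ∞) (c : ℝ) :
    ∫⁻ ω, ENNReal.ofReal (Real.exp (c * (φ.lintegral (μ ω)).toReal)) ∂P =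
      ENNReal.ofReal (Real.exp (∑ v : (φ.range.filter (· ≠ 0)),
        (ν (φ ⁻¹' {(v : ℝ≥0∞)})).toReal * (Real.exp (c * (v : ℝ≥0∞).toReal) - 1))) := by
  rw [← hμ.lintegral_exp_sum (fun v : (φ.range.filter (· ≠ 0)) => φ ⁻¹' {(v : ℝ≥0∞)})
    (fun v => φ.measurableSet_fiber _) ?_ (fun v => hν _ (Finset.mem_filter.1 v.2).2)
    (fun v => c * (v : ℝ≥0∞).toReal)]
  · refine lintegral_congr_ae ?_
    filter_upwards [hμ.ae_simple_toReal φ hfin hν] with ω hω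
    rw [hω.2, Finset.mul_sum]
    simp only [mul_assoc]
  · intro v w hvw
    refine Disjoint.preimage _ ?_
    rw [Set.disjoint_singleton]
    exact fun h => hvw (Subtype.ext h)

/-- Approximation of a nonnegative function from below by simple functions supported on sets of
finite measure. -/
noncomputable def finApprox (ν : Measure E) [SigmaFinite ν] (h : E → ℝ≥0∞) (n : ℕ) :
    SimpleFunc E ℝ≥0∞ :=
  (SimpleFunc.eapprox h n).restrict (spanningSets ν n)

lemma finApprox_apply [SigmaFinite ν] (h : E → ℝ≥0∞) (n : ℕ) (q : E) :
    finApprox ν h n q = (spanningSets ν n).indicator (SimpleFunc.eapprox h n) q := by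
  rw [finApprox, SimpleFunc.restrict_apply _ (measurableSet_spanningSets ν n)]

lemma finApprox_ne_top [SigmaFinite ν] (h : E → ℝ≥0∞) (n : ℕ) (q : E) :
    finApprox ν h n q ≠ ∞ := by
  rw [finApprox_apply]
  by_cases hq : q ∈ spanningSets ν n
  · simpa [hq] using (SimpleFunc.eapprox_lt_top h n q).ne
  · simp [hq]

lemma finApprox_fiber [SigmaFinite ν] (h : E → ℝ≥0∞) (n : ℕ) {v : ℝ≥0∞} (hv : v ≠ 0) :
    ν (finApprox ν h n ⁻¹' {v}) ≠ ∞ := by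
  refine ((measure_mono fun q hq => ?_).trans_lt (measure_spanningSets_lt_top ν n)).ne
  by_contra hq'
  simp only [Set.mem_preimage, Set.mem_singleton_iff, finApprox_apply,
    Set.indicator_of_notMem hq'] at hq
  exact hv hq.symm

lemma monotone_finApprox [SigmaFinite ν] (h : E → ℝ≥0∞) (q : E) :
    Monotone fun n => finApprox ν h n q := by
  intro n k hnk
  simp only [finApprox_apply]
  by_cases hq : q ∈ spanningSets ν n
  · rw [Set.indicator_of_mem hq, Set.indicator_of_mem (monotone_spanningSets ν hnk hq)]
    exact SimpleFunc.monotone_eapprox h hnk q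
  · simp [hq]

lemma iSup_finApprox [SigmaFinite ν] {h : E → ℝ≥0∞} (hh : Measurable h) (q : E) :
    ⨆ n, finApprox ν h n q = h q := by
  refine iSup_eq_of_tendsto (monotone_finApprox h q) ?_
  refine (SimpleFunc.tendsto_eapprox hh q).congr' ?_
  filter_upwards [eventually_ge_atTop (spanningSetsIndex ν q)] with n hn
  rw [finApprox_apply, Set.indicator_of_mem]
  exact monotone_spanningSets ν hn (mem_spanningSetsIndex ν q)

lemma finApprox_le [SigmaFinite ν] {h : E → ℝ≥0∞} (hh : Measurable h) (n : ℕ) (q : E) :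
    finApprox ν h n q ≤ h q := by
  rw [← iSup_finApprox (ν := ν) hh q]
  exact le_iSup (fun n => finApprox ν h n q) n

lemma iSup_lintegral_finApprox [SigmaFinite ν] {h : E → ℝ≥0∞} (hh : Measurable h)
    (N : Measure E) : ⨆ n, (finApprox ν h n).lintegral N = ∫⁻ q, h q ∂N := by
  simp_rw [← SimpleFunc.lintegral_eq_lintegral]
  rw [← lintegral_iSup (fun n => (finApprox ν h n).measurable)
    fun i j hij q => monotone_finApprox h q hij]
  exact lintegral_congr fun q => iSup_finApprox hh q

/-- Markov's inequality for the exponential of the integral. The log-Laplace transform, a sum over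
fibres, is the integral of `exp φ - 1` against `ν`. -/
lemma measure_simple_gt_le (hμ : IsPoissonRandomMeasure P ν μ) (φ : SimpleFunc E ℝ≥0∞)
    (hfin : ∀ q, φ q ≠ ∞) (hν : ∀ v, v ≠ 0 → ν (φ ⁻¹' {v}) ≠ ∞) {C : ℝ}
    (hC : 0 ≤ C) (h : ∫⁻ q, ENNReal.ofReal (Real.exp (φ q).toReal - 1) ∂ν ≤ ENNReal.ofReal C)
    (x : ℝ) :
    P {ω | ENNReal.ofReal x < φ.lintegral (μ ω)} ≤ ENNReal.ofReal (Real.exp (C - x)) := by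
  have hsum : ∑ v : (φ.range.filter (· ≠ 0)),
      (ν (φ ⁻¹' {(v : ℝ≥0∞)})).toReal * (Real.exp (1 * (v : ℝ≥0∞).toReal) - 1) ≤ C := by
    rw [← ENNReal.ofReal_le_ofReal_iff hC]
    refine le_trans ?_ h
    have h2 := SimpleFunc.map_lintegral (μ := ν)
      (fun v : ℝ≥0∞ => ENNReal.ofReal (Real.exp v.toReal - 1)) φ
    rw [← SimpleFunc.lintegral_eq_lintegral] at h2
    simp only [SimpleFunc.map_apply] at h2
    rw [h2, ENNReal.ofReal_sum_of_nonneg, Finset.sum_coe_sort (φ.range.filter (· ≠ 0))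
      fun v => ENNReal.ofReal ((ν (φ ⁻¹' {v})).toReal * (Real.exp (1 * v.toReal) - 1))]
    · refine (Finset.sum_le_sum fun v hv => ?_).trans
        (Finset.sum_le_sum_of_subset (Finset.filter_subset _ _))
      rw [mul_comm, ENNReal.ofReal_mul (by simp),
        ENNReal.ofReal_toReal (hν _ (Finset.mem_filter.1 hv).2), one_mul]
    · intro v _
      have : 0 ≤ Real.exp (1 * (v : ℝ≥0∞).toReal) - 1 := by simp
      positivity
  have key := hμ.lintegral_exp_simple φ hfin hν 1
  have h1 : ∫⁻ ω, ENNReal.ofReal (Real.exp (-x)) *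
      ENNReal.ofReal (Real.exp (1 * (φ.lintegral (μ ω)).toReal)) ∂P ≤
        ENNReal.ofReal (Real.exp (C - x)) := by
    rw [lintegral_const_mul', key, ← ENNReal.ofReal_mul (by positivity), ← Real.exp_add]
    · apply ENNReal.ofReal_le_ofReal
      apply Real.exp_le_exp.2
      linarith
    · simp
  have hm : Measurable fun ω => φ.lintegral (μ ω) := by
    simp_rw [← SimpleFunc.lintegral_eq_lintegral]
    exact hμ.measurable_lintegral φ.measurable
  have hms : MeasurableSet {ω | ENNReal.ofReal x < φ.lintegral (μ ω)} :=
    measurableSet_lt measurable_const hm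
  refine le_trans ?_ h1
  rw [← lintegral_indicator_one hms]
  refine lintegral_mono_ae ?_
  filter_upwards [hμ.ae_simple_toReal φ hfin hν] with ω hω
  by_cases hx : ENNReal.ofReal x < φ.lintegral (μ ω)
  · have : ω ∈ {ω | ENNReal.ofReal x < φ.lintegral (μ ω)} := hx
    rw [Set.indicator_of_mem this, ← ENNReal.ofReal_mul (by positivity), ← Real.exp_add]
    simp only [Pi.one_apply, one_mul]
    rw [← ENNReal.ofReal_one]
    apply ENNReal.ofReal_le_ofReal
    apply Real.one_le_exp
    have := (ENNReal.ofReal_le_iff_le_toReal hω.1).1 hx.le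
    linarith
  · have : ω ∉ {ω | ENNReal.ofReal x < φ.lintegral (μ ω)} := hx
    rw [Set.indicator_of_notMem this]
    exact zero_le

/-- Exponential Chebyshev inequality for the upper tail of a Poisson integral. -/
lemma measure_lintegral_gt_le [SigmaFinite ν] (hμ : IsPoissonRandomMeasure P ν μ) {h : E → ℝ≥0∞}
    (hh : Measurable h) (hfin : ∀ q, h q ≠ ∞) {C : ℝ} (hC : 0 ≤ C)
    (hint : ∫⁻ q, ENNReal.ofReal (Real.exp (h q).toReal - 1) ∂ν ≤ ENNReal.ofReal C) (x : ℝ) :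
    P {ω | ENNReal.ofReal x < ∫⁻ q, h q ∂(μ ω)} ≤ ENNReal.ofReal (Real.exp (C - x)) := by
  have hset : {ω | ENNReal.ofReal x < ∫⁻ q, h q ∂(μ ω)} =
      ⋃ n, {ω | ENNReal.ofReal x < (finApprox ν h n).lintegral (μ ω)} := by
    ext ω
    simp only [Set.mem_ofPred_eq, Set.mem_iUnion, ← iSup_lintegral_finApprox (ν := ν) hh (μ ω),
      lt_iSup_iff]
  have hmono : Monotone fun n => {ω | ENNReal.ofReal x < (finApprox ν h n).lintegral (μ ω)} := by
    intro n k hnk ω hω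
    exact lt_of_lt_of_le hω
      (SimpleFunc.lintegral_mono (fun q => monotone_finApprox h q hnk) le_rfl)
  rw [hset, hmono.measure_iUnion]
  refine iSup_le fun n => hμ.measure_simple_gt_le _ (finApprox_ne_top h n)
    (fun v hv => finApprox_fiber h n hv) hC (le_trans (lintegral_mono fun q => ?_) hint) x
  refine ENNReal.ofReal_le_ofReal (sub_le_sub_right (Real.exp_le_exp.2 ?_) 1)
  exact ENNReal.toReal_mono (hfin q) (finApprox_le hh n q)

/-- Since `exp v ≥ 1 + v`, it suffices that `(1 - v + v²)(1 + v) = 1 + v³ ≥ 1`. -/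
lemma exp_neg_le_quadratic {v : ℝ} (hv : 0 ≤ v) : Real.exp (-v) ≤ 1 - v + v ^ 2 := by
  have h1 : 1 + v ≤ Real.exp v := by linarith [Real.add_one_le_exp v]
  have h2 : Real.exp (-v) * Real.exp v = 1 := by rw [← Real.exp_add]; simp
  have h3 : Real.exp (-v) * (1 + v) ≤ 1 := by
    exact (mul_le_mul_of_nonneg_left h1 (Real.exp_pos _).le).trans h2.le
  have h4 : (1 : ℝ) ≤ (1 - v + v ^ 2) * (1 + v) := by nlinarith [pow_nonneg hv 3]
  exact le_of_mul_le_mul_right (h3.trans h4) (by linarith)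

/-- For values `v ≤ b` the quadratic bound gives `exp (-v) - 1 ≤ -(1 - b) v`, so the exponent in
Markov's inequality becomes linear in the mean. -/
lemma measure_simple_le_le (hμ : IsPoissonRandomMeasure P ν μ) (φ : SimpleFunc E ℝ≥0∞)
    {b : ℝ} (hb : ∀ q, φ q ≤ ENNReal.ofReal b) (hb0 : 0 ≤ b)
    (hν : ∀ v, v ≠ 0 → ν (φ ⁻¹' {v}) ≠ ∞) {x : ℝ} (hx0 : 0 ≤ x) :
    P {ω | φ.lintegral (μ ω) ≤ ENNReal.ofReal x} ≤
      ENNReal.ofReal (Real.exp (x - (1 - b) * (φ.lintegral ν).toReal)) := by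
  have hfin : ∀ q, φ q ≠ ∞ := fun q => ((hb q).trans_lt ENNReal.ofReal_lt_top).ne
  have hsum : ∑ v : (φ.range.filter (· ≠ 0)),
      (ν (φ ⁻¹' {(v : ℝ≥0∞)})).toReal * (Real.exp (-1 * (v : ℝ≥0∞).toReal) - 1) ≤
        -((1 - b) * (φ.lintegral ν).toReal) := by
    have h1 : (φ.lintegral ν).toReal =
        ∑ v : (φ.range.filter (· ≠ 0)),
          (v : ℝ≥0∞).toReal * (ν (φ ⁻¹' {(v : ℝ≥0∞)})).toReal := by
      rw [SimpleFunc.lintegral, ENNReal.toReal_sum]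
      · rw [Finset.sum_coe_sort (φ.range.filter (· ≠ 0))
          fun v => v.toReal * (ν (φ ⁻¹' {v})).toReal, Finset.sum_filter]
        refine Finset.sum_congr rfl fun v _ => ?_
        by_cases hv : v = 0 <;> simp [hv]
      · intro v hv
        by_cases hv0 : v = 0
        · simp [hv0]
        · obtain ⟨q, hq⟩ := SimpleFunc.mem_range.1 hv
          exact ENNReal.mul_ne_top (hq ▸ hfin q) (hν v hv0)
    rw [h1, Finset.mul_sum, ← Finset.sum_neg_distrib]
    refine Finset.sum_le_sum fun v _ => ?_
    obtain ⟨q, hq⟩ := SimpleFunc.mem_range.1 (Finset.mem_filter.1 v.2).1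
    have hvb : (v : ℝ≥0∞).toReal ≤ b := by
      rw [← hq]; exact ENNReal.toReal_le_of_le_ofReal hb0 (hb q)
    have hv0 : 0 ≤ (v : ℝ≥0∞).toReal := ENNReal.toReal_nonneg
    have hn0 : 0 ≤ (ν (φ ⁻¹' {(v : ℝ≥0∞)})).toReal := ENNReal.toReal_nonneg
    have h2 : Real.exp (-1 * (v : ℝ≥0∞).toReal) - 1 ≤ -((1 - b) * (v : ℝ≥0∞).toReal) := by
      have := exp_neg_le_quadratic hv0
      rw [neg_one_mul]
      nlinarith
    calc _ ≤ (ν (φ ⁻¹' {(v : ℝ≥0∞)})).toReal * (-((1 - b) * (v : ℝ≥0∞).toReal)) :=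
          mul_le_mul_of_nonneg_left h2 hn0
      _ = _ := by ring
  have key := hμ.lintegral_exp_simple φ hfin hν (-1)
  have h1 : ∫⁻ ω, ENNReal.ofReal (Real.exp x) *
      ENNReal.ofReal (Real.exp (-1 * (φ.lintegral (μ ω)).toReal)) ∂P ≤
        ENNReal.ofReal (Real.exp (x - (1 - b) * (φ.lintegral ν).toReal)) := by
    rw [lintegral_const_mul', key, ← ENNReal.ofReal_mul (by positivity), ← Real.exp_add]
    · apply ENNReal.ofReal_le_ofReal
      apply Real.exp_le_exp.2
      linarith
    · simp
  have hm : Measurable fun ω => φ.lintegral (μ ω) := by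
    simp_rw [← SimpleFunc.lintegral_eq_lintegral]
    exact hμ.measurable_lintegral φ.measurable
  have hms : MeasurableSet {ω | φ.lintegral (μ ω) ≤ ENNReal.ofReal x} :=
    measurableSet_le hm measurable_const
  refine le_trans ?_ h1
  rw [← lintegral_indicator_one hms]
  refine lintegral_mono fun ω => ?_
  by_cases hx : φ.lintegral (μ ω) ≤ ENNReal.ofReal x
  · have : ω ∈ {ω | φ.lintegral (μ ω) ≤ ENNReal.ofReal x} := hx
    rw [Set.indicator_of_mem this, ← ENNReal.ofReal_mul (by positivity), ← Real.exp_add]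
    simp only [Pi.one_apply]
    rw [← ENNReal.ofReal_one]
    apply ENNReal.ofReal_le_ofReal
    apply Real.one_le_exp
    have := ENNReal.toReal_le_of_le_ofReal hx0 hx
    linarith
  · have : ω ∉ {ω | φ.lintegral (μ ω) ≤ ENNReal.ofReal x} := hx
    rw [Set.indicator_of_notMem this]
    exact zero_le

/-- Exponential Chebyshev inequality for the lower tail of a Poisson integral. -/
lemma measure_lintegral_le_le [SigmaFinite ν] (hμ : IsPoissonRandomMeasure P ν μ) {h : E → ℝ≥0∞}
    (hh : Measurable h) {b : ℝ} (hb : ∀ q, h q ≤ ENNReal.ofReal b) (hb0 : 0 ≤ b) (hb1 : b ≤ 1)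
    {I : ℝ} (hI : ENNReal.ofReal I < ∫⁻ q, h q ∂ν) {x : ℝ} (hx : 0 ≤ x) :
    P {ω | ∫⁻ q, h q ∂(μ ω) ≤ ENNReal.ofReal x} ≤ ENNReal.ofReal (Real.exp (x - (1 - b) * I)) := by
  -- Because the inequality for `I` is strict, a single approximant already has mean above `I`; its
  -- integral against `μ ω` is the smaller one, so the event only grows.
  rw [← iSup_lintegral_finApprox (ν := ν) hh ν, lt_iSup_iff] at hI
  obtain ⟨n, hn⟩ := hI
  have h1 := hμ.measure_simple_le_le (finApprox ν h n)
    (fun q => (finApprox_le hh n q).trans (hb q)) hb0 (fun v hv => finApprox_fiber h n hv) hx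
  refine (measure_mono fun ω hω => ?_).trans (h1.trans (ENNReal.ofReal_le_ofReal
    (Real.exp_le_exp.2 (sub_le_sub_left (mul_le_mul_of_nonneg_left ?_ (by linarith)) _))))
  · simp only [Set.mem_ofPred_eq] at hω ⊢
    rw [← iSup_lintegral_finApprox (ν := ν) hh] at hω
    exact (le_iSup _ n).trans hω
  · refine (ENNReal.ofReal_le_iff_le_toReal ?_).1 hn.le
    rw [SimpleFunc.lintegral]
    refine ENNReal.sum_ne_top.2 fun v hv => ?_
    by_cases hv0 : v = 0
    · simp [hv0]
    · obtain ⟨q, hq⟩ := SimpleFunc.mem_range.1 hv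
      exact ENNReal.mul_ne_top (hq ▸ finApprox_ne_top h n q) (finApprox_fiber h n hv0)

/-- The cell of a finite family of sets determined by a pattern of memberships. -/
def cell {ι G : Type*} (A : Set G) (F : ι → Set G) (b : ι → Bool) : Set G :=
  A ∩ ⋂ i, if b i then F i else (F i)ᶜ

lemma measurableSet_cell {ι : Type*} [Countable ι] {A : Set E} (hA : MeasurableSet A)
    {F : ι → Set E} (hF : ∀ i, MeasurableSet (F i)) (b : ι → Bool) :
    MeasurableSet (cell A F b) := by
  refine hA.inter (MeasurableSet.iInter fun i => ?_)
  split_ifs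
  exacts [hF i, (hF i).compl]

lemma disjoint_cell {ι G : Type*} {A : Set G} {F : ι → Set G} {b c : ι → Bool} (hbc : b ≠ c) :
    Disjoint (cell A F b) (cell A F c) := by
  obtain ⟨i, hi⟩ := Function.ne_iff.1 hbc
  rw [Set.disjoint_left]
  intro q hq hq'
  have h1 := Set.mem_iInter.1 hq.2 i
  have h2 := Set.mem_iInter.1 hq'.2 i
  cases hb : b i <;> cases hc : c i <;> simp_all

lemma measure_inter_eq_sum_cell {ι : Type*} [Fintype ι] [DecidableEq ι] {A : Set E}
    (hA : MeasurableSet A) {F : ι → Set E} (hF : ∀ i, MeasurableSet (F i)) (N : Measure E) (i : ι) :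
    N (A ∩ F i) = ∑ b : ι → Bool, if b i then N (cell A F b) else 0 := by
  classical
  rw [← Finset.sum_filter, ← measure_biUnion_finset
    (fun b _ c _ hbc => disjoint_cell hbc) (fun b _ => measurableSet_cell hA hF b)]
  congr 1
  ext q
  simp only [Set.mem_inter_iff, Finset.mem_filter, Finset.mem_univ, true_and, Set.mem_iUnion,
    exists_prop]
  constructor
  · rintro ⟨hqA, hqi⟩
    refine ⟨fun j => decide (q ∈ F j), by simpa using hqi, hqA, Set.mem_iInter.2 fun j => ?_⟩
    by_cases hj : q ∈ F j <;> simp [hj]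
  · rintro ⟨b, hb, hq⟩
    refine ⟨hq.1, ?_⟩
    have := Set.mem_iInter.1 hq.2 i
    simpa [hb] using this

/-- The restrictions of a Poisson random measure to two disjoint sets are independent. -/
lemma indepFun_restrict [IsProbabilityMeasure P] (hμ : IsPoissonRandomMeasure P ν μ) {A B : Set E}
    (hA : MeasurableSet A) (hB : MeasurableSet B) (hAB : Disjoint A B) :
    IndepFun (fun ω => (μ ω).restrict A) (fun ω => (μ ω).restrict B) P := by
  classical
  let T := {F : Set E // MeasurableSet F}
  have hproc : IndepFun (fun ω (F : T) => μ ω (A ∩ F)) (fun ω (F : T) => μ ω (B ∩ F)) P := by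
    refine IndepFun.process_indepFun_process (X := fun (F : T) ω => μ ω (A ∩ F))
      (Y := fun (F : T) ω => μ ω (B ∩ F)) (fun F => hμ.measurable_apply (hA.inter F.2))
      (fun F => hμ.measurable_apply (hB.inter F.2)) fun I J => ?_
    -- The test sets may overlap, whereas independence is given for disjoint sets. The cells
    -- generated by finitely many test sets inside `A` and inside `B` are disjoint, and the values
    -- on the test sets are sums over cells.
    let C : (I → Bool) ⊕ (J → Bool) → Set E :=
      Sum.elim (cell A fun i : I => (i : T).1) (cell B fun j : J => (j : T).1)
    have hCm : ∀ k, MeasurableSet (C k) := by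
      rintro (b | b)
      exacts [measurableSet_cell hA (fun i : I => (i : T).2) b,
        measurableSet_cell hB (fun i : J => (i : T).2) b]
    have hCd : Pairwise fun k l => Disjoint (C k) (C l) := by
      rintro (b | b) (c | c) hbc
      · exact disjoint_cell fun h => hbc (by rw [h])
      · exact hAB.mono Set.inter_subset_left Set.inter_subset_left
      · exact hAB.symm.mono Set.inter_subset_left Set.inter_subset_left
      · exact disjoint_cell fun h => hbc (by rw [h])
    have hind := hμ.iIndepFun_apply C hCm hCd
    let S1 : Finset ((I → Bool) ⊕ (J → Bool)) := Finset.univ.map Function.Embedding.inl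
    let S2 : Finset ((I → Bool) ⊕ (J → Bool)) := Finset.univ.map Function.Embedding.inr
    have hdisj : Disjoint S1 S2 := by
      rw [Finset.disjoint_left]
      intro k hk hk'
      simp only [S1, S2, Finset.mem_map, Finset.mem_univ, true_and] at hk hk'
      obtain ⟨b, rfl⟩ := hk
      obtain ⟨c, hc⟩ := hk'
      cases hc
    have h2 := hind.indepFun_finset S1 S2 hdisj fun k => hμ.measurable_apply (hCm k)
    let g1 : (S1 → ℝ≥0∞) → (I → ℝ≥0∞) := fun x i =>
      ∑ b : I → Bool, if b i then x ⟨Sum.inl b, by simp [S1]⟩ else 0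
    let g2 : (S2 → ℝ≥0∞) → (J → ℝ≥0∞) := fun x i =>
      ∑ b : J → Bool, if b i then x ⟨Sum.inr b, by simp [S2]⟩ else 0
    have hg1 : Measurable g1 := by
      refine measurable_pi_lambda _ fun i => Finset.measurable_sum _ fun b _ => ?_
      split_ifs
      exacts [measurable_pi_apply _, measurable_const]
    have hg2 : Measurable g2 := by
      refine measurable_pi_lambda _ fun i => Finset.measurable_sum _ fun b _ => ?_
      split_ifs
      exacts [measurable_pi_apply _, measurable_const]
    have h3 := h2.comp hg1 hg2
    convert! h3 using 1
    · funext ω i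
      exact measure_inter_eq_sum_cell hA (fun i : I => (i : T).2) (μ ω) i
    · funext ω i
      exact measure_inter_eq_sum_cell hB (fun i : J => (i : T).2) (μ ω) i
  -- The restricted measure carries no more information than the process of its values on measurable
  -- sets.
  have hgen : ∀ D : Set E, MeasurableSet D →
      MeasurableSpace.comap (fun ω => (μ ω).restrict D) inferInstance ≤
      MeasurableSpace.comap (fun ω (F : T) => μ ω (D ∩ F)) inferInstance := by
    intro D hD
    rw [← measurable_iff_comap_le]
    refine Measure.measurable_of_measurable_coe _ fun F hF => ?_
    simp_rw [Measure.restrict_apply hF, Set.inter_comm F D]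
    exact (measurable_pi_apply (⟨F, hF⟩ : T)).comp
      (comap_measurable fun ω (F : T) => μ ω (D ∩ F))
  exact indep_of_indep_of_le_left (indep_of_indep_of_le_right hproc (hgen B hB)) (hgen A hA)

end IsPoissonRandomMeasure

end PoissonConcentration

/-! ### The heat kernel -/

section HeatKernel

variable {d : ℕ}

lemma heatKernel_of_pos {t : ℝ} (ht : 0 < t) (x : Space d) :
    heatKernel t x = (√(4 * Real.pi * t) ^ d)⁻¹ * Real.exp (-(‖x‖ ^ 2 / (4 * t))) := by
  have h : (0 : ℝ) ≤ 4 * Real.pi * t := by positivity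
  rw [heatKernel, if_pos ht, Real.rpow_neg h, Real.sqrt_eq_rpow,
    ← Real.rpow_natCast ((4 * Real.pi * t) ^ (1 / 2 : ℝ)) d, ← Real.rpow_mul h]
  congr 3
  ring

lemma heatKernel_of_nonpos {t : ℝ} (ht : t ≤ 0) (x : Space d) : heatKernel t x = 0 := by
  rw [heatKernel, if_neg (not_lt.2 ht)]

lemma heatKernel_nonneg (t : ℝ) (x : Space d) : 0 ≤ heatKernel t x := by
  rcases lt_or_ge 0 t with ht | ht
  · rw [heatKernel_of_pos ht]; positivity
  · rw [heatKernel_of_nonpos ht]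

lemma heatKernel_zero_sub (t : ℝ) (y : Space d) : heatKernel t (0 - y) = heatKernel t y := by
  simp [heatKernel]

lemma measurable_heatKernel : Measurable fun p : ℝ × Space d => heatKernel p.1 p.2 := by
  unfold heatKernel
  refine Measurable.ite (measurableSet_lt measurable_const measurable_fst) ?_ measurable_const
  fun_prop

@[fun_prop]
lemma Measurable.heatKernel_comp {α : Type*} [MeasurableSpace α] {u : α → ℝ} {v : α → Space d}
    (hu : Measurable u) (hv : Measurable v) : Measurable fun a => heatKernel (u a) (v a) :=
  measurable_heatKernel.comp (hu.prodMk hv)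

lemma heatKernel_le_inv {t : ℝ} (ht : 0 < t) (x : Space d) :
    heatKernel t x ≤ (√(4 * Real.pi * t) ^ d)⁻¹ := by
  rw [heatKernel_of_pos ht]
  refine mul_le_of_le_one_right (by positivity) (Real.exp_le_one_iff.2 ?_)
  have : 0 ≤ ‖x‖ ^ 2 / (4 * t) := by positivity
  linarith

lemma heatKernel_le_one {t : ℝ} (ht : 1 ≤ t) (x : Space d) : heatKernel t x ≤ 1 := by
  refine (heatKernel_le_inv (by linarith) x).trans (inv_le_one_of_one_le₀ (one_le_pow₀ ?_))
  rw [Real.one_le_sqrt]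
  nlinarith [Real.pi_gt_three]

lemma lintegral_heatKernel {t : ℝ} (ht : 0 < t) :
    ∫⁻ y : Space d, ENNReal.ofReal (heatKernel t y) = 1 := by
  have hb : (0 : ℝ) < 1 / (4 * t) := by positivity
  have h1 := GaussianFourier.integral_rexp_neg_mul_sq_norm (V := Space d) hb
  have h2 : ∫ y : Space d, heatKernel t y = 1 := by
    simp_rw [heatKernel, if_pos ht]
    rw [integral_const_mul]
    have : (fun y : Space d => Real.exp (-(‖y‖ ^ 2 / (4 * t)))) =
        fun y => Real.exp (-(1 / (4 * t)) * ‖y‖ ^ 2) := by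
      funext y; congr 1; ring
    rw [this, h1, finrank_euclideanSpace, Fintype.card_fin]
    have h3 : Real.pi / (1 / (4 * t)) = 4 * Real.pi * t := by field_simp
    rw [h3, Real.rpow_neg (by positivity)]
    exact inv_mul_cancel₀ (by positivity)
  have h4 : Integrable (fun y : Space d => heatKernel t y) := by
    by_contra h
    rw [integral_undef h] at h2
    exact zero_ne_one h2
  rw [← ofReal_integral_eq_lintegral_ofReal h4 (ae_of_all _ fun y => heatKernel_nonneg t y), h2,
    ENNReal.ofReal_one]

/-- In time, the heat kernel decreases at most polynomially. -/
lemma heatKernel_le_mul {e u v : ℝ} (hu : 0 < u) (huv : u ≤ v) (hv : v ≤ (1 + e) * u)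
    (he : 0 ≤ e) (y : Space d) : heatKernel u y ≤ (1 + e) ^ d * heatKernel v y := by
  have hv0 : 0 < v := hu.trans_le huv
  rw [heatKernel_of_pos hu, heatKernel_of_pos hv0, ← mul_assoc]
  have h1 : √(4 * Real.pi * v) ≤ (1 + e) * √(4 * Real.pi * u) := by
    rw [Real.sqrt_le_left (by positivity), mul_pow, Real.sq_sqrt (by positivity)]
    have : (1 + e) * u ≤ (1 + e) ^ 2 * u := by
      apply mul_le_mul_of_nonneg_right _ hu.le; nlinarith
    nlinarith [Real.pi_pos, mul_le_mul_of_nonneg_left (hv.trans this) Real.pi_pos.le]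
  have h2 : √(4 * Real.pi * v) ^ d ≤ (1 + e) ^ d * √(4 * Real.pi * u) ^ d := by
    rw [← mul_pow]; exact pow_le_pow_left₀ (by positivity) h1 d
  refine mul_le_mul ?_ ?_ (by positivity) (by positivity)
  · rw [← div_eq_mul_inv, inv_eq_one_div, div_le_div_iff₀ (by positivity) (by positivity), one_mul]
    exact h2
  · apply Real.exp_le_exp.2
    apply neg_le_neg
    gcongr

/-- From `v ^ p ≤ p! exp v` and `v - v² ≤ 1`. -/
lemma pow_mul_exp_neg_sq_le {v : ℝ} (hv : 0 ≤ v) (p : ℕ) :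
    v ^ p * Real.exp (-v ^ 2) ≤ Real.exp 1 * p.factorial := by
  have h1 := Real.pow_div_factorial_le_exp v hv p
  rw [div_le_iff₀ (by positivity)] at h1
  have h2 : Real.exp v * Real.exp (-v ^ 2) ≤ Real.exp 1 := by
    rw [← Real.exp_add]; apply Real.exp_le_exp.2; nlinarith [sq_nonneg (v - 1 / 2)]
  calc v ^ p * Real.exp (-v ^ 2) ≤ (Real.exp v * p.factorial) * Real.exp (-v ^ 2) := by gcongr
    _ = (Real.exp v * Real.exp (-v ^ 2)) * p.factorial := by ring
    _ ≤ _ := by gcongr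

lemma heatKernel_mul_pow {u : ℝ} (hu : 0 < u) (y : Space d) :
    heatKernel u y = (√Real.pi ^ d)⁻¹ * ((2 * √u) ^ d)⁻¹ * Real.exp (-(‖y‖ / (2 * √u)) ^ 2) := by
  rw [heatKernel_of_pos hu]
  have h1 : √(4 * Real.pi * u) = √Real.pi * (2 * √u) := by
    rw [Real.sqrt_mul (by positivity), Real.sqrt_mul (by positivity)]
    have : √(4 : ℝ) = 2 := by rw [show (4 : ℝ) = 2 ^ 2 by norm_num]; simp
    rw [this]; ring
  have h2 : ‖y‖ ^ 2 / (4 * u) = (‖y‖ / (2 * √u)) ^ 2 := by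
    rw [div_pow, mul_pow, Real.sq_sqrt hu.le]; norm_num
  rw [h1, h2, mul_pow, mul_inv]

lemma one_le_sqrt_pi : 1 ≤ √Real.pi := by
  rw [Real.one_le_sqrt]; linarith [Real.pi_gt_three]

/-- A constant in the bounds of the heat kernel by powers of the spatial variable. -/
noncomputable def kernelConst (d : ℕ) : ℝ := 2 * (Real.exp 1 * (d + 1).factorial)

lemma one_le_kernelConst (d : ℕ) : 1 ≤ kernelConst d := by
  have h1 : 1 ≤ Real.exp 1 := Real.one_le_exp zero_le_one
  have h2 : (1 : ℝ) ≤ (d + 1).factorial := by exact_mod_cast Nat.succ_le_of_lt (Nat.factorial_pos _)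
  unfold kernelConst
  nlinarith

/-- In the similarity variable `‖y‖ / (2√u)` the product no longer depends on `u`. The bound locates
large contributions in space and controls the kernel near the origin uniformly in time. -/
lemma heatKernel_mul_norm_pow_le (u : ℝ) (y : Space d) :
    heatKernel u y * ‖y‖ ^ d ≤ kernelConst d := by
  rcases le_or_gt u 0 with hu | hu
  · rw [heatKernel_of_nonpos hu, zero_mul]; linarith [one_le_kernelConst d]
  have hs : 0 < √u := Real.sqrt_pos.2 hu
  have h0 : heatKernel u y * ‖y‖ ^ d = (√Real.pi ^ d)⁻¹ *
      ((‖y‖ / (2 * √u)) ^ d * Real.exp (-(‖y‖ / (2 * √u)) ^ 2)) := by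
    rw [heatKernel_mul_pow hu]
    generalize Real.exp (-(‖y‖ / (2 * √u)) ^ 2) = E
    rw [div_pow]
    field_simp
  rw [h0]
  have h1 := pow_mul_exp_neg_sq_le (v := ‖y‖ / (2 * √u)) (by positivity) d
  have h2 : (√Real.pi ^ d)⁻¹ ≤ 1 := inv_le_one_of_one_le₀ (one_le_pow₀ one_le_sqrt_pi)
  have h3 : ((d.factorial : ℕ) : ℝ) ≤ (d + 1).factorial := by
    exact_mod_cast Nat.factorial_le (Nat.le_succ d)
  calc _ ≤ 1 * (Real.exp 1 * d.factorial) := mul_le_mul h2 h1 (by positivity) zero_le_one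
    _ ≤ kernelConst d := by
      unfold kernelConst
      have : Real.exp 1 * d.factorial ≤ Real.exp 1 * (d + 1).factorial := by gcongr
      have h5 : 0 ≤ Real.exp 1 * (d + 1).factorial := by positivity
      linarith

/-- One more power of `‖y‖` leaves a factor `√u`, which is harmless for `u ≤ 1`. The extra decay
makes the uniform bound integrable at infinity. -/
lemma heatKernel_mul_norm_pow_succ_le {u : ℝ} (hu1 : u ≤ 1) (y : Space d) :
    heatKernel u y * ‖y‖ ^ (d + 1) ≤ kernelConst d := by
  rcases le_or_gt u 0 with hu | hu
  · rw [heatKernel_of_nonpos hu, zero_mul]; linarith [one_le_kernelConst d]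
  have hs : 0 < √u := Real.sqrt_pos.2 hu
  have hs1 : √u ≤ 1 := Real.sqrt_le_one.2 hu1
  have h0 : heatKernel u y * ‖y‖ ^ (d + 1) = ((√Real.pi ^ d)⁻¹ * (2 * √u)) *
      ((‖y‖ / (2 * √u)) ^ (d + 1) * Real.exp (-(‖y‖ / (2 * √u)) ^ 2)) := by
    rw [heatKernel_mul_pow hu]
    generalize Real.exp (-(‖y‖ / (2 * √u)) ^ 2) = E
    rw [div_pow]
    field_simp
    ring
  rw [h0]
  have h1 := pow_mul_exp_neg_sq_le (v := ‖y‖ / (2 * √u)) (by positivity) (d + 1)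
  have h2 : (√Real.pi ^ d)⁻¹ ≤ 1 := inv_le_one_of_one_le₀ (one_le_pow₀ one_le_sqrt_pi)
  have h3 : (√Real.pi ^ d)⁻¹ * (2 * √u) ≤ 1 * (2 * 1) := by gcongr
  calc _ ≤ (1 * (2 * 1)) * (Real.exp 1 * (d + 1).factorial) :=
        mul_le_mul h3 h1 (by positivity) (by norm_num)
    _ = kernelConst d := by unfold kernelConst; ring

/-- On this parabolic box the exponent `‖y‖² / (4u)` is at most `1/2`, and the prefactor is smallest
at age `a`. -/
lemma le_heatKernel {a u : ℝ} (ha : 0 < a) (hu1 : a / 2 ≤ u) (hu2 : u ≤ a) {y : Space d}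
    (hy : ‖y‖ ^ 2 ≤ a) : (√(4 * Real.pi * a) ^ d)⁻¹ * Real.exp (-1) ≤ heatKernel u y := by
  have hu : 0 < u := by linarith
  rw [heatKernel_of_pos hu]
  refine mul_le_mul ?_ ?_ (by positivity) (by positivity)
  · gcongr
  · apply Real.exp_le_exp.2
    apply neg_le_neg
    rw [div_le_one (by positivity)]
    linarith

end HeatKernel

/-! ### The jump measure -/

section Intensity

variable {d : ℕ} {lam : Measure ℝ}

lemma sigmaFinite_of_integrable (h0 : lam {0} = 0) (hint : Integrable (fun z : ℝ => z) lam) :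
    SigmaFinite lam := by
  refine ⟨⟨{ set := fun n => {0} ∪ {z | (1 / ((n : ℝ) + 1)) ≤ |z|},
             set_mem := fun n => trivial, finite := fun n => ?_, spanning := ?_ }⟩⟩
  · refine (measure_union_le _ _).trans_lt ?_
    rw [h0, zero_add]
    have := hint.norm.measure_ge_lt_top (ε := 1 / ((n : ℝ) + 1)) (by positivity)
    simpa [Real.norm_eq_abs] using this
  · refine Set.eq_univ_of_forall fun z => Set.mem_iUnion.2 ?_
    by_cases hz : z = 0
    · exact ⟨0, Or.inl hz⟩
    · obtain ⟨n, hn⟩ := exists_nat_one_div_lt (abs_pos.2 hz)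
      exact ⟨n, Or.inr hn.le⟩

instance [SigmaFinite lam] : SigmaFinite (intensity d lam) := by
  unfold intensity; infer_instance

lemma lintegral_intensity [SigmaFinite lam] {h : JumpSpace d → ℝ≥0∞} (hh : Measurable h) :
    ∫⁻ q, h q ∂(intensity d lam) =
      ∫⁻ s in Set.Ioi (0 : ℝ), ∫⁻ y : Space d, ∫⁻ z, h (s, y, z) ∂lam := by
  rw [intensity, lintegral_prod _ hh.aemeasurable]
  refine lintegral_congr fun s => ?_
  rw [lintegral_prod _ (by fun_prop)]

lemma intensity_restrict [SigmaFinite lam] {S : Set ℝ} :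
    intensity d (lam.restrict S) = (intensity d lam).restrict {q | q.2.2 ∈ S} := by
  have h : {q : JumpSpace d | q.2.2 ∈ S} = Set.univ ×ˢ (Set.univ ×ˢ S) := by ext q; simp
  rw [h, intensity, intensity, ← Measure.prod_restrict, ← Measure.prod_restrict]
  simp

lemma lintegral_intensity_mul [SigmaFinite lam] {k : ℝ → Space d → ℝ≥0∞}
    (hk : Measurable fun p : ℝ × Space d => k p.1 p.2) {w : ℝ → ℝ≥0∞} (hw : Measurable w) :
    ∫⁻ q, k q.1 q.2.1 * w q.2.2 ∂(intensity d lam) =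
      (∫⁻ s in Set.Ioi (0 : ℝ), ∫⁻ y : Space d, k s y) * ∫⁻ z, w z ∂lam := by
  rw [lintegral_intensity (by fun_prop)]
  have h1 : ∀ s (y : Space d), ∫⁻ z, k s y * w z ∂lam = k s y * ∫⁻ z, w z ∂lam :=
    fun s y => lintegral_const_mul _ hw
  simp_rw [h1]
  rw [← lintegral_mul_const]
  · refine lintegral_congr fun s => ?_
    rw [lintegral_mul_const]
    fun_prop
  · exact Measurable.lintegral_prod_right' (f := fun p : ℝ × Space d => k p.1 p.2) hk

/-- The kernel has spatial mass one at each positive age, so only the length of the time set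
remains. -/
lemma lintegral_intensity_heatKernel [SigmaFinite lam] (T : ℝ) {A : Set ℝ} (hA : MeasurableSet A)
    {w : ℝ → ℝ≥0∞} (hw : Measurable w) :
    ∫⁻ q : JumpSpace d, A.indicator 1 q.1 * ENNReal.ofReal (heatKernel (T - q.1) q.2.1) * w q.2.2
        ∂(intensity d lam) = volume (A ∩ Set.Ioo 0 T) * ∫⁻ z, w z ∂lam := by
  have hind : Measurable (A.indicator (1 : ℝ → ℝ≥0∞)) := measurable_one.indicator hA
  rw [lintegral_intensity_mul
    (k := fun s (y : Space d) => A.indicator 1 s * ENNReal.ofReal (heatKernel (T - s) y))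
    (by fun_prop) hw]
  congr 1
  have h1 : ∀ s, ∫⁻ y : Space d, A.indicator 1 s * ENNReal.ofReal (heatKernel (T - s) y) =
      (A ∩ Set.Iio T).indicator 1 s := by
    intro s
    rw [lintegral_const_mul _ (by fun_prop)]
    by_cases hs : s < T
    · rw [lintegral_heatKernel (by linarith), mul_one]
      by_cases hsA : s ∈ A <;> simp [hsA, hs]
    · simp [heatKernel_of_nonpos (sub_nonpos.2 (not_lt.1 hs)), hs]
  simp_rw [h1]
  rw [lintegral_indicator_one (hA.inter measurableSet_Iio),
    Measure.restrict_apply (hA.inter measurableSet_Iio)]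
  congr 1
  ext s
  simp only [Set.mem_inter_iff, Set.mem_Iio, Set.mem_Ioi, Set.mem_Ioo]
  tauto

lemma IsPoissonRandomMeasure.restrict {Ω E : Type*} [MeasurableSpace Ω] [MeasurableSpace E]
    {P : Measure Ω} {ν : Measure E} {μ : Ω → Measure E} (hμ : IsPoissonRandomMeasure P ν μ)
    {D : Set E} (hD : MeasurableSet D) :
    IsPoissonRandomMeasure P (ν.restrict D) fun ω => (μ ω).restrict D where
  measurable := by
    refine Measure.measurable_of_measurable_coe _ fun A hA => ?_
    simp_rw [Measure.restrict_apply hA]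
    exact hμ.measurable_apply (hA.inter hD)
  law A hA h := by
    simp_rw [Measure.restrict_apply hA] at h ⊢
    exact hμ.law _ (hA.inter hD) h
  indep n A hA hd := by
    have := hμ.indep n (fun i => A i ∩ D) (fun i => (hA i).inter hD)
      fun i j hij => (hd hij).mono Set.inter_subset_left Set.inter_subset_left
    simpa only [Measure.restrict_apply (hA _)] using this

/-- The sum of the absolute jump sizes, weighted by the heat kernel. -/
noncomputable def jumpSum {d : ℕ} (N : Measure (JumpSpace d)) (t : ℝ) : ℝ≥0∞ :=
  ∫⁻ q, ENNReal.ofReal (heatKernel (t - q.1) q.2.1 * |q.2.2|) ∂N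

/-- The first absolute moment of the jump sizes. -/
noncomputable def absMean (lam : Measure ℝ) : ℝ := ∫ z, |z| ∂lam

lemma absMean_nonneg (lam : Measure ℝ) : 0 ≤ absMean lam := integral_nonneg fun z => abs_nonneg z

lemma lintegral_abs (hint : Integrable (fun z : ℝ => z) lam) :
    ∫⁻ z, ENNReal.ofReal |z| ∂lam = ENNReal.ofReal (absMean lam) :=
  (ofReal_integral_eq_lintegral_ofReal hint.abs (ae_of_all _ fun z => abs_nonneg z)).symm

lemma measurable_jumpSum_integrand (t : ℝ) : Measurable fun q : JumpSpace d =>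
    ENNReal.ofReal (heatKernel (t - q.1) q.2.1 * |q.2.2|) := by fun_prop

lemma lintegral_intensity_jumpSum [SigmaFinite lam] (hint : Integrable (fun z : ℝ => z) lam)
    (t : ℝ) : jumpSum (intensity d lam) t = ENNReal.ofReal (t * absMean lam) := by
  rcases le_or_gt t 0 with ht | ht
  · rw [jumpSum, ENNReal.ofReal_of_nonpos (mul_nonpos_of_nonpos_of_nonneg ht (absMean_nonneg lam)),
      lintegral_intensity (by fun_prop)]
    refine (setLIntegral_congr_fun measurableSet_Ioi (g := fun _ => 0) fun s hs => ?_).trans (by simp)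
    have hs' : t - s ≤ 0 := by have := Set.mem_Ioi.1 hs; linarith
    simp [heatKernel_of_nonpos hs']
  · have := lintegral_intensity_heatKernel (d := d) (lam := lam) t MeasurableSet.univ
      (w := fun z => ENNReal.ofReal |z|) (by fun_prop)
    rw [Set.univ_inter, Real.volume_Ioo, sub_zero, lintegral_abs hint,
      ← ENNReal.ofReal_mul ht.le] at this
    rw [jumpSum, ← this]
    refine lintegral_congr fun q => ?_
    simp [ENNReal.ofReal_mul (heatKernel_nonneg _ _)]

variable {Ω : Type*} [MeasurableSpace Ω] {P : Measure Ω} {μ : Ω → Measure (JumpSpace d)}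

lemma measurable_jumpSum (hμ : IsPoissonRandomMeasure P (intensity d lam) μ) (t : ℝ) :
    Measurable fun ω => jumpSum (μ ω) t :=
  hμ.measurable_lintegral (measurable_jumpSum_integrand t)

lemma lintegral_jumpSum [SigmaFinite lam] (hint : Integrable (fun z : ℝ => z) lam)
    (hμ : IsPoissonRandomMeasure P (intensity d lam) μ) (t : ℝ) :
    ∫⁻ ω, jumpSum (μ ω) t ∂P = ENNReal.ofReal (t * absMean lam) := by
  rw [← lintegral_intensity_jumpSum (d := d) hint t]
  exact hμ.lintegral_lintegral (measurable_jumpSum_integrand t)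

lemma ae_jumpSum_lt_top [SigmaFinite lam] (hint : Integrable (fun z : ℝ => z) lam)
    (hμ : IsPoissonRandomMeasure P (intensity d lam) μ) (t : ℕ → ℝ) :
    ∀ᵐ ω ∂P, ∀ n, jumpSum (μ ω) (t n) < ∞ := by
  rw [ae_all_iff]
  intro n
  refine ae_lt_top (measurable_jumpSum hμ _) ?_
  rw [lintegral_jumpSum hint hμ]
  exact ENNReal.ofReal_ne_top

end Intensity

/-! ### The law of large numbers from below -/

section LowerBound

variable {d : ℕ} {lam : Measure ℝ} {Ω : Type*} [MeasurableSpace Ω] {P : Measure Ω}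
  {μ : Ω → Measure (JumpSpace d)}

/-- Jump sizes truncated at level `M`. -/
noncomputable def truncAbs (M : ℝ) (z : ℝ) : ℝ≥0∞ := {z : ℝ | |z| ≤ M}.indicator (fun z => ENNReal.ofReal |z|) z

lemma measurable_truncAbs (M : ℝ) : Measurable (truncAbs M) :=
  Measurable.indicator (by fun_prop) (measurableSet_le (by fun_prop) measurable_const)

lemma truncAbs_le (M z : ℝ) : truncAbs M z ≤ ENNReal.ofReal |z| :=
  Set.indicator_le_self _ _ z

lemma truncAbs_le_const (M z : ℝ) : truncAbs M z ≤ ENNReal.ofReal M := by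
  unfold truncAbs
  by_cases h : |z| ≤ M
  · have : z ∈ {z : ℝ | |z| ≤ M} := h
    rw [Set.indicator_of_mem this]
    exact ENNReal.ofReal_le_ofReal h
  · have : z ∉ {z : ℝ | |z| ≤ M} := h
    rw [Set.indicator_of_notMem this]
    exact zero_le

lemma exists_lt_lintegral_truncAbs (hint : Integrable (fun z : ℝ => z) lam) {c : ℝ} (hc0 : 0 ≤ c)
    (hc : c < absMean lam) : ∃ M : ℕ, 0 < M ∧ ENNReal.ofReal c < ∫⁻ z, truncAbs M z ∂lam := by
  have hsup : ∫⁻ z, ENNReal.ofReal |z| ∂lam = ⨆ M : ℕ, ∫⁻ z, truncAbs M z ∂lam := by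
    rw [← lintegral_iSup (fun M => measurable_truncAbs _)]
    · refine lintegral_congr fun z => le_antisymm ?_ (iSup_le fun M => truncAbs_le _ _)
      obtain ⟨M, hM⟩ := exists_nat_ge |z|
      refine le_trans ?_ (le_iSup (fun M : ℕ => truncAbs M z) M)
      have : z ∈ {z : ℝ | |z| ≤ M} := hM
      rw [truncAbs, Set.indicator_of_mem this]
    · intro M M' hM z
      refine Set.indicator_le_indicator_of_subset (fun z hz => ?_) (fun _ => zero_le) z
      exact le_trans (show |z| ≤ M from hz) (by exact_mod_cast hM)
  have h1 : ENNReal.ofReal c < ⨆ M : ℕ, ∫⁻ z, truncAbs M z ∂lam := by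
    rw [← hsup, lintegral_abs hint, ENNReal.ofReal_lt_ofReal_iff (hc0.trans_lt hc)]
    exact hc
  obtain ⟨M, hM⟩ := lt_iSup_iff.1 h1
  refine ⟨M, Nat.pos_of_ne_zero ?_, hM⟩
  rintro rfl
  have : ∫⁻ z, truncAbs ((0 : ℕ) : ℝ) z ∂lam = 0 := by
    have : ∀ z, truncAbs ((0 : ℕ) : ℝ) z = 0 := fun z =>
      le_antisymm ((truncAbs_le_const _ z).trans (by simp)) zero_le
    simp_rw [this, lintegral_zero]
  rw [this] at hM
  exact not_lt_zero hM

/-- The sum of the truncated jumps before time `k - L`. -/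
noncomputable def oldSum (N : Measure (JumpSpace d)) (L M k : ℝ) : ℝ≥0∞ :=
  ∫⁻ q, (Set.Iio (k - L)).indicator 1 q.1 * ENNReal.ofReal (heatKernel (k - q.1) q.2.1) *
    truncAbs M q.2.2 ∂N

lemma measurable_oldSum_integrand (L M k : ℝ) : Measurable fun q : JumpSpace d =>
    (Set.Iio (k - L)).indicator 1 q.1 * ENNReal.ofReal (heatKernel (k - q.1) q.2.1) *
      truncAbs M q.2.2 := by
  have h1 : Measurable ((Set.Iio (k - L)).indicator (1 : ℝ → ℝ≥0∞)) :=
    measurable_one.indicator measurableSet_Iio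
  have h2 := measurable_truncAbs M
  fun_prop

/-- At ages above `1 / e ≥ 1` the kernel is at most one, so the truncated contributions are at most
`M`. After scaling by `e / M` the integrand is bounded by `e`, and the lower tail bound applies with
`b = e`. -/
lemma measure_oldSum_le [SigmaFinite lam] (hμ : IsPoissonRandomMeasure P (intensity d lam) μ)
    {e M m' k : ℝ} (he : 0 < e) (he1 : e < 1) (hM : 0 < M) (hm' : 0 < m')
    (hm : ENNReal.ofReal m' < ∫⁻ z, truncAbs M z ∂lam) (hk : 1 / e < k) :
    P {ω | oldSum (μ ω) (1 / e) M k ≤ ENNReal.ofReal ((1 - e) ^ 2 * m' * (k - 1 / e))} ≤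
      ENNReal.ofReal (Real.exp (-(e / M * (1 - e) * e * m' * (k - 1 / e)))) := by
  have hθ : 0 < e / M := div_pos he hM
  have hL : 1 ≤ 1 / e := by rw [le_div_iff₀ he]; linarith
  have h1 : Measurable fun q : JumpSpace d => ENNReal.ofReal (e / M) *
    ((Set.Iio (k - 1 / e)).indicator 1 q.1 * ENNReal.ofReal (heatKernel (k - q.1) q.2.1) *
      truncAbs M q.2.2) := (measurable_oldSum_integrand _ _ _).const_mul _
  have hbd : ∀ q : JumpSpace d, ENNReal.ofReal (e / M) *
    ((Set.Iio (k - 1 / e)).indicator 1 q.1 * ENNReal.ofReal (heatKernel (k - q.1) q.2.1) *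
      truncAbs M q.2.2) ≤ ENNReal.ofReal e := by
    intro q
    have h2 : (Set.Iio (k - 1 / e)).indicator 1 q.1 * ENNReal.ofReal (heatKernel (k - q.1) q.2.1)
        ≤ 1 := by
      by_cases hq : q.1 ∈ Set.Iio (k - 1 / e)
      · rw [Set.indicator_of_mem hq, Pi.one_apply, one_mul, ENNReal.ofReal_le_one]
        apply heatKernel_le_one
        have := Set.mem_Iio.1 hq
        linarith
      · rw [Set.indicator_of_notMem hq, zero_mul]; exact zero_le
    calc _ ≤ ENNReal.ofReal (e / M) * (1 * ENNReal.ofReal M) := by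
          gcongr; exact truncAbs_le_const _ _
      _ = ENNReal.ofReal e := by
          rw [one_mul, ← ENNReal.ofReal_mul hθ.le, div_mul_cancel₀ _ hM.ne']
  have hI : ENNReal.ofReal (e / M * ((k - 1 / e) * m')) < ∫⁻ q : JumpSpace d,
      ENNReal.ofReal (e / M) * ((Set.Iio (k - 1 / e)).indicator 1 q.1 *
        ENNReal.ofReal (heatKernel (k - q.1) q.2.1) * truncAbs M q.2.2) ∂(intensity d lam) := by
    rw [lintegral_const_mul _ (measurable_oldSum_integrand _ _ _),
      lintegral_intensity_heatKernel k measurableSet_Iio (measurable_truncAbs M)]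
    have h3 : Set.Iio (k - 1 / e) ∩ Set.Ioo 0 k = Set.Ioo 0 (k - 1 / e) := by
      ext s
      simp only [Set.mem_inter_iff, Set.mem_Iio, Set.mem_Ioo]
      constructor
      · rintro ⟨a, b, c⟩; exact ⟨b, a⟩
      · rintro ⟨a, b⟩; exact ⟨b, a, by linarith⟩
    rw [h3, Real.volume_Ioo, sub_zero, ENNReal.ofReal_mul hθ.le,
      ENNReal.ofReal_mul (by linarith)]
    have p1 : ENNReal.ofReal (e / M) ≠ 0 := by simpa using hθ
    have p2 : ENNReal.ofReal (k - 1 / e) ≠ 0 := by simpa using hk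
    gcongr <;> simp
  have key := hμ.measure_lintegral_le_le h1 hbd he.le he1.le hI
    (x := e / M * ((1 - e) ^ 2 * m' * (k - 1 / e)))
    (by have : 0 < k - 1 / e := by linarith
        positivity)
  refine (measure_mono fun ω hω => ?_).trans (key.trans (le_of_eq ?_))
  · simp only [Set.mem_ofPred_eq] at hω ⊢
    rw [lintegral_const_mul _ (measurable_oldSum_integrand _ _ _), ENNReal.ofReal_mul hθ.le]
    exact mul_le_mul_right hω _
  · congr 2
    ring

lemma ae_eventually_lt_oldSum [SigmaFinite lam] (hμ : IsPoissonRandomMeasure P (intensity d lam) μ)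
    {e M m' : ℝ} (he : 0 < e) (he1 : e < 1) (hM : 0 < M) (hm' : 0 < m')
    (hm : ENNReal.ofReal m' < ∫⁻ z, truncAbs M z ∂lam) :
    ∀ᵐ ω ∂P, ∀ᶠ k : ℕ in atTop,
      ENNReal.ofReal ((1 - e) ^ 2 * m' * (k - 1 / e)) < oldSum (μ ω) (1 / e) M k := by
  obtain ⟨k0, hk0⟩ := exists_nat_gt (1 / e)
  have hr : 0 < e / M * (1 - e) * e * m' := by
    have : 0 < 1 - e := by linarith
    positivity
  set r := e / M * (1 - e) * e * m' with hrdef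
  -- The shift by `k0` starts the series where the tail bound is available; from there it is
  -- dominated by a geometric series.
  have hsum : ∑' k : ℕ, P {ω | oldSum (μ ω) (1 / e) M ((k + k0 : ℕ) : ℝ) ≤
      ENNReal.ofReal ((1 - e) ^ 2 * m' * (((k + k0 : ℕ) : ℝ) - 1 / e))} ≠ ∞ := by
    have hb : ∀ k : ℕ, P {ω | oldSum (μ ω) (1 / e) M ((k + k0 : ℕ) : ℝ) ≤
        ENNReal.ofReal ((1 - e) ^ 2 * m' * (((k + k0 : ℕ) : ℝ) - 1 / e))} ≤
          ENNReal.ofReal (Real.exp (-r) ^ k) := by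
      intro k
      have hk1 : 1 / e < ((k + k0 : ℕ) : ℝ) := by
        push_cast
        have : (0 : ℝ) ≤ k := Nat.cast_nonneg k
        linarith
      refine (measure_oldSum_le hμ he he1 hM hm' hm hk1).trans (ENNReal.ofReal_le_ofReal ?_)
      rw [← Real.exp_nat_mul]
      apply Real.exp_le_exp.2
      rw [← hrdef]
      push_cast
      nlinarith
    refine ne_top_of_le_ne_top ?_ (ENNReal.tsum_le_tsum hb)
    have hs : Summable fun k : ℕ => Real.exp (-r) ^ k :=
      summable_geometric_of_lt_one (Real.exp_pos _).le (Real.exp_lt_one_iff.2 (by linarith))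
    rw [← ENNReal.ofReal_tsum_of_nonneg (fun k => by positivity) hs]
    exact ENNReal.ofReal_ne_top
  filter_upwards [ae_eventually_notMem hsum] with ω hω
  obtain ⟨n0, hn0⟩ := eventually_atTop.1 hω
  refine eventually_atTop.2 ⟨n0 + k0, fun k hk => ?_⟩
  have := hn0 (k - k0) (by omega)
  rw [Nat.sub_add_cancel (by omega)] at this
  exact not_le.1 this

/-- Ages above `1 / e` grow by a factor of at most `1 + e` within one unit of time, so the kernel
loses at most `(1 + e) ^ d`. This carries bounds at integer times over to all real times. -/
lemma oldSum_le_jumpSum (N : Measure (JumpSpace d)) {e M k x : ℝ} (he : 0 < e) (hkx : k ≤ x)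
    (hxk : x ≤ k + 1) :
    oldSum N (1 / e) M k ≤ ENNReal.ofReal ((1 + e) ^ d) * jumpSum N x := by
  rw [oldSum, jumpSum, ← lintegral_const_mul _ (measurable_jumpSum_integrand x)]
  refine lintegral_mono fun q => ?_
  by_cases hq : q.1 ∈ Set.Iio (k - 1 / e)
  · have hq' := Set.mem_Iio.1 hq
    have hu : 1 / e < k - q.1 := by linarith
    have hu0 : 0 < k - q.1 := lt_trans (by positivity) hu
    have h1 : 1 ≤ e * (k - q.1) := by
      rw [div_lt_iff₀ he] at hu; linarith
    rw [Set.indicator_of_mem hq, Pi.one_apply, one_mul,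
      ENNReal.ofReal_mul (heatKernel_nonneg _ _), ← mul_assoc, ← ENNReal.ofReal_mul (by positivity)]
    refine mul_le_mul' (ENNReal.ofReal_le_ofReal ?_) (truncAbs_le _ _)
    exact heatKernel_le_mul hu0 (by linarith) (by linarith) he.le _
  · rw [Set.indicator_of_notMem hq, zero_mul, zero_mul]
    exact zero_le

lemma exists_small_param {c m' : ℝ} (hcm : c < m') (d : ℕ) :
    ∃ e : ℝ, 0 < e ∧ e < 1 ∧ (1 + e) ^ d * c < (1 - e) ^ 2 * m' := by
  have hcont : ContinuousAt (fun e : ℝ => (1 - e) ^ 2 * m' - (1 + e) ^ d * c) 0 := by fun_prop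
  have h0 : 0 < (fun e : ℝ => (1 - e) ^ 2 * m' - (1 + e) ^ d * c) 0 := by simpa using hcm
  have h1 : ∀ᶠ e in 𝓝[>] (0 : ℝ), 0 < (1 - e) ^ 2 * m' - (1 + e) ^ d * c :=
    (hcont.eventually_const_lt h0).filter_mono nhdsWithin_le_nhds
  have h2 : ∀ᶠ e in 𝓝[>] (0 : ℝ), e ∈ Set.Ioo (0 : ℝ) 1 := Ioo_mem_nhdsGT one_pos
  obtain ⟨e, he, he'⟩ := (h1.and h2).exists
  exact ⟨e, he'.1, he'.2, by linarith⟩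

lemma ae_eventually_le_jumpSum_of_lt [SigmaFinite lam] (hint : Integrable (fun z : ℝ => z) lam)
    (hμ : IsPoissonRandomMeasure P (intensity d lam) μ) {c : ℝ} (hc : c < absMean lam) :
    ∀ᵐ ω ∂P, ∀ᶠ x : ℝ in atTop, ENNReal.ofReal (c * x) ≤ jumpSum (μ ω) x := by
  rcases le_or_gt c 0 with hc0 | hc0
  · refine ae_of_all _ fun ω => ?_
    filter_upwards [eventually_ge_atTop 0] with x hx
    rw [ENNReal.ofReal_of_nonpos (mul_nonpos_of_nonpos_of_nonneg hc0 hx)]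
    exact zero_le
  obtain ⟨m', hcm, hm'⟩ := exists_between hc
  have hm'0 : 0 < m' := hc0.trans hcm
  obtain ⟨M, hM0, hM⟩ := exists_lt_lintegral_truncAbs hint hm'0.le hm'
  obtain ⟨e, he, he1, hec⟩ := exists_small_param hcm d
  filter_upwards [ae_eventually_lt_oldSum hμ he he1 (Nat.cast_pos.2 hM0) hm'0 hM] with ω hω
  have hfl : Tendsto (fun x : ℝ => ⌊x⌋₊) atTop atTop := tendsto_nat_floor_atTop
  have hgap : 0 < (1 - e) ^ 2 * m' - (1 + e) ^ d * c := by linarith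
  -- Beyond the last threshold, the linear gap between the two slopes outweighs the cost of rounding
  -- `x` down and of discarding the most recent `1 / e` units of time.
  filter_upwards [hfl.eventually hω, eventually_ge_atTop 0,
    eventually_ge_atTop ((1 - e) ^ 2 * m' * (1 + 1 / e) / ((1 - e) ^ 2 * m' - (1 + e) ^ d * c))]
    with x hx hx0 hx1
  have h1 : (⌊x⌋₊ : ℝ) ≤ x := Nat.floor_le hx0
  have h2 : x < ⌊x⌋₊ + 1 := Nat.lt_floor_add_one x
  have h3 := hx.le.trans (oldSum_le_jumpSum (μ ω) he h1 h2.le)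
  rw [div_le_iff₀ hgap] at hx1
  have h4 : (1 + e) ^ d * (c * x) ≤ (1 - e) ^ 2 * m' * (⌊x⌋₊ - 1 / e) := by
    have : (1 - e) ^ 2 * m' * (x - 1 - 1 / e) ≤ (1 - e) ^ 2 * m' * (⌊x⌋₊ - 1 / e) :=
      mul_le_mul_of_nonneg_left (by linarith) (by positivity)
    linarith
  have h5 := (ENNReal.ofReal_le_ofReal h4).trans h3
  rw [ENNReal.ofReal_mul (by positivity)] at h5
  refine (ENNReal.mul_le_mul_iff_right ?_ ENNReal.ofReal_ne_top).1 h5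
  simpa using (by positivity : 0 < (1 + e) ^ d)

/-- Almost surely, the lower limit of `jumpSum x / x` is at least the mean. -/
lemma ae_eventually_le_jumpSum [SigmaFinite lam] (hint : Integrable (fun z : ℝ => z) lam)
    (hμ : IsPoissonRandomMeasure P (intensity d lam) μ) :
    ∀ᵐ ω ∂P, ∀ c < absMean lam, ∀ᶠ x : ℝ in atTop, ENNReal.ofReal (c * x) ≤ jumpSum (μ ω) x := by
  have h : ∀ᵐ ω ∂P, ∀ r : ℚ, (r : ℝ) < absMean lam →
      ∀ᶠ x : ℝ in atTop, ENNReal.ofReal (r * x) ≤ jumpSum (μ ω) x := by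
    rw [ae_all_iff]
    intro r
    by_cases hr : (r : ℝ) < absMean lam
    · filter_upwards [ae_eventually_le_jumpSum_of_lt hint hμ hr] with ω hω _ using hω
    · exact ae_of_all _ fun ω h => absurd h hr
  filter_upwards [h] with ω hω c hc
  obtain ⟨r, hcr, hr⟩ := exists_rat_btwn hc
  filter_upwards [hω r hr, eventually_ge_atTop 0] with x hx hx0
  refine le_trans (ENNReal.ofReal_le_ofReal ?_) hx
  exact mul_le_mul_of_nonneg_right hcr.le hx0

/-- Along a sequence, the lower limit of `jumpSum (t n) / F n` is at most the limit of the means. -/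
lemma ae_frequently_jumpSum_lt [SigmaFinite lam] [IsProbabilityMeasure P]
    (hint : Integrable (fun z : ℝ => z) lam)
    (hμ : IsPoissonRandomMeasure P (intensity d lam) μ) {t F : ℕ → ℝ} {κ : ℝ} (hκ0 : 0 ≤ κ)
    (hF : ∀ᶠ n in atTop, 0 < F n) (ht : Tendsto t atTop atTop)
    (hκ : Tendsto (fun n => t n / F n) atTop (𝓝 κ)) :
    ∀ᵐ ω ∂P, ∀ c, κ * absMean lam < c →
      ∃ᶠ n in atTop, jumpSum (μ ω) (t n) < ENNReal.ofReal (c * F n) := by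
  have hm := absMean_nonneg lam
  set D : ℕ → Ω → ℝ≥0∞ := fun n ω => jumpSum (μ ω) (t n) / ENNReal.ofReal (F n) with hD
  have hDm : ∀ n, Measurable (D n) := fun n => (measurable_jumpSum hμ _).div_const _
  have hlow : (fun _ => ENNReal.ofReal (κ * absMean lam)) ≤ᵐ[P] fun ω => liminf (fun n => D n ω) atTop := by
    filter_upwards [ae_eventually_le_jumpSum hint hμ] with ω hω
    have h1 : ∀ c < absMean lam,
        ENNReal.ofReal (c * κ) ≤ liminf (fun n => D n ω) atTop := by
      intro c hc
      have h2 : Tendsto (fun n => ENNReal.ofReal (c * (t n / F n))) atTop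
          (𝓝 (ENNReal.ofReal (c * κ))) := ENNReal.tendsto_ofReal (hκ.const_mul c)
      rw [← h2.liminf_eq]
      refine liminf_le_liminf ?_
      filter_upwards [ht.eventually (hω c hc), hF] with n hn hFn
      rw [hD, ← mul_div_assoc, ENNReal.ofReal_div_of_pos hFn]
      exact ENNReal.div_le_div_right hn _
    have h3 : Tendsto (fun c : ℝ => ENNReal.ofReal (c * κ)) (𝓝[<] (absMean lam))
        (𝓝 (ENNReal.ofReal (absMean lam * κ))) :=
      (ENNReal.tendsto_ofReal ((continuous_id.mul continuous_const).tendsto _)).mono_left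
        nhdsWithin_le_nhds
    rw [mul_comm]
    refine le_of_tendsto h3 ?_
    filter_upwards [self_mem_nhdsWithin] with c hc using h1 c hc
  -- By Fatou's lemma and Campbell's formula the mean of the lower limit is at most `κ * absMean
  -- lam`. Since `hlow` bounds the lower limit below by the same constant, the two agree almost
  -- surely.
  have hup : ∫⁻ ω, liminf (fun n => D n ω) atTop ∂P ≤ ∫⁻ _, ENNReal.ofReal (κ * absMean lam) ∂P := by
    refine (lintegral_liminf_le hDm).trans ?_
    rw [lintegral_const, measure_univ, mul_one]
    have h2 : Tendsto (fun n => ENNReal.ofReal (t n / F n * absMean lam)) atTop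
        (𝓝 (ENNReal.ofReal (κ * absMean lam))) := ENNReal.tendsto_ofReal (hκ.mul_const _)
    rw [← h2.liminf_eq]
    refine liminf_le_liminf ?_
    filter_upwards [hF] with n hFn
    simp only [hD, div_eq_mul_inv]
    rw [lintegral_mul_const _ (measurable_jumpSum hμ _), lintegral_jumpSum hint hμ,
      ← div_eq_mul_inv, ← ENNReal.ofReal_div_of_pos hFn]
    exact ENNReal.ofReal_le_ofReal (le_of_eq (by ring))
  have heq := ae_eq_of_ae_le_of_lintegral_le hlow (by simp)
    (Measurable.liminf hDm).aemeasurable hup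
  filter_upwards [heq] with ω hω c hc
  have hlt : liminf (fun n => D n ω) atTop < ENNReal.ofReal c := by
    rw [← hω, ENNReal.ofReal_lt_ofReal_iff (lt_of_le_of_lt (by positivity) hc)]
    exact hc
  refine ((frequently_lt_of_liminf_lt (by isBoundedDefault) hlt).and_eventually hF).mono ?_
  rintro n ⟨h1, hFn⟩
  simp only [hD] at h1
  have hF0 : ENNReal.ofReal (F n) ≠ 0 := by simpa using hFn
  rw [ENNReal.div_lt_iff (Or.inl hF0) (Or.inl ENNReal.ofReal_ne_top)] at h1
  rwa [ENNReal.ofReal_mul' hFn.le]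

end LowerBound

/-! ### Greedy selection of separated times -/

section Greedy

variable {t a w : ℕ → ℝ}

/-- `n` is a greedy selection of indices starting at `N`: each selected time is the first one that
exceeds the previous one by more than the value of `a` there. -/
structure IsGreedy (t a : ℕ → ℝ) (N : ℕ) (n : ℕ → ℕ) : Prop where
  zero : n 0 = N
  gap : ∀ j, t (n j) + a (n j) < t (n (j + 1))
  le_of_lt : ∀ j k, k < n (j + 1) → t k ≤ t (n j) + a (n j)

lemma exists_isGreedy (ht : Tendsto t atTop atTop) (N : ℕ) : ∃ n, IsGreedy t a N n := by
  classical
  have hex : ∀ i, ∃ k, t i + a i < t k := fun i => (ht.eventually_gt_atTop _).exists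
  refine ⟨fun j => Nat.rec N (fun _ i => Nat.find (hex i)) j, rfl, fun j => ?_, fun j k hk => ?_⟩
  · exact Nat.find_spec (hex _)
  · exact not_lt.1 (Nat.find_min (hex _) hk)

namespace IsGreedy

variable {N : ℕ} {n : ℕ → ℕ}

lemma strictMono (h : IsGreedy t a N n) (htm : Monotone t) (ha : ∀ k, N ≤ k → 0 < a k) :
    StrictMono n := by
  have key : ∀ j, N ≤ n j ∧ n j < n (j + 1) := by
    intro j
    induction j with
    | zero =>
      refine ⟨h.zero.ge, ?_⟩
      by_contra hlt
      have := htm (not_lt.1 hlt)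
      linarith [h.gap 0, ha _ h.zero.ge]
    | succ j ih =>
      have hN : N ≤ n (j + 1) := ih.1.trans ih.2.le
      refine ⟨hN, ?_⟩
      by_contra hlt
      have := htm (not_lt.1 hlt)
      linarith [h.gap (j + 1), ha _ hN]
  exact strictMono_nat_of_lt_succ fun j => (key j).2

lemma le_apply (h : IsGreedy t a N n) (htm : Monotone t) (ha : ∀ k, N ≤ k → 0 < a k) (j : ℕ) :
    N ≤ n j := by
  rw [← h.zero]; exact (h.strictMono htm ha).monotone (Nat.zero_le j)

lemma exists_mem_block (h : IsGreedy t a N n) (htm : Monotone t) (ha : ∀ k, N ≤ k → 0 < a k)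
    {k : ℕ} (hk : N ≤ k) : ∃ j, n j ≤ k ∧ k < n (j + 1) := by
  have hsm := h.strictMono htm ha
  have hex : ∃ j, k < n (j + 1) := ⟨k, lt_of_lt_of_le (Nat.lt_succ_self k) (hsm.le_apply)⟩
  classical
  refine ⟨Nat.find hex, ?_, Nat.find_spec hex⟩
  by_cases h0 : Nat.find hex = 0
  · rw [h0, h.zero]; exact hk
  · obtain ⟨i, hi⟩ := Nat.exists_eq_succ_of_ne_zero h0
    rw [hi]
    exact not_lt.1 (Nat.find_min hex (m := i) (by omega))

end IsGreedy

/-- Truncation of nonnegative numbers at a fixed level is subadditive, and the increments telescope.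
-/
lemma min_le_sum_min (htm : Monotone t) {A : ℝ} (hA : 0 ≤ A) {p q : ℕ} (hpq : p ≤ q) :
    min A (t q - t p) ≤ ∑ k ∈ Finset.Ico p q, min A (t (k + 1) - t k) := by
  induction q, hpq using Nat.le_induction with
  | base => simp [hA]
  | succ q hpq ih =>
    rw [Finset.sum_Ico_succ_top hpq]
    have h1 : 0 ≤ t (q + 1) - t q := sub_nonneg.2 (htm (Nat.le_succ q))
    have h2 : 0 ≤ t q - t p := sub_nonneg.2 (htm hpq)
    refine le_trans ?_ (add_le_add_left ih _)
    rcases le_total A (t q - t p) with h3 | h3 <;> rcases le_total A (t (q + 1) - t q) with h4 | h4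
    · rw [min_eq_left h3, min_eq_left h4]; exact (min_le_left _ _).trans (by linarith)
    · rw [min_eq_left h3, min_eq_right h4]; exact (min_le_left _ _).trans (by linarith)
    · rw [min_eq_right h3, min_eq_left h4]; exact (min_le_left _ _).trans (by linarith)
    · rw [min_eq_right h3, min_eq_right h4]; exact (min_le_right _ _).trans (by linarith)

/-- Over a block the time gap exceeds `a` at its start, hence also `a` at its end, so the truncated
increments in the block add up to at least the latter. Monotonicity replaces the coefficients at the
end by those inside the block. -/
lemma IsGreedy.sum_le_sum {N : ℕ} {n : ℕ → ℕ} (h : IsGreedy t a N n) (htm : Monotone t)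
    (ha : ∀ k, N ≤ k → 0 < a k) (haa : ∀ k l, N ≤ k → k ≤ l → a l ≤ a k)
    (hw : ∀ k, N ≤ k → 0 ≤ w k) (hwa : ∀ k l, N ≤ k → k ≤ l → w l ≤ w k) (J : ℕ) :
    ∑ j ∈ Finset.range J, a (n (j + 1)) * w (n (j + 1)) ≤
      ∑ k ∈ Finset.Ico N (n J), min (a (k + 1)) (t (k + 1) - t k) * w (k + 1) := by
  have hsm := h.strictMono htm ha
  induction J with
  | zero => simp [h.zero]
  | succ J ih =>
    have hN := h.le_apply htm ha J
    have hJ : n J ≤ n (J + 1) := (hsm (Nat.lt_succ_self J)).le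
    rw [Finset.sum_range_succ, ← Finset.sum_Ico_consecutive _ hN hJ]
    refine add_le_add ih ?_
    have h1 := min_le_sum_min htm (ha _ (hN.trans hJ)).le hJ
    rw [min_eq_left] at h1
    · calc a (n (J + 1)) * w (n (J + 1)) ≤
          (∑ k ∈ Finset.Ico (n J) (n (J + 1)), min (a (n (J + 1))) (t (k + 1) - t k)) *
            w (n (J + 1)) := mul_le_mul_of_nonneg_right h1 (hw _ (hN.trans hJ))
        _ = ∑ k ∈ Finset.Ico (n J) (n (J + 1)), min (a (n (J + 1))) (t (k + 1) - t k) *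
            w (n (J + 1)) := Finset.sum_mul _ _ _
        _ ≤ _ := by
          refine Finset.sum_le_sum fun k hk => ?_
          obtain ⟨hk1, hk2⟩ := Finset.mem_Ico.1 hk
          have hNk : N ≤ k + 1 := by omega
          have hΔ : 0 ≤ t (k + 1) - t k := sub_nonneg.2 (htm (Nat.le_succ k))
          exact mul_le_mul (min_le_min_right _ (haa _ _ hNk hk2)) (hwa _ _ hNk hk2)
            (hw _ (hN.trans hJ)) (le_min (ha _ hNk).le hΔ)
    · have := haa _ _ hN hJ
      linarith [h.gap J]

/-- By minimality of the next greedy index, all increments of the block except the last add up to at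
most `a (n j)`. The last may be long and is bounded by the truncation instead. -/
lemma IsGreedy.sum_block_le {N : ℕ} {n : ℕ → ℕ} (h : IsGreedy t a N n) (htm : Monotone t)
    (ha : ∀ k, N ≤ k → 0 < a k)
    (hw : ∀ k, N ≤ k → 0 ≤ w k) (hwa : ∀ k l, N ≤ k → k ≤ l → w l ≤ w k) (j : ℕ) :
    ∑ k ∈ Finset.Ico (n j) (n (j + 1)), min (a (k + 1)) (t (k + 1) - t k) * w (k + 1) ≤
      a (n j) * w (n j) + a (n (j + 1)) * w (n (j + 1)) := by
  have hN := h.le_apply htm ha j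
  have hlt : n j < n (j + 1) := h.strictMono htm ha (Nat.lt_succ_self j)
  obtain ⟨q, hq⟩ : ∃ q, n (j + 1) = q + 1 := Nat.exists_eq_succ_of_ne_zero (by omega)
  have hjq : n j ≤ q := by omega
  rw [hq, Finset.sum_Ico_succ_top hjq]
  refine add_le_add ?_ ?_
  · calc _ ≤ ∑ k ∈ Finset.Ico (n j) q, (t (k + 1) - t k) * w (n j) := by
          refine Finset.sum_le_sum fun k hk => ?_
          obtain ⟨hk1, hk2⟩ := Finset.mem_Ico.1 hk
          have hΔ : 0 ≤ t (k + 1) - t k := sub_nonneg.2 (htm (Nat.le_succ k))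
          exact mul_le_mul (min_le_right _ _) (hwa _ _ hN (by omega)) (hw _ (by omega)) hΔ
      _ = (t q - t (n j)) * w (n j) := by
          rw [← Finset.sum_mul, Finset.sum_Ico_sub _ hjq]
      _ ≤ a (n j) * w (n j) := by
          refine mul_le_mul_of_nonneg_right ?_ (hw _ hN)
          linarith [h.le_of_lt j q (by omega)]
  · exact mul_le_mul_of_nonneg_right (min_le_left _ _) (hw _ (by omega))

lemma IsGreedy.sum_le_two_mul {N : ℕ} {n : ℕ → ℕ} (h : IsGreedy t a N n) (htm : Monotone t)
    (ha : ∀ k, N ≤ k → 0 < a k)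
    (hw : ∀ k, N ≤ k → 0 ≤ w k) (hwa : ∀ k l, N ≤ k → k ≤ l → w l ≤ w k) (J : ℕ) :
    ∑ k ∈ Finset.Ico N (n J), min (a (k + 1)) (t (k + 1) - t k) * w (k + 1) ≤
      2 * ∑ j ∈ Finset.range (J + 1), a (n j) * w (n j) := by
  -- Each greedy index serves two neighbouring blocks. The induction carries the newest one only
  -- once.
  have key : ∑ k ∈ Finset.Ico N (n J), min (a (k + 1)) (t (k + 1) - t k) * w (k + 1) ≤
      2 * (∑ j ∈ Finset.range J, a (n j) * w (n j)) + a (n J) * w (n J) := by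
    induction J with
    | zero =>
      simp only [h.zero, Finset.Ico_self, Finset.sum_empty, Finset.range_zero, mul_zero, zero_add]
      exact mul_nonneg (ha _ le_rfl).le (hw _ le_rfl)
    | succ J ih =>
      have hN := h.le_apply htm ha J
      have hJ : n J ≤ n (J + 1) := (h.strictMono htm ha (Nat.lt_succ_self J)).le
      rw [Finset.sum_range_succ, ← Finset.sum_Ico_consecutive _ hN hJ]
      have := h.sum_block_le htm ha hw hwa J
      linarith
  rw [Finset.sum_range_succ]
  have hN := h.le_apply htm ha J
  have := mul_nonneg (ha _ hN).le (hw _ hN)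
  linarith

end Greedy

/-! ### Divergent series -/

section Divergent

variable {d : ℕ} {lam : Measure ℝ}

/-- Lebesgue measure on `(0, ∞) × ℝ^d`. -/
noncomputable def spaceTime (d : ℕ) : Measure (ℝ × Space d) :=
  ((volume : Measure ℝ).restrict (Set.Ioi 0)).prod (volume : Measure (Space d))

instance : SigmaFinite (spaceTime d) := by
  unfold spaceTime; infer_instance

/-- With the jump size as outermost variable, intensities can be estimated through space-time
volumes at fixed `z`. -/
lemma lintegral_intensity_swap [SigmaFinite lam] {h : JumpSpace d → ℝ≥0∞} (hh : Measurable h) :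
    ∫⁻ q, h q ∂(intensity d lam) = ∫⁻ z, ∫⁻ p, h (p.1, p.2, z) ∂(spaceTime d) ∂lam := by
  rw [lintegral_intensity hh]
  have h1 : ∀ s, ∫⁻ y : Space d, ∫⁻ z, h (s, y, z) ∂lam =
      ∫⁻ z, (∫⁻ y : Space d, h (s, y, z)) ∂lam :=
    fun s => lintegral_lintegral_swap (f := fun y z => h (s, y, z))
      (by simp only [Function.uncurry_def]; fun_prop)
  simp_rw [h1]
  have h2 : Measurable fun p : (ℝ × ℝ) × Space d => h (p.1.1, p.2, p.1.2) := by fun_prop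
  rw [lintegral_lintegral_swap (Measurable.lintegral_prod_right' h2).aemeasurable]
  refine lintegral_congr fun z => ?_
  rw [spaceTime, lintegral_prod _ (by fun_prop)]

/-- The proportionality constant of the boxes on which the heat kernel is large. -/
noncomputable def boxConst : ℝ := Real.exp (-2) / (4 * Real.pi)

lemma boxConst_pos : 0 < boxConst := by unfold boxConst; positivity

/-- With `a = boxConst * ρ ^ (2 / d)` one has `√(4πa) ^ d = exp (-d) * ρ`. The factor `exp d`
compensates the `exp (-1)` lost on the box, as `d ≥ 1`. -/
lemma inv_le_heatKernel (hd : 1 ≤ d) {ρ u : ℝ} (hρ : 0 < ρ)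
    (hu1 : boxConst * ρ ^ (2 / (d : ℝ)) / 2 ≤ u) (hu2 : u ≤ boxConst * ρ ^ (2 / (d : ℝ)))
    {y : Space d} (hy : ‖y‖ ^ 2 ≤ boxConst * ρ ^ (2 / (d : ℝ))) : ρ⁻¹ ≤ heatKernel u y := by
  have hd0 : (d : ℝ) ≠ 0 := by positivity
  have ha : 0 < boxConst * ρ ^ (2 / (d : ℝ)) := mul_pos boxConst_pos (by positivity)
  refine le_trans ?_ (le_heatKernel ha hu1 hu2 hy)
  have h1 : √(4 * Real.pi * (boxConst * ρ ^ (2 / (d : ℝ)))) = Real.exp (-1) * ρ ^ (1 / (d : ℝ)) := by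
    rw [Real.sqrt_eq_iff_mul_self_eq (by positivity) (by positivity), boxConst]
    have e1 : Real.exp (-2) = Real.exp (-1) * Real.exp (-1) := by rw [← Real.exp_add]; norm_num
    have e2 : ρ ^ (2 / (d : ℝ)) = ρ ^ (1 / (d : ℝ)) * ρ ^ (1 / (d : ℝ)) := by
      rw [← Real.rpow_add hρ]; ring_nf
    rw [e1, e2]
    field_simp
  have h2 : √(4 * Real.pi * (boxConst * ρ ^ (2 / (d : ℝ)))) ^ d = Real.exp (-1) ^ d * ρ := by
    rw [h1, mul_pow, ← Real.rpow_natCast (ρ ^ (1 / (d : ℝ))), ← Real.rpow_mul hρ.le,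
      one_div_mul_cancel hd0, Real.rpow_one]
  rw [h2, mul_inv]
  have h3 : Real.exp (-1) ^ d ≤ Real.exp (-1) := by
    calc Real.exp (-1) ^ d ≤ Real.exp (-1) ^ 1 :=
          pow_le_pow_of_le_one (Real.exp_pos _).le (Real.exp_le_one_iff.2 (by norm_num)) hd
      _ = _ := pow_one _
  have h4 : (Real.exp (-1))⁻¹ ≤ (Real.exp (-1) ^ d)⁻¹ := by gcongr
  have h5 : (Real.exp (-1))⁻¹ * Real.exp (-1) = 1 := inv_mul_cancel₀ (Real.exp_pos _).ne'
  calc ρ⁻¹ = (Real.exp (-1))⁻¹ * Real.exp (-1) * ρ⁻¹ := by rw [h5, one_mul]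
    _ ≤ (Real.exp (-1) ^ d)⁻¹ * Real.exp (-1) * ρ⁻¹ := by gcongr
    _ = _ := by ring

/-- The inequality `1 - x ≤ -log x` for ratios of successive times telescopes. The first summand
equals one because `t 0 = 0`, and it is kept apart. -/
lemma sum_div_le_one_add_log {t : ℕ → ℝ} (ht0 : t 0 = 0) (htp : ∀ n, 1 ≤ n → 0 < t n) (M : ℕ) :
    ∑ k ∈ Finset.range (M + 1), (t (k + 1) - t k) / t (k + 1) ≤
      1 + Real.log (t (M + 1) / t 1) := by
  induction M with
  | zero =>
    have := (htp 1 le_rfl).ne'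
    simp [ht0, this]
  | succ M ih =>
    rw [Finset.sum_range_succ]
    have h1 := htp (M + 1) (by omega)
    have h2 := htp (M + 1 + 1) (by omega)
    have h3 := htp 1 le_rfl
    have h4 := Real.add_one_le_exp (Real.log (t (M + 1) / t (M + 1 + 1)))
    rw [Real.exp_log (by positivity)] at h4
    rw [Real.log_div h1.ne' h2.ne'] at h4
    rw [Real.log_div h1.ne' h3.ne'] at ih
    rw [Real.log_div h2.ne' h3.ne', sub_div, div_self h2.ne']
    linarith

/-- The series of the theorem, for a sequence of weights and a measure of jump sizes. -/
noncomputable def levySeries (d : ℕ) (lam : Measure ℝ) (F t : ℕ → ℝ) : ℝ≥0∞ :=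
  ∑' n : ℕ, ∫⁻ z, ENNReal.ofReal
    (min ((|z| / F (n + 1)) ^ (2 / (d : ℝ))) (t (n + 1) - t n) * (|z| / F (n + 1))) ∂lam

/-- The points with contribution at least `K * F n` at time `t n`. -/
def bigJumps (d : ℕ) (F t : ℕ → ℝ) (K : ℝ) (n : ℕ) : Set (JumpSpace d) :=
  {q | K * F n ≤ heatKernel (t n - q.1) q.2.1 * |q.2.2|}

lemma measurableSet_bigJumps (F t : ℕ → ℝ) (K : ℝ) (n : ℕ) :
    MeasurableSet (bigJumps d F t K n) :=
  measurableSet_le measurable_const (by fun_prop)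

/-- The assumptions on times and weights. -/
structure IsAdmissible (t F : ℕ → ℝ) : Prop where
  zero : t 0 = 0
  pos : ∀ n, 1 ≤ n → 0 < t n
  mono : Monotone t
  tendsto : Tendsto t atTop atTop
  weight_pos : ∀ n, 1 ≤ n → 0 < F n
  weight_mono : ∀ k l, 1 ≤ k → k ≤ l → F k ≤ F l

/-- Below each greedy time sits a parabolic box with ages between `a / 2` and `a`, on which a jump
of size `z` contributes at least `K * F`. The greedy gaps make the boxes disjoint in time, and `a N
< t N` keeps them in positive time. Volumes therefore add. -/
lemma tsum_boxes_le (hd : 1 ≤ d) {t F : ℕ → ℝ} (h : IsAdmissible t F) {K z : ℝ} (hK : 0 < K)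
    (hz : z ≠ 0) {N : ℕ} (hN : 1 ≤ N)
    (haN : boxConst * (|z| / (K * F N)) ^ (2 / (d : ℝ)) < t N) {n : ℕ → ℕ}
    (hn : IsGreedy t (fun k => boxConst * (|z| / (K * F k)) ^ (2 / (d : ℝ))) N n) :
    ∑' j, ENNReal.ofReal (boxConst * (|z| / (K * F (n j))) ^ (2 / (d : ℝ)) *
        (|z| / (K * F (n j)))) *
        (ENNReal.ofReal (√boxConst ^ d / 2) * volume (Metric.ball (0 : Space d) 1)) ≤
      spaceTime d {p | (p.1, p.2, z) ∈ ⋃ k ∈ Set.Ici 1, bigJumps d F t K k} := by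
  have hd0 : (d : ℝ) ≠ 0 := by positivity
  set a : ℕ → ℝ := fun k => boxConst * (|z| / (K * F k)) ^ (2 / (d : ℝ)) with hadef
  have hρ : ∀ k, 1 ≤ k → 0 < |z| / (K * F k) := fun k hk =>
    div_pos (abs_pos.2 hz) (mul_pos hK (h.weight_pos k hk))
  have ha : ∀ k, 1 ≤ k → 0 < a k := fun k hk =>
    mul_pos boxConst_pos (Real.rpow_pos_of_pos (hρ k hk) _)
  have hρa : ∀ k l, 1 ≤ k → k ≤ l → |z| / (K * F l) ≤ |z| / (K * F k) := fun k l hk hkl => by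
    have := h.weight_mono k l hk hkl
    have := h.weight_pos k hk
    gcongr
  have haa : ∀ k l, 1 ≤ k → k ≤ l → a l ≤ a k := fun k l hk hkl => by
    have h1 := hρa k l hk hkl
    have h2 := (hρ l (hk.trans hkl)).le
    have := boxConst_pos
    simp only [hadef]
    gcongr
  have ha' : ∀ k, N ≤ k → 0 < a k := fun k hk => ha k (hN.trans hk)
  have hsm := hn.strictMono h.mono ha'
  have hn1 : ∀ j, 1 ≤ n j := fun j => hN.trans (hn.le_apply h.mono ha' j)
  let B : ℕ → Set (ℝ × Space d) := fun j =>
    Set.Ioo (t (n j) - a (n j)) (t (n j) - a (n j) / 2) ×ˢ Metric.ball (0 : Space d) (√(a (n j)))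
  have hBm : ∀ j, MeasurableSet (B j) := fun j => measurableSet_Ioo.prod Metric.isOpen_ball.measurableSet
  have hsep : ∀ i j, i < j → t (n i) ≤ t (n j) - a (n j) := by
    intro i j hij
    have h1 : t (n i) + a (n i) < t (n (i + 1)) := hn.gap i
    obtain ⟨l, rfl⟩ : ∃ l, j = l + 1 := Nat.exists_eq_succ_of_ne_zero (by omega)
    have h2 := hn.gap l
    have h3 := haa (n l) (n (l + 1)) (hn1 l) (hsm.monotone (Nat.le_succ l))
    have h4 := h.mono (hsm.monotone (show i ≤ l by omega))
    have : t (n l) + a (n l) < t (n (l + 1)) := h2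
    linarith
  have hdisj : Pairwise fun i j => Disjoint (B i) (B j) := by
    have key : ∀ i j, i < j → Disjoint (B i) (B j) := by
      intro i j hij
      rw [Set.disjoint_left]
      rintro ⟨s, y⟩ ⟨⟨_, hs1⟩, _⟩ ⟨⟨hs2, _⟩, _⟩
      simp only at hs1 hs2
      linarith [hsep i j hij, ha (n i) (hn1 i)]
    intro i j hij
    rcases lt_or_gt_of_ne hij with h1 | h1
    · exact key i j h1
    · exact (key j i h1).symm
  have hpos : ∀ j, 0 ≤ t (n j) - a (n j) := by
    intro j
    rcases Nat.eq_zero_or_pos j with rfl | hj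
    · rw [hn.zero]; exact sub_nonneg.2 haN.le
    · exact (h.pos _ (hn1 0)).le.trans (hsep 0 j hj)
  have hvol : ∀ j, spaceTime d (B j) =
      ENNReal.ofReal (a (n j) * (|z| / (K * F (n j)))) *
        (ENNReal.ofReal (√boxConst ^ d / 2) * volume (Metric.ball (0 : Space d) 1)) := by
    intro j
    rw [spaceTime, Measure.prod_prod, Measure.restrict_apply measurableSet_Ioo]
    have h1 : Set.Ioo (t (n j) - a (n j)) (t (n j) - a (n j) / 2) ∩ Set.Ioi 0 =
        Set.Ioo (t (n j) - a (n j)) (t (n j) - a (n j) / 2) := by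
      refine Set.inter_eq_left.2 fun s hs => ?_
      exact (hpos j).trans_lt hs.1
    -- The exponent `2 / d` is such that the spatial volume is proportional to `|z| / (K * F)`.
    have h2 : √(a (n j)) ^ d = √boxConst ^ d * (|z| / (K * F (n j))) := by
      have hp := hρ _ (hn1 j)
      simp only [hadef]
      rw [Real.sqrt_mul boxConst_pos.le, mul_pow, Real.sqrt_eq_rpow (_ ^ _),
        ← Real.rpow_natCast (_ ^ (1 / 2 : ℝ)), ← Real.rpow_mul hp.le, ← Real.rpow_mul hp.le]
      have : 2 / (d : ℝ) * (1 / 2) * d = 1 := by field_simp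
      rw [mul_assoc] at this
      rw [mul_assoc, this, Real.rpow_one]
    rw [h1, Real.volume_Ioo, Measure.addHaar_ball_of_pos _ _ (Real.sqrt_pos.2 (ha _ (hn1 j))),
      finrank_euclideanSpace, Fintype.card_fin, h2, ← mul_assoc, ← mul_assoc]
    congr 1
    have := ha _ (hn1 j)
    have := hρ _ (hn1 j)
    rw [← ENNReal.ofReal_mul (by linarith), ← ENNReal.ofReal_mul (by positivity)]
    congr 1
    ring
  refine (tsum_congr fun j => (hvol j).symm).trans_le ?_
  rw [← measure_iUnion hdisj hBm]
  refine measure_mono (Set.iUnion_subset fun j => ?_)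
  rintro ⟨s, y⟩ ⟨⟨hs1, hs2⟩, hy⟩
  simp only at hs1 hs2 hy
  refine Set.mem_biUnion (hn1 j) ?_
  have hp := hρ _ (hn1 j)
  have hy2 : ‖y‖ ^ 2 ≤ a (n j) := by
    rw [mem_ball_zero_iff] at hy
    have := pow_le_pow_left₀ (norm_nonneg y) hy.le 2
    rwa [Real.sq_sqrt (ha _ (hn1 j)).le] at this
  have key := inv_le_heatKernel (y := y) hd hp (u := t (n j) - s) (by simp only [hadef] at hs2; linarith)
    (by simp only [hadef] at hs1; linarith) hy2
  rw [inv_div, div_le_iff₀ (abs_pos.2 hz)] at key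
  exact key

/-- Before the first crossing the box of height `a k` would reach back to time zero or earlier;
those early times are estimated separately. -/
lemma exists_large_time {t F : ℕ → ℝ} (h : IsAdmissible t F) {a : ℕ → ℝ}
    (haa : ∀ k l, 1 ≤ k → k ≤ l → a l ≤ a k) :
    ∃ N, 1 ≤ N ∧ a N < t N ∧ ∀ k, 1 ≤ k → k < N → t k ≤ a k := by
  classical
  have hex : ∃ N, 1 ≤ N ∧ a N < t N := by
    obtain ⟨N, hN, hN1⟩ := ((h.tendsto.eventually_gt_atTop (a 1)).and
      (eventually_ge_atTop 1)).exists
    exact ⟨N, hN1, (haa 1 N le_rfl hN1).trans_lt hN⟩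
  refine ⟨Nat.find hex, (Nat.find_spec hex).1, (Nat.find_spec hex).2, fun k hk hkN => ?_⟩
  have := Nat.find_min hex hkN
  by_contra hlt
  exact this ⟨hk, not_le.1 hlt⟩

/-- Up to the early times, a series over all times is bounded by the sum over the greedy ones. -/
lemma sum_min_le {t F : ℕ → ℝ} (h : IsAdmissible t F) {a w : ℕ → ℝ}
    (ha : ∀ k, 1 ≤ k → 0 < a k)
    (hw : ∀ k, 1 ≤ k → 0 ≤ w k) (hwa : ∀ k l, 1 ≤ k → k ≤ l → w l ≤ w k) {N : ℕ} (hN : 1 ≤ N)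
    {n : ℕ → ℕ} (hn : IsGreedy t a N n) {D : ℝ}
    (hD : ∑ k ∈ Finset.range (N - 1), (t (k + 1) - t k) * w (k + 1) ≤ D) (J : ℕ) :
    ∑ k ∈ Finset.range J, min (a (k + 1)) (t (k + 1) - t k) * w (k + 1) ≤
      D + 3 * ∑ j ∈ Finset.range (J + 1), a (n j) * w (n j) := by
  have ha' : ∀ k, N ≤ k → 0 < a k := fun k hk => ha k (hN.trans hk)
  have hw' : ∀ k, N ≤ k → 0 ≤ w k := fun k hk => hw k (hN.trans hk)
  have hwa' : ∀ k l, N ≤ k → k ≤ l → w l ≤ w k := fun k l hk hl => hwa k l (hN.trans hk) hl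
  have hsm := hn.strictMono h.mono ha'
  have hterm : ∀ k, 0 ≤ min (a (k + 1)) (t (k + 1) - t k) * w (k + 1) := fun k =>
    mul_nonneg (le_min (ha _ (by omega)).le (sub_nonneg.2 (h.mono (Nat.le_succ k)))) (hw _ (by omega))
  have h1 : ∑ k ∈ Finset.range J, min (a (k + 1)) (t (k + 1) - t k) * w (k + 1) ≤
      ∑ k ∈ Finset.range (max (n J) N), min (a (k + 1)) (t (k + 1) - t k) * w (k + 1) := by
    refine Finset.sum_le_sum_of_subset_of_nonneg (Finset.range_mono ?_) fun k _ _ => hterm k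
    exact (hsm.le_apply).trans (le_max_left _ _)
  have hNJ : N ≤ n J := hn.le_apply h.mono ha' J
  rw [max_eq_left hNJ, ← Finset.sum_range_add_sum_Ico _ hNJ] at h1
  have h2 := hn.sum_le_two_mul h.mono ha' hw' hwa' J
  obtain ⟨M, rfl⟩ : ∃ M, N = M + 1 := Nat.exists_eq_succ_of_ne_zero (by omega)
  rw [Finset.sum_range_succ] at h1
  have h3 : ∑ k ∈ Finset.range M, min (a (k + 1)) (t (k + 1) - t k) * w (k + 1) ≤ D := by
    refine le_trans (Finset.sum_le_sum fun k _ => ?_) hD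
    exact mul_le_mul_of_nonneg_right (min_le_right _ _) (hw _ (by omega))
  -- The summand at the first greedy index is covered neither by the early times nor by the blocks.
  -- It accounts for the factor three instead of two.
  have h4 : min (a (M + 1)) (t (M + 1) - t M) * w (M + 1) ≤
      ∑ j ∈ Finset.range (J + 1), a (n j) * w (n j) := by
    have hnn : ∀ j, 0 ≤ a (n j) * w (n j) := fun j =>
      mul_nonneg (ha' _ (hn.le_apply h.mono ha' j)).le (hw' _ (hn.le_apply h.mono ha' j))
    refine le_trans ?_ (Finset.single_le_sum (f := fun j => a (n j) * w (n j)) (fun j _ => hnn j)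
      (Finset.mem_range.2 (Nat.succ_pos J)))
    simp only [hn.zero]
    exact mul_le_mul_of_nonneg_right (min_le_left _ _) (hw _ (by omega))
  linarith

/-- Comparison of the series at a fixed jump size with the volume of the points that give rise to
large contributions. -/
lemma tsum_le_spaceTime (hd : 1 ≤ d) {t F : ℕ → ℝ} (h : IsAdmissible t F) {K c ε : ℝ} (hK : 0 < K)
    (hc : 0 < c) (hF : ∀ n, 1 ≤ n → c * t n ≤ F n) (hε : 0 < ε) :
    ∃ A B : ℝ≥0, ∀ z : ℝ,
      ∑' n : ℕ, ENNReal.ofReal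
        (min ((|z| / F (n + 1)) ^ (2 / (d : ℝ))) (t (n + 1) - t n) * (|z| / F (n + 1))) ≤
      A * (ENNReal.ofReal |z| + ENNReal.ofReal (|z| ^ (1 + ε))) +
        B * spaceTime d {p | (p.1, p.2, z) ∈ ⋃ k ∈ Set.Ici 1, bigJumps d F t K k} := by
  have hd0 : (0 : ℝ) < d := by positivity
  have hb := boxConst_pos
  have ht1 := h.pos 1 le_rfl
  have hF1 := h.weight_pos 1 le_rfl
  set V : ℝ≥0∞ := ENNReal.ofReal (√boxConst ^ d / 2) * volume (Metric.ball (0 : Space d) 1) with hV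
  have hV0 : V ≠ 0 := by
    refine mul_ne_zero ?_ (Metric.measure_ball_pos _ _ one_pos).ne'
    have : 0 < √boxConst ^ d / 2 := by positivity
    simpa using this
  have hVt : V ≠ ∞ := ENNReal.mul_ne_top ENNReal.ofReal_ne_top measure_ball_lt_top.ne
  set C1 : ℝ := K * max 1 (K ^ (2 / (d : ℝ)) / boxConst) with hC1
  have hC1pos : 0 < C1 := by positivity
  -- The bound `log x ≤ x ^ p / p` is applied to a multiple of `|z| ^ (2 / d)`. This choice of `p`
  -- turns that power into `|z| ^ ε`, and `Q` collects the constants.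
  set p : ℝ := ε * d / 2 with hp
  have hp0 : 0 < p := by positivity
  set Q : ℝ := (boxConst * (1 / (K * F 1)) ^ (2 / (d : ℝ)) / t 1) ^ p / p with hQ
  have hQ0 : 0 < Q := by positivity
  set A0 : ℝ := C1 / (K * c) * (1 + Q) with hA0
  have hA00 : 0 ≤ A0 := by positivity
  set B0 : ℝ≥0∞ := ENNReal.ofReal (3 * C1) / V with hB0
  have hB0t : B0 ≠ ∞ := ENNReal.div_ne_top ENNReal.ofReal_ne_top hV0
  refine ⟨A0.toNNReal, B0.toNNReal, fun z => ?_⟩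
  by_cases hz : z = 0
  · subst hz; simp
  rw [ENNReal.coe_toNNReal hB0t]
  have hz0 : 0 < |z| := abs_pos.2 hz
  set w : ℕ → ℝ := fun k => |z| / (K * F k) with hwdef
  set a : ℕ → ℝ := fun k => boxConst * w k ^ (2 / (d : ℝ)) with hadef
  have hw : ∀ k, 1 ≤ k → 0 < w k := fun k hk => div_pos hz0 (mul_pos hK (h.weight_pos k hk))
  have ha : ∀ k, 1 ≤ k → 0 < a k := fun k hk => mul_pos hb (Real.rpow_pos_of_pos (hw k hk) _)
  have hwa : ∀ k l, 1 ≤ k → k ≤ l → w l ≤ w k := fun k l hk hkl => by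
    have := h.weight_mono k l hk hkl
    have := h.weight_pos k hk
    simp only [hwdef]
    gcongr
  have haa : ∀ k l, 1 ≤ k → k ≤ l → a l ≤ a k := fun k l hk hkl => by
    have h1 := hwa k l hk hkl
    have h2 := (hw l (hk.trans hkl)).le
    simp only [hadef]
    gcongr
  obtain ⟨N, hN, haN, hNlt⟩ := exists_large_time h haa
  obtain ⟨n, hn⟩ := exists_isGreedy (a := a) h.tendsto N
  have hn1 : ∀ j, 1 ≤ n j := fun j =>
    hN.trans (hn.le_apply h.mono (fun k hk => ha k (hN.trans hk)) j)
  have hboxes := tsum_boxes_le hd h hK hz hN haN hn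
  -- At early times `F ≥ c * t` bounds the summands by multiples of `Δt / t`, whose sum is
  -- logarithmic in the last early time. That time is at most `a 1`, a power of `|z|`, so the
  -- logarithm is paid for by `|z| ^ ε`.
  have hD : ∑ k ∈ Finset.range (N - 1), (t (k + 1) - t k) * w (k + 1) ≤
      |z| / (K * c) * (1 + Q * |z| ^ ε) := by
    have hRHS : 0 ≤ |z| / (K * c) * (1 + Q * |z| ^ ε) := by positivity
    have hstep : ∀ k, (t (k + 1) - t k) * w (k + 1) ≤
        |z| / (K * c) * ((t (k + 1) - t k) / t (k + 1)) := by
      intro k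
      have h1 := h.pos (k + 1) (by omega)
      have h2 := hF (k + 1) (by omega)
      have h3 : 0 ≤ t (k + 1) - t k := sub_nonneg.2 (h.mono (Nat.le_succ k))
      have h4 : w (k + 1) ≤ |z| / (K * (c * t (k + 1))) := by
        simp only [hwdef]; gcongr
      calc (t (k + 1) - t k) * w (k + 1) ≤ (t (k + 1) - t k) * (|z| / (K * (c * t (k + 1)))) := by
            gcongr
        _ = _ := by field_simp
    obtain hN1 | ⟨M, hM⟩ : N - 1 = 0 ∨ ∃ M, N - 1 = M + 1 := by
      rcases Nat.eq_zero_or_pos (N - 1) with h0 | h0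
      · exact Or.inl h0
      · exact Or.inr (Nat.exists_eq_succ_of_ne_zero h0.ne')
    · rw [hN1]; simpa using hRHS
    · rw [hM]
      refine (Finset.sum_le_sum fun k _ => hstep k).trans ?_
      rw [← Finset.mul_sum]
      refine mul_le_mul_of_nonneg_left ((sum_div_le_one_add_log h.zero h.pos M).trans ?_)
        (by positivity)
      have h1 : t (M + 1) ≤ a 1 :=
        (hNlt (M + 1) (by omega) (by omega)).trans (haa 1 (M + 1) le_rfl (by omega))
      have h2 := h.pos (M + 1) (by omega)
      have h3 : Real.log (t (M + 1) / t 1) ≤ Real.log (a 1 / t 1) :=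
        Real.log_le_log (by positivity) (by gcongr)
      have h4 : Real.log (a 1 / t 1) ≤ (a 1 / t 1) ^ p / p :=
        Real.log_le_rpow_div (div_nonneg (ha 1 le_rfl).le ht1.le) hp0
      have h5 : (a 1 / t 1) ^ p / p = Q * |z| ^ ε := by
        have e1 : a 1 / t 1 = (boxConst * (1 / (K * F 1)) ^ (2 / (d : ℝ)) / t 1) *
            |z| ^ (2 / (d : ℝ)) := by
          simp only [hadef, hwdef]
          rw [div_eq_mul_one_div |z|, Real.mul_rpow hz0.le (by positivity)]
          ring
        have e2 : (|z| ^ (2 / (d : ℝ))) ^ p = |z| ^ ε := by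
          rw [← Real.rpow_mul hz0.le, hp]
          congr 1
          field_simp
        rw [e1, Real.mul_rpow (by positivity) (by positivity), e2, hQ]
        ring
      linarith
  have hsum := sum_min_le h ha (fun k hk => (hw k hk).le) hwa hN hn hD
  -- Passing from level one to level `K` changes each summand by at most the factor `C1`.
  have hterm : ∀ k, min ((|z| / F (k + 1)) ^ (2 / (d : ℝ))) (t (k + 1) - t k) * (|z| / F (k + 1)) ≤
      C1 * (min (a (k + 1)) (t (k + 1) - t k) * w (k + 1)) := by
    intro k
    have hFk := h.weight_pos (k + 1) (by omega)
    have h3 : 0 ≤ t (k + 1) - t k := sub_nonneg.2 (h.mono (Nat.le_succ k))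
    have e1 : |z| / F (k + 1) = K * w (k + 1) := by simp only [hwdef]; field_simp
    have e2 : (|z| / F (k + 1)) ^ (2 / (d : ℝ)) = K ^ (2 / (d : ℝ)) / boxConst * a (k + 1) := by
      rw [e1, Real.mul_rpow hK.le (hw _ (by omega)).le]
      simp only [hadef]
      field_simp
    rw [e2, e1, hC1]
    have hwk := hw (k + 1) (by omega)
    have hak := ha (k + 1) (by omega)
    set m := max 1 (K ^ (2 / (d : ℝ)) / boxConst) with hm
    have h4 : min (K ^ (2 / (d : ℝ)) / boxConst * a (k + 1)) (t (k + 1) - t k) ≤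
        m * min (a (k + 1)) (t (k + 1) - t k) := by
      rw [mul_min_of_nonneg _ _ (by positivity : 0 ≤ m)]
      refine min_le_min ?_ ?_
      · exact mul_le_mul_of_nonneg_right (le_max_right _ _) hak.le
      · exact le_mul_of_one_le_left h3 (le_max_left _ _)
    calc _ ≤ m * min (a (k + 1)) (t (k + 1) - t k) * (K * w (k + 1)) := by gcongr
      _ = _ := by ring
  have hbn : ∀ j, 0 ≤ a (n j) * w (n j) := fun j =>
    mul_nonneg (ha _ (hn1 j)).le (hw _ (hn1 j)).le
  have hpart : ∀ J, ∑ k ∈ Finset.range J, ENNReal.ofReal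
      (min ((|z| / F (k + 1)) ^ (2 / (d : ℝ))) (t (k + 1) - t k) * (|z| / F (k + 1))) ≤
      ENNReal.ofReal (C1 * (|z| / (K * c) * (1 + Q * |z| ^ ε))) +
        ENNReal.ofReal (3 * C1) * ∑' j, ENNReal.ofReal (a (n j) * w (n j)) := by
    intro J
    rw [← ENNReal.ofReal_sum_of_nonneg]
    · calc _ ≤ ENNReal.ofReal (C1 * (|z| / (K * c) * (1 + Q * |z| ^ ε)) +
            (3 * C1) * ∑ j ∈ Finset.range (J + 1), a (n j) * w (n j)) := by
            apply ENNReal.ofReal_le_ofReal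
            refine (Finset.sum_le_sum fun k _ => hterm k).trans ?_
            rw [← Finset.mul_sum]
            have := mul_le_mul_of_nonneg_left (hsum J) hC1pos.le
            linarith
        _ ≤ _ := by
            rw [ENNReal.ofReal_add (by positivity)
              (mul_nonneg (by positivity) (Finset.sum_nonneg fun j _ => hbn j)),
              ENNReal.ofReal_mul (p := 3 * C1) (by positivity),
              ENNReal.ofReal_sum_of_nonneg fun j _ => hbn j]
            gcongr
            exact ENNReal.sum_le_tsum _
    · intro k _
      have hFk := h.weight_pos (k + 1) (by omega)
      have h3 : 0 ≤ t (k + 1) - t k := sub_nonneg.2 (h.mono (Nat.le_succ k))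
      exact mul_nonneg (le_min (by positivity) h3) (by positivity)
  refine (ENNReal.tsum_le_of_sum_range_le hpart).trans (add_le_add ?_ ?_)
  · rw [← ENNReal.ofReal_add (by positivity) (by positivity)]
    change _ ≤ ENNReal.ofReal A0 * _
    rw [← ENNReal.ofReal_mul hA00]
    apply ENNReal.ofReal_le_ofReal
    rw [Real.rpow_add hz0, Real.rpow_one, hA0]
    have e : C1 / (K * c) * (1 + Q) * (|z| + |z| * |z| ^ ε) -
        C1 * (|z| / (K * c) * (1 + Q * |z| ^ ε)) =
        C1 / (K * c) * (Q * |z| + |z| * |z| ^ ε) := by ring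
    have : 0 ≤ C1 / (K * c) * (Q * |z| + |z| * |z| ^ ε) := by positivity
    linarith
  · calc ENNReal.ofReal (3 * C1) * ∑' j, ENNReal.ofReal (a (n j) * w (n j)) =
        B0 * ∑' j, ENNReal.ofReal (a (n j) * w (n j)) * V := by
          have hBV : B0 * V = ENNReal.ofReal (3 * C1) := ENNReal.div_mul_cancel hV0 hVt
          rw [ENNReal.tsum_mul_right, ← hBV]
          ring
      _ ≤ _ := by gcongr

/-- Markov's inequality under the intensity, where the jump sum has finite mean. -/
lemma intensity_bigJumps_lt_top [SigmaFinite lam] (hint : Integrable (fun z : ℝ => z) lam)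
    {t F : ℕ → ℝ} (h : IsAdmissible t F) {K : ℝ} (hK : 0 < K) {n : ℕ} (hn : 1 ≤ n) :
    intensity d lam (bigJumps d F t K n) < ∞ := by
  have hpos : ENNReal.ofReal (K * F n) ≠ 0 := by simpa using mul_pos hK (h.weight_pos n hn)
  have h1 := mul_meas_ge_le_lintegral (μ := intensity d lam)
    (measurable_jumpSum_integrand (d := d) (t n)) (ENNReal.ofReal (K * F n))
  have h2 : bigJumps d F t K n ⊆ {q : JumpSpace d | ENNReal.ofReal (K * F n) ≤
      ENNReal.ofReal (heatKernel (t n - q.1) q.2.1 * |q.2.2|)} :=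
    fun q hq => ENNReal.ofReal_le_ofReal hq
  refine (measure_mono h2).trans_lt ?_
  have h3 := (lintegral_intensity_jumpSum (d := d) hint (t n))
  rw [jumpSum] at h3
  rw [h3] at h1
  by_contra htop
  rw [not_lt, top_le_iff] at htop
  rw [htop, ENNReal.mul_top hpos] at h1
  exact absurd h1 (by simp)

/-- The comparison at fixed `z` is integrated against the Lévy measure. The moment terms are finite,
so only the volume term can account for the divergence. -/
lemma intensity_iUnion_bigJumps [SigmaFinite lam] (hd : 1 ≤ d)
    (hint : Integrable (fun z : ℝ => z) lam) {ε : ℝ} (hε : 0 < ε)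
    (hmom : Integrable (fun z : ℝ => |z| ^ (1 + ε)) lam)
    {t F : ℕ → ℝ} (h : IsAdmissible t F) {K c : ℝ} (hK : 0 < K)
    (hc : 0 < c) (hF : ∀ n, 1 ≤ n → c * t n ≤ F n) (hser : levySeries d lam F t = ∞) :
    intensity d lam (⋃ k ∈ Set.Ici 1, bigJumps d F t K k) = ∞ := by
  obtain ⟨A, B, hAB⟩ := tsum_le_spaceTime (d := d) hd h hK hc hF hε
  have hQ : MeasurableSet (⋃ k ∈ Set.Ici 1, bigJumps d F t K k) :=
    MeasurableSet.biUnion (Set.to_countable _) fun k _ => measurableSet_bigJumps F t K k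
  have hν : intensity d lam (⋃ k ∈ Set.Ici 1, bigJumps d F t K k) =
      ∫⁻ z, spaceTime d {p | (p.1, p.2, z) ∈ ⋃ k ∈ Set.Ici 1, bigJumps d F t K k} ∂lam := by
    rw [← lintegral_indicator_one hQ, lintegral_intensity_swap (measurable_one.indicator hQ)]
    refine lintegral_congr fun z => ?_
    rw [← lintegral_indicator_one]
    · rfl
    · exact hQ.preimage (by fun_prop : Measurable fun p : ℝ × Space d => (p.1, p.2, z))
  have hfin : ∫⁻ z, (A : ℝ≥0∞) * (ENNReal.ofReal |z| + ENNReal.ofReal (|z| ^ (1 + ε))) ∂lam ≠ ∞ := by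
    rw [lintegral_const_mul' _ _ ENNReal.coe_ne_top, lintegral_add_left (by fun_prop)]
    refine ENNReal.mul_ne_top ENNReal.coe_ne_top (ENNReal.add_ne_top.2 ⟨?_, ?_⟩)
    · rw [lintegral_abs hint]; exact ENNReal.ofReal_ne_top
    · rw [← ofReal_integral_eq_lintegral_ofReal hmom (ae_of_all _ fun z => by positivity)]
      exact ENNReal.ofReal_ne_top
  have h1 : levySeries d lam F t ≤
      ∫⁻ z, (A : ℝ≥0∞) * (ENNReal.ofReal |z| + ENNReal.ofReal (|z| ^ (1 + ε))) ∂lam +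
        B * intensity d lam (⋃ k ∈ Set.Ici 1, bigJumps d F t K k) := by
    rw [levySeries, ← lintegral_tsum fun n => by fun_prop, hν,
      ← lintegral_const_mul' _ _ ENNReal.coe_ne_top, ← lintegral_add_left (by fun_prop)]
    exact lintegral_mono hAB
  by_contra hne
  rw [hser, top_le_iff] at h1
  exact ENNReal.add_ne_top.2 ⟨hfin, ENNReal.mul_ne_top ENNReal.coe_ne_top hne⟩ h1

lemma intensity_iUnion_bigJumps_tail [SigmaFinite lam] (hint : Integrable (fun z : ℝ => z) lam)
    {t F : ℕ → ℝ} (h : IsAdmissible t F) {K : ℝ} (hK : 0 < K)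
    (hinf : intensity d lam (⋃ k ∈ Set.Ici 1, bigJumps d F t K k) = ∞) (N : ℕ) :
    intensity d lam (⋃ k ∈ Set.Ici (N + 1), bigJumps d F t K k) = ∞ := by
  have hsub : (⋃ k ∈ Set.Ici 1, bigJumps d F t K k) ⊆
      (⋃ k ∈ Finset.Icc 1 N, bigJumps d F t K k) ∪ ⋃ k ∈ Set.Ici (N + 1), bigJumps d F t K k := by
    refine Set.iUnion₂_subset fun k hk => ?_
    rcases le_or_gt k N with h1 | h1
    · exact Set.subset_union_of_subset_left
        (Set.subset_biUnion_of_mem (u := fun k => bigJumps d F t K k)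
          (show k ∈ (Finset.Icc 1 N : Finset ℕ) from Finset.mem_Icc.2 ⟨hk, h1⟩)) _
    · exact Set.subset_union_of_subset_right
        (Set.subset_biUnion_of_mem (u := fun k => bigJumps d F t K k)
          (show k ∈ Set.Ici (N + 1) from h1)) _
  have hfin : intensity d lam (⋃ k ∈ Finset.Icc 1 N, bigJumps d F t K k) < ∞ := by
    refine (measure_biUnion_finset_le _ _).trans_lt (ENNReal.sum_lt_top.2 fun k hk => ?_)
    exact intensity_bigJumps_lt_top hint h hK (Finset.mem_Icc.1 hk).1
  have := (measure_mono hsub).trans (measure_union_le (μ := intensity d lam) _ _)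
  rw [hinf, top_le_iff] at this
  by_contra hne
  exact ENNReal.add_ne_top.2 ⟨hfin.ne, hne⟩ this

/-- If the series diverges, the weighted sum of the jumps exceeds every multiple of the weights
infinitely often. -/
theorem ae_frequently_le_jumpSum [SigmaFinite lam] (hd : 1 ≤ d)
    (hint : Integrable (fun z : ℝ => z) lam) {ε : ℝ} (hε : 0 < ε)
    (hmom : Integrable (fun z : ℝ => |z| ^ (1 + ε)) lam)
    {t F : ℕ → ℝ} (h : IsAdmissible t F) {c : ℝ}
    (hc : 0 < c) (hF : ∀ n, 1 ≤ n → c * t n ≤ F n) (hser : levySeries d lam F t = ∞)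
    {Ω : Type*} [MeasurableSpace Ω] {P : Measure Ω} [IsProbabilityMeasure P]
    {μ : Ω → Measure (JumpSpace d)} (hμ : IsPoissonRandomMeasure P (intensity d lam) μ) :
    ∀ᵐ ω ∂P, ∀ K : ℝ, ∃ᶠ n in atTop, ENNReal.ofReal (K * F n) ≤ jumpSum (μ ω) (t n) := by
  -- Levels `K + 1` are positive, as the estimates require, and countably many levels and tails
  -- suffice.
  have h1 : ∀ᵐ ω ∂P, ∀ K N : ℕ,
      μ ω (⋃ k ∈ Set.Ici (N + 1), bigJumps d F t ((K : ℝ) + 1) k) ≠ 0 := by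
    rw [ae_all_iff]; intro K; rw [ae_all_iff]; intro N
    have hK : (0 : ℝ) < (K : ℝ) + 1 := by positivity
    exact hμ.ae_apply_ne_zero
      (MeasurableSet.biUnion (Set.to_countable _) fun k _ => measurableSet_bigJumps F t _ k)
      (intensity_iUnion_bigJumps_tail hint h hK
        (intensity_iUnion_bigJumps hd hint hε hmom h hK hc hF hser) N)
  have h2 : ∀ᵐ ω ∂P, ∀ K n : ℕ, ∃ k : ℕ, μ ω (bigJumps d F t ((K : ℝ) + 1) (n + 1)) = k := by
    rw [ae_all_iff]; intro K; rw [ae_all_iff]; intro n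
    exact hμ.ae_exists_natCast (measurableSet_bigJumps F t _ _)
      (intensity_bigJumps_lt_top hint h (by positivity) (by omega)).ne
  filter_upwards [h1, h2] with ω hω1 hω2 K0
  obtain ⟨K, hK⟩ := exists_nat_ge K0
  rw [frequently_atTop]
  intro N
  have h3 := hω1 K N
  rw [Ne, measure_biUnion_null_iff (Set.to_countable _)] at h3
  push Not at h3
  obtain ⟨n, hn, hn0⟩ := h3
  have hnN : N + 1 ≤ n := hn
  refine ⟨n, by omega, ?_⟩
  obtain ⟨k, hk⟩ := hω2 K (n - 1)
  rw [Nat.sub_add_cancel (by omega)] at hk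
  -- A nonzero count is a natural number, hence at least one, and a single point already yields the
  -- level.
  have h1le : 1 ≤ μ ω (bigJumps d F t ((K : ℝ) + 1) n) := by
    rw [hk] at hn0 ⊢
    have : k ≠ 0 := by simpa using hn0
    exact_mod_cast Nat.one_le_iff_ne_zero.2 this
  have hFn := h.weight_pos n (by omega)
  calc ENNReal.ofReal (K0 * F n) ≤ ENNReal.ofReal (((K : ℝ) + 1) * F n) := by
        apply ENNReal.ofReal_le_ofReal; gcongr; linarith
    _ ≤ ENNReal.ofReal (((K : ℝ) + 1) * F n) * μ ω (bigJumps d F t ((K : ℝ) + 1) n) :=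
        le_mul_of_one_le_right zero_le h1le
    _ ≤ ENNReal.ofReal (((K : ℝ) + 1) * F n) * μ ω {q : JumpSpace d |
          ENNReal.ofReal (((K : ℝ) + 1) * F n) ≤
            ENNReal.ofReal (heatKernel (t n - q.1) q.2.1 * |q.2.2|)} := by
        gcongr; exact fun q hq => ENNReal.ofReal_le_ofReal hq
    _ ≤ jumpSum (μ ω) (t n) :=
        mul_meas_ge_le_lintegral (measurable_jumpSum_integrand (t n)) _

end Divergent

/-! ### Convergent series: the contribution of recent jumps -/

section Recent

variable {d : ℕ} {lam : Measure ℝ}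

/-- A bound for the heat kernel that is uniform over times in `(0, 1]`. -/
noncomputable def kernelBound (d : ℕ) (y : Space d) : ℝ :=
  kernelConst d / (‖y‖ ^ d * max 1 ‖y‖)

lemma kernelBound_nonneg (y : Space d) : 0 ≤ kernelBound d y := by
  have := one_le_kernelConst d
  unfold kernelBound
  positivity

@[fun_prop]
lemma measurable_kernelBound : Measurable (kernelBound d) := by
  unfold kernelBound
  fun_prop

/-- The two power bounds are used on the two sides of the unit sphere. The origin is excluded
because division by zero makes `kernelBound` vanish there when `d ≥ 1`. -/
lemma heatKernel_le_kernelBound {u : ℝ} (hu : u ≤ 1) {y : Space d} (hy : y ≠ 0) :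
    heatKernel u y ≤ kernelBound d y := by
  have hy0 : 0 < ‖y‖ := norm_pos_iff.2 hy
  rw [kernelBound, le_div_iff₀ (by positivity)]
  rcases le_total ‖y‖ 1 with h | h
  · rw [max_eq_left h, mul_one]; exact heatKernel_mul_norm_pow_le u y
  · rw [max_eq_right h, ← pow_succ]; exact heatKernel_mul_norm_pow_succ_le hu y

lemma volume_norm_pow_le (hd : 1 ≤ d) {b : ℝ} (hb : 0 < b) :
    volume {y : Space d | ‖y‖ ^ d ≤ b} =
      ENNReal.ofReal b * volume (Metric.ball (0 : Space d) 1) := by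
  have hd0 : (d : ℝ) ≠ 0 := by positivity
  have hset : {y : Space d | ‖y‖ ^ d ≤ b} = Metric.closedBall 0 (b ^ (1 / (d : ℝ))) := by
    ext y
    simp only [Set.mem_ofPred_eq, mem_closedBall_zero_iff]
    rw [one_div, Real.le_rpow_inv_iff_of_pos (norm_nonneg y) hb.le (by positivity), Real.rpow_natCast]
  rw [hset, Measure.addHaar_closedBall _ _ (by positivity), finrank_euclideanSpace,
    Fintype.card_fin, ← Real.rpow_natCast, ← Real.rpow_mul hb.le, one_div_mul_cancel hd0,
    Real.rpow_one]

/-- Splitting at `v = b` produces the logarithm behind the condition on `z log |z|` at small jumps.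
-/
lemma lintegral_min_div {b : ℝ} (hb0 : 0 < b) (hb1 : b < 1) :
    ∫⁻ v in Set.Ioc (0 : ℝ) 1, min 1 (ENNReal.ofReal (b / v)) ≤
      ENNReal.ofReal b + ENNReal.ofReal (b * Real.log (1 / b)) := by
  have hun : Set.Ioc (0 : ℝ) 1 ⊆ Set.Ioc 0 b ∪ Set.Ioc b 1 := by
    rw [Set.Ioc_union_Ioc_eq_Ioc hb0.le hb1.le]
  refine (lintegral_mono_set hun).trans ((lintegral_union_le _ _ _).trans (add_le_add ?_ ?_))
  · calc ∫⁻ v in Set.Ioc (0 : ℝ) b, min 1 (ENNReal.ofReal (b / v)) ≤ ∫⁻ v in Set.Ioc (0 : ℝ) b, 1 :=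
          lintegral_mono fun v => min_le_left _ _
      _ = ENNReal.ofReal b := by simp
  · have hint : IntegrableOn (fun v : ℝ => b * v⁻¹) (Set.Ioc b 1) := by
      rw [← intervalIntegrable_iff_integrableOn_Ioc_of_le hb1.le]
      refine (ContinuousOn.intervalIntegrable ?_)
      refine continuousOn_const.mul (continuousOn_inv₀.mono fun v hv => ?_)
      rw [Set.uIcc_of_le hb1.le] at hv
      exact (hb0.trans_le hv.1).ne'
    calc ∫⁻ v in Set.Ioc b 1, min 1 (ENNReal.ofReal (b / v)) ≤
          ∫⁻ v in Set.Ioc b 1, ENNReal.ofReal (b * v⁻¹) :=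
          lintegral_mono fun v => min_le_right _ _
      _ = ENNReal.ofReal (∫ v in Set.Ioc b 1, b * v⁻¹) := by
          rw [ofReal_integral_eq_lintegral_ofReal hint]
          refine (ae_restrict_iff' measurableSet_Ioc).2 (ae_of_all _ fun v hv => ?_)
          have := hb0.trans hv.1
          positivity
      _ ≤ _ := by
          rw [← intervalIntegral.integral_of_le hb1.le, intervalIntegral.integral_const_mul,
            integral_inv_of_pos hb0 one_pos]

/-- Layer-cake formula: the superlevel set at height `v` lies in a ball of volume proportional to `b
/ v`, which reduces the integral to one dimension. -/
lemma lintegral_ball_min (hd : 1 ≤ d) {b : ℝ} (hb0 : 0 < b) (hb1 : b < 1) :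
    ∫⁻ y in Metric.ball (0 : Space d) 1, ENNReal.ofReal (min 1 (b / ‖y‖ ^ d)) ≤
      (ENNReal.ofReal b + ENNReal.ofReal (b * Real.log (1 / b))) *
        volume (Metric.ball (0 : Space d) 1) := by
  set V := volume (Metric.ball (0 : Space d) 1) with hV
  rw [lintegral_eq_lintegral_meas_lt _ (ae_of_all _ fun y => by positivity) (by fun_prop)]
  have hsub : ∀ v ∈ Set.Ioi (0 : ℝ),
      (volume.restrict (Metric.ball (0 : Space d) 1)) {y | v < min 1 (b / ‖y‖ ^ d)} ≤
        (Set.Ioc (0 : ℝ) 1).indicator (fun v => min 1 (ENNReal.ofReal (b / v)) * V) v := by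
    intro v hv
    have hv0 : 0 < v := hv
    by_cases hv1 : v ≤ 1
    · rw [Set.indicator_of_mem (show v ∈ Set.Ioc (0 : ℝ) 1 from ⟨hv0, hv1⟩)]
      rcases le_total 1 (ENNReal.ofReal (b / v)) with h1 | h1
      · rw [min_eq_left h1, one_mul]
        exact (measure_mono (Set.subset_univ _)).trans (by simp [hV])
      · rw [min_eq_right h1, ← volume_norm_pow_le hd (div_pos hb0 hv0)]
        refine (Measure.restrict_apply_le _ _).trans (measure_mono fun y hy => ?_)
        have h2 : v < b / ‖y‖ ^ d := (lt_min_iff.1 hy).2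
        have hy0 : 0 < ‖y‖ ^ d := by
          by_contra hcon
          have : ‖y‖ ^ d = 0 := le_antisymm (not_lt.1 hcon) (by positivity)
          rw [this, div_zero] at h2
          linarith
        rw [lt_div_iff₀ hy0] at h2
        change ‖y‖ ^ d ≤ b / v
        rw [le_div_iff₀ hv0]
        linarith
    · rw [Set.indicator_of_notMem (fun h => hv1 h.2)]
      have : {y : Space d | v < min 1 (b / ‖y‖ ^ d)} = ∅ := by
        ext y
        simp only [Set.mem_ofPred_eq, Set.mem_empty_iff_false, iff_false, not_lt]
        exact (min_le_left _ _).trans (not_le.1 hv1).le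
      rw [this]; simp
  refine (setLIntegral_mono' measurableSet_Ioi hsub).trans ?_
  rw [setLIntegral_indicator measurableSet_Ioc]
  have h3 : Set.Ioc (0 : ℝ) 1 ∩ Set.Ioi 0 = Set.Ioc 0 1 := Set.inter_eq_left.2 fun v hv => hv.1
  rw [h3, lintegral_mul_const _ (by fun_prop)]
  gcongr
  exact lintegral_min_div hb0 hb1

/-- For `kernelConst d * |z| < 1` one has `|z| < 1`, and the logarithmic bound applies. Otherwise
the cap at one is itself dominated by the linear term. -/
lemma lintegral_ball_min_le (hd : 1 ≤ d) (z : ℝ) :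
    ∫⁻ y in Metric.ball (0 : Space d) 1, ENNReal.ofReal (min 1 (kernelBound d y * |z|)) ≤
      (ENNReal.ofReal (kernelConst d * |z|) +
        (Set.Icc (-1 : ℝ) 1).indicator
          (fun z => ENNReal.ofReal (kernelConst d * |z * Real.log z|)) z) *
        volume (Metric.ball (0 : Space d) 1) := by
  have hC := one_le_kernelConst d
  by_cases hz : z = 0
  · subst hz; simp
  have hz0 : 0 < |z| := abs_pos.2 hz
  have hb0 : 0 < kernelConst d * |z| := by positivity
  have h1 : ∫⁻ y in Metric.ball (0 : Space d) 1, ENNReal.ofReal (min 1 (kernelBound d y * |z|)) ≤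
      ∫⁻ y in Metric.ball (0 : Space d) 1,
        ENNReal.ofReal (min 1 (kernelConst d * |z| / ‖y‖ ^ d)) := by
    refine lintegral_mono fun y => ENNReal.ofReal_le_ofReal (min_le_min_left _ ?_)
    rw [kernelBound, div_mul_eq_mul_div]
    by_cases hy : ‖y‖ ^ d = 0
    · simp [hy]
    have : 0 < ‖y‖ ^ d := lt_of_le_of_ne (by positivity) (Ne.symm hy)
    gcongr
    exact le_mul_of_one_le_right this.le (le_max_left _ _)
  refine h1.trans ?_
  rcases lt_or_ge (kernelConst d * |z|) 1 with hb1 | hb1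
  · have hz1 : |z| < 1 := by nlinarith
    have hmem : z ∈ Set.Icc (-1 : ℝ) 1 := ⟨(abs_lt.1 hz1).1.le, (abs_lt.1 hz1).2.le⟩
    refine (lintegral_ball_min hd hb0 hb1).trans ?_
    rw [Set.indicator_of_mem hmem]
    gcongr (_ + ENNReal.ofReal ?_) * _
    rw [mul_assoc, abs_mul]
    refine mul_le_mul_of_nonneg_left (mul_le_mul_of_nonneg_left ?_ hz0.le) (by linarith)
    rw [one_div, Real.log_inv, Real.log_mul (by positivity) hz0.ne', Real.log_abs]
    have := Real.log_nonneg hC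
    have := neg_abs_le (Real.log z)
    linarith
  · calc ∫⁻ y in Metric.ball (0 : Space d) 1, ENNReal.ofReal (min 1 (kernelConst d * |z| / ‖y‖ ^ d))
        ≤ ∫⁻ y in Metric.ball (0 : Space d) 1, 1 :=
          lintegral_mono fun y => ENNReal.ofReal_le_one.2 (min_le_left _ _)
      _ = 1 * volume (Metric.ball (0 : Space d) 1) := by simp
      _ ≤ _ := by
          gcongr
          refine le_add_right ?_
          rw [← ENNReal.ofReal_one]
          exact ENNReal.ofReal_le_ofReal hb1

lemma lintegral_kernelBound_compl_ball_lt_top :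
    ∫⁻ y in (Metric.ball (0 : Space d) 1)ᶜ, ENNReal.ofReal (kernelBound d y) < ∞ := by
  have hC := one_le_kernelConst d
  have hint : Integrable (fun y : Space d => (1 + ‖y‖) ^ (-((d : ℝ) + 1))) :=
    integrable_one_add_norm (by simp)
  have hle : ∀ y ∈ (Metric.ball (0 : Space d) 1)ᶜ, ENNReal.ofReal (kernelBound d y) ≤
      ENNReal.ofReal (kernelConst d * 2 ^ (d + 1)) *
        ENNReal.ofReal ((1 + ‖y‖) ^ (-((d : ℝ) + 1))) := by
    intro y hy
    have hy1 : 1 ≤ ‖y‖ := by simpa using hy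
    rw [← ENNReal.ofReal_mul (by positivity)]
    apply ENNReal.ofReal_le_ofReal
    rw [kernelBound, max_eq_right hy1, ← pow_succ, Real.rpow_neg (by positivity),
      show ((d : ℝ) + 1) = ((d + 1 : ℕ) : ℝ) by push_cast; ring, Real.rpow_natCast,
      ← div_eq_mul_inv, div_le_div_iff₀ (by positivity) (by positivity), mul_assoc, ← mul_pow]
    gcongr
    linarith
  refine (setLIntegral_mono' Metric.isOpen_ball.measurableSet.compl hle).trans_lt ?_
  rw [lintegral_const_mul' _ _ ENNReal.ofReal_ne_top]
  refine ENNReal.mul_lt_top ENNReal.ofReal_lt_top ?_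
  refine (setLIntegral_le_lintegral _ _).trans_lt ?_
  rw [← ofReal_integral_eq_lintegral_ofReal hint (ae_of_all _ fun y => by positivity)]
  exact ENNReal.ofReal_lt_top

/-- The mean contribution of recent jumps is finite. -/
lemma lintegral_min_kernelBound_lt_top [SigmaFinite lam] (hd : 1 ≤ d)
    (hint : Integrable (fun z : ℝ => z) lam)
    (hlog : IntegrableOn (fun z : ℝ => |z * Real.log z|) (Set.Icc (-1) 1) lam) :
    ∫⁻ y : Space d, ∫⁻ z, ENNReal.ofReal (min 1 (kernelBound d y * |z|)) ∂lam < ∞ := by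
  have hC := one_le_kernelConst d
  rw [lintegral_lintegral_swap (by simp only [Function.uncurry_def]; fun_prop)]
  set V := volume (Metric.ball (0 : Space d) 1) with hV
  have hVt : V ≠ ∞ := measure_ball_lt_top.ne
  set W := ∫⁻ y in (Metric.ball (0 : Space d) 1)ᶜ, ENNReal.ofReal (kernelBound d y) with hW
  have hWt : W ≠ ∞ := lintegral_kernelBound_compl_ball_lt_top.ne
  have hpt : ∀ z : ℝ, ∫⁻ y : Space d, ENNReal.ofReal (min 1 (kernelBound d y * |z|)) ≤
      (ENNReal.ofReal (kernelConst d * |z|) +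
        (Set.Icc (-1 : ℝ) 1).indicator
          (fun z => ENNReal.ofReal (kernelConst d * |z * Real.log z|)) z) * V +
        W * ENNReal.ofReal |z| := by
    intro z
    rw [← lintegral_add_compl _ (Metric.isOpen_ball (x := (0 : Space d)) (ε := 1)).measurableSet]
    refine add_le_add (lintegral_ball_min_le hd z) ?_
    rw [hW, ← lintegral_mul_const' _ _ ENNReal.ofReal_ne_top]
    refine lintegral_mono fun y => ?_
    rw [← ENNReal.ofReal_mul (kernelBound_nonneg y)]
    exact ENNReal.ofReal_le_ofReal (min_le_right _ _)
  refine (lintegral_mono hpt).trans_lt ?_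
  have hm1 : Measurable ((Set.Icc (-1 : ℝ) 1).indicator
      (fun z => ENNReal.ofReal (kernelConst d * |z * Real.log z|))) :=
    Measurable.indicator (by fun_prop) measurableSet_Icc
  have habs : ∫⁻ z, ENNReal.ofReal |z| ∂lam < ∞ := by
    rw [lintegral_abs hint]; exact ENNReal.ofReal_lt_top
  rw [lintegral_add_right _ (by fun_prop), lintegral_mul_const' _ _ hVt,
    lintegral_const_mul' _ _ hWt, lintegral_add_right _ hm1, lintegral_indicator measurableSet_Icc]
  simp_rw [ENNReal.ofReal_mul (by linarith : (0 : ℝ) ≤ kernelConst d)]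
  rw [lintegral_const_mul' _ _ ENNReal.ofReal_ne_top, lintegral_const_mul' _ _ ENNReal.ofReal_ne_top]
  refine ENNReal.add_lt_top.2 ⟨ENNReal.mul_lt_top (ENNReal.add_lt_top.2
    ⟨ENNReal.mul_lt_top ENNReal.ofReal_lt_top habs, ENNReal.mul_lt_top ENNReal.ofReal_lt_top ?_⟩)
      hVt.lt_top, ENNReal.mul_lt_top hWt.lt_top habs⟩
  rw [← ofReal_integral_eq_lintegral_ofReal hlog (ae_of_all _ fun z => abs_nonneg _)]
  exact ENNReal.ofReal_lt_top

end Recent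

/-! ### Convergent series: the large contributions -/

section Large

variable {d : ℕ} {lam : Measure ℝ}

/-- Converse to `inv_le_heatKernel`: the bound at the spatial maximum limits the age, and the bound
uniform in time limits the distance. -/
lemma bounds_of_inv_le_heatKernel (hd : 1 ≤ d) {ρ u : ℝ} (hρ : 0 < ρ) {y : Space d}
    (h : ρ⁻¹ ≤ heatKernel u y) :
    0 < u ∧ u ≤ ρ ^ (2 / (d : ℝ)) ∧ ‖y‖ ^ d ≤ kernelConst d * ρ := by
  have hd0 : (d : ℝ) ≠ 0 := by positivity
  have hu : 0 < u := by
    by_contra hcon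
    rw [heatKernel_of_nonpos (not_lt.1 hcon)] at h
    exact absurd h (not_le.2 (inv_pos.2 hρ))
  refine ⟨hu, ?_, ?_⟩
  · have h1 := h.trans (heatKernel_le_inv hu y)
    rw [inv_le_inv₀ hρ (by positivity)] at h1
    have h2 : √u ^ d ≤ ρ := by
      refine le_trans (pow_le_pow_left₀ (Real.sqrt_nonneg _) (Real.sqrt_le_sqrt ?_) d) h1
      nlinarith [Real.pi_gt_three]
    have h3 : u = (√u ^ d) ^ (2 / (d : ℝ)) := by
      rw [Real.sqrt_eq_rpow, ← Real.rpow_natCast, ← Real.rpow_mul hu.le, ← Real.rpow_mul hu.le]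
      have : 1 / 2 * (d : ℝ) * (2 / d) = 1 := by field_simp
      rw [this, Real.rpow_one]
    calc u = (√u ^ d) ^ (2 / (d : ℝ)) := h3
      _ ≤ _ := by gcongr
  · have h1 := heatKernel_mul_norm_pow_le u y
    have h2 : ρ⁻¹ * ‖y‖ ^ d ≤ kernelConst d := le_trans (by gcongr) h1
    rw [inv_mul_le_iff₀ hρ] at h2
    linarith

/-- Each jump is assigned to the first time `t (i + 1)` after its occurrence. The weights increase,
so a jump large at a later time exceeds the level of `F (i + 1)` as well. Its age at `t (i + 1)` is
then at most both the age bound and the increment. -/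
lemma spaceTime_bigJumps_le (hd : 1 ≤ d) {t F : ℕ → ℝ} (h : IsAdmissible t F) {δ z : ℝ}
    (hδ : 0 < δ) (hz : z ≠ 0) :
    spaceTime d {p | (p.1, p.2, z) ∈ ⋃ k ∈ Set.Ici 1, bigJumps d F t δ k} ≤
      ∑' n : ℕ, ENNReal.ofReal (min ((|z| / (δ * F (n + 1))) ^ (2 / (d : ℝ))) (t (n + 1) - t n)) *
        (ENNReal.ofReal (kernelConst d * (|z| / (δ * F (n + 1)))) *
          volume (Metric.ball (0 : Space d) 1)) := by
  have hz0 : 0 < |z| := abs_pos.2 hz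
  have hC := one_le_kernelConst d
  have hρ : ∀ k, 1 ≤ k → 0 < |z| / (δ * F k) := fun k hk =>
    div_pos hz0 (mul_pos hδ (h.weight_pos k hk))
  let B : ℕ → Set (ℝ × Space d) := fun n =>
    Set.Ico (t (n + 1) - min ((|z| / (δ * F (n + 1))) ^ (2 / (d : ℝ))) (t (n + 1) - t n))
      (t (n + 1)) ×ˢ {y : Space d | ‖y‖ ^ d ≤ kernelConst d * (|z| / (δ * F (n + 1)))}
  have hsub : {p : ℝ × Space d | (p.1, p.2, z) ∈ ⋃ k ∈ Set.Ici 1, bigJumps d F t δ k} ⊆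
      (Set.Iic 0 ×ˢ Set.univ) ∪ ⋃ n, B n := by
    rintro ⟨s, y⟩ hp
    obtain ⟨k, hk, hq⟩ := Set.mem_iUnion₂.1 hp
    have hk1 : 1 ≤ k := hk
    have hq' : δ * F k ≤ heatKernel (t k - s) y * |z| := hq
    by_cases hs : s ≤ 0
    · exact Or.inl ⟨hs, trivial⟩
    right
    have hst : s < t k := by
      by_contra hcon
      rw [heatKernel_of_nonpos (by linarith), zero_mul] at hq'
      exact absurd hq' (not_le.2 (mul_pos hδ (h.weight_pos k hk1)))
    classical
    have hex : ∃ i, s < t i := ⟨k, hst⟩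
    have hN0 : Nat.find hex ≠ 0 := by
      intro h0
      have := Nat.find_spec hex
      rw [h0, h.zero] at this
      exact hs this.le
    obtain ⟨i, hi⟩ := Nat.exists_eq_succ_of_ne_zero hN0
    have hi1 : s < t (i + 1) := by have := Nat.find_spec hex; rwa [hi] at this
    have hi2 : t i ≤ s := not_lt.1 (Nat.find_min hex (m := i) (by omega))
    have hik : i + 1 ≤ k := by have := Nat.find_min' hex hst; omega
    have hFi := h.weight_pos (i + 1) (by omega)
    have hFik := h.weight_mono (i + 1) k (by omega) hik
    have hinv : (|z| / (δ * F (i + 1)))⁻¹ ≤ heatKernel (t k - s) y := by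
      rw [inv_div, div_le_iff₀ hz0]
      exact le_trans (by gcongr) hq'
    obtain ⟨_, hu, hy⟩ := bounds_of_inv_le_heatKernel hd (hρ (i + 1) (by omega)) hinv
    refine Set.mem_iUnion.2 ⟨i, ⟨?_, hi1⟩, hy⟩
    have h1 : t (i + 1) ≤ t k := h.mono hik
    have h2 : t (i + 1) - s ≤ min ((|z| / (δ * F (i + 1))) ^ (2 / (d : ℝ))) (t (i + 1) - t i) :=
      le_min (by linarith) (by linarith)
    change t (i + 1) - min ((|z| / (δ * F (i + 1))) ^ (2 / (d : ℝ))) (t (i + 1) - t i) ≤ s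
    linarith
  refine (measure_mono hsub).trans ((measure_union_le _ _).trans ?_)
  have h0 : spaceTime d (Set.Iic (0 : ℝ) ×ˢ (Set.univ : Set (Space d))) = 0 := by
    rw [spaceTime, Measure.prod_prod, Measure.restrict_apply measurableSet_Iic]
    have : Set.Iic (0 : ℝ) ∩ Set.Ioi 0 = ∅ := by ext s; simp
    rw [this]; simp
  rw [h0, zero_add]
  refine (measure_iUnion_le _).trans (ENNReal.tsum_le_tsum fun n => ?_)
  have := hρ (n + 1) (by omega)
  rw [spaceTime, Measure.prod_prod, volume_norm_pow_le hd (by positivity)]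
  gcongr
  refine (Measure.restrict_apply_le _ _).trans ?_
  rw [Real.volume_Ico]
  simp

lemma intensity_iUnion_bigJumps_lt_top [SigmaFinite lam] (hd : 1 ≤ d) {t F : ℕ → ℝ}
    (h : IsAdmissible t F) {δ : ℝ} (hδ : 0 < δ) (hser : levySeries d lam F t < ∞) :
    intensity d lam (⋃ k ∈ Set.Ici 1, bigJumps d F t δ k) < ∞ := by
  have hC := one_le_kernelConst d
  have hQ : MeasurableSet (⋃ k ∈ Set.Ici 1, bigJumps d F t δ k) :=
    MeasurableSet.biUnion (Set.to_countable _) fun k _ => measurableSet_bigJumps F t δ k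
  have hν : intensity d lam (⋃ k ∈ Set.Ici 1, bigJumps d F t δ k) =
      ∫⁻ z, spaceTime d {p | (p.1, p.2, z) ∈ ⋃ k ∈ Set.Ici 1, bigJumps d F t δ k} ∂lam := by
    rw [← lintegral_indicator_one hQ, lintegral_intensity_swap (measurable_one.indicator hQ)]
    refine lintegral_congr fun z => ?_
    rw [← lintegral_indicator_one]
    · rfl
    · exact hQ.preimage (by fun_prop : Measurable fun p : ℝ × Space d => (p.1, p.2, z))
  set V := volume (Metric.ball (0 : Space d) 1) with hV
  have hVt : V ≠ ∞ := measure_ball_lt_top.ne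
  set D : ℝ := max 1 (δ⁻¹ ^ (2 / (d : ℝ))) * (kernelConst d * δ⁻¹) with hD
  have hpt : ∀ z : ℝ, spaceTime d {p | (p.1, p.2, z) ∈ ⋃ k ∈ Set.Ici 1, bigJumps d F t δ k} ≤
      (ENNReal.ofReal D * V) * ∑' n : ℕ, ENNReal.ofReal
        (min ((|z| / F (n + 1)) ^ (2 / (d : ℝ))) (t (n + 1) - t n) * (|z| / F (n + 1))) := by
    intro z
    by_cases hz : z = 0
    · have : {p : ℝ × Space d | (p.1, p.2, z) ∈ ⋃ k ∈ Set.Ici 1, bigJumps d F t δ k} = ∅ := by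
        ext p
        simp only [Set.mem_ofPred_eq, Set.mem_iUnion, Set.mem_empty_iff_false, iff_false, not_exists]
        intro k hk hq
        have hq' : δ * F k ≤ heatKernel (t k - p.1) p.2 * |z| := hq
        rw [hz, abs_zero, mul_zero] at hq'
        exact absurd hq' (not_le.2 (mul_pos hδ (h.weight_pos k hk)))
      rw [this]; simp
    refine (spaceTime_bigJumps_le hd h hδ hz).trans ?_
    rw [← ENNReal.tsum_mul_left]
    refine ENNReal.tsum_le_tsum fun n => ?_
    have hF := h.weight_pos (n + 1) (by omega)
    have hΔ : 0 ≤ t (n + 1) - t n := sub_nonneg.2 (h.mono (Nat.le_succ n))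
    have hz0 : 0 < |z| := abs_pos.2 hz
    have e1 : |z| / (δ * F (n + 1)) = δ⁻¹ * (|z| / F (n + 1)) := by field_simp
    rw [← mul_assoc, ← ENNReal.ofReal_mul (le_min (by positivity) hΔ), mul_right_comm,
      ← ENNReal.ofReal_mul (by positivity)]
    gcongr ENNReal.ofReal ?_ * _
    rw [e1, Real.mul_rpow (by positivity) (by positivity)]
    set m := max 1 (δ⁻¹ ^ (2 / (d : ℝ))) with hm
    have h4 : min (δ⁻¹ ^ (2 / (d : ℝ)) * (|z| / F (n + 1)) ^ (2 / (d : ℝ))) (t (n + 1) - t n) ≤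
        m * min ((|z| / F (n + 1)) ^ (2 / (d : ℝ))) (t (n + 1) - t n) := by
      rw [mul_min_of_nonneg _ _ (by positivity : 0 ≤ m)]
      refine min_le_min ?_ ?_
      · exact mul_le_mul_of_nonneg_right (le_max_right _ _) (by positivity)
      · exact le_mul_of_one_le_left hΔ (le_max_left _ _)
    calc _ ≤ m * min ((|z| / F (n + 1)) ^ (2 / (d : ℝ))) (t (n + 1) - t n) *
          (kernelConst d * (δ⁻¹ * (|z| / F (n + 1)))) := by gcongr
      _ = _ := by rw [hD]; ring
  rw [hν]
  refine (lintegral_mono hpt).trans_lt ?_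
  rw [lintegral_const_mul' _ _ (ENNReal.mul_ne_top ENNReal.ofReal_ne_top hVt),
    lintegral_tsum fun n => by fun_prop]
  exact ENNReal.mul_lt_top (ENNReal.mul_lt_top ENNReal.ofReal_lt_top hVt.lt_top) hser

/-- The total contribution of the points in a set of finite intensity stays bounded. -/
lemma ae_exists_setLIntegral_le {Ω : Type*} [MeasurableSpace Ω] {P : Measure Ω}
    {μ : Ω → Measure (JumpSpace d)} (hμ : IsPoissonRandomMeasure P (intensity d lam) μ)
    {B : Set (JumpSpace d)} (hB : MeasurableSet B) (hν : intensity d lam B < ∞) :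
    ∀ᵐ ω ∂P, ∃ C : ℝ≥0, ∀ᶠ x : ℝ in atTop,
      ∫⁻ q in B, ENNReal.ofReal (heatKernel (x - q.1) q.2.1 * |q.2.2|) ∂(μ ω) ≤ C := by
  -- The points of `B` that are late or large. As `B` carries finitely many points, one of these
  -- sets has measure zero.
  let D : ℕ → Set (JumpSpace d) := fun M => B ∩ {q | (M : ℝ) < max q.1 |q.2.2|}
  have hDm : ∀ M, MeasurableSet (D M) := fun M =>
    hB.inter (measurableSet_lt measurable_const (by fun_prop))
  have hDanti : Antitone D := fun M M' hMM' q hq =>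
    ⟨hq.1, lt_of_le_of_lt (Nat.cast_le.2 hMM' : (M : ℝ) ≤ M') hq.2⟩
  have hDemp : ⋂ M, D M = ∅ := by
    ext q
    simp only [Set.mem_iInter, Set.mem_empty_iff_false, iff_false, not_forall]
    obtain ⟨M, hM⟩ := exists_nat_ge (max q.1 |q.2.2|)
    exact ⟨M, fun hq => absurd hq.2 (not_lt.2 hM)⟩
  have h1 : ∀ᵐ ω ∂P, ∀ M, ∃ k : ℕ, μ ω (D M) = k := by
    rw [ae_all_iff]
    exact fun M => hμ.ae_exists_natCast (hDm M)
      ((measure_mono Set.inter_subset_left).trans_lt hν).ne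
  filter_upwards [h1, hμ.ae_exists_natCast hB hν.ne] with ω hω1 hω2
  obtain ⟨k, hk⟩ := hω2
  have hfin : μ ω B ≠ ∞ := by rw [hk]; exact ENNReal.natCast_ne_top k
  have hlim := tendsto_measure_iInter_atTop (μ := μ ω) (fun M => (hDm M).nullMeasurableSet) hDanti
    ⟨0, ((measure_mono Set.inter_subset_left).trans_lt hfin.lt_top).ne⟩
  rw [hDemp, measure_empty] at hlim
  obtain ⟨M, hM⟩ := (hlim.eventually_lt_const (zero_lt_one)).exists
  have hM0 : μ ω (D M) = 0 := by
    obtain ⟨l, hl⟩ := hω1 M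
    rw [Function.comp_apply] at hM
    rw [hl] at hM ⊢
    have : l < 1 := by exact_mod_cast hM
    simp [Nat.lt_one_iff.1 this]
  refine ⟨M * k, ?_⟩
  -- From time `M + 1` on, every remaining point has age at least one, where the kernel is at most
  -- one.
  filter_upwards [eventually_ge_atTop ((M : ℝ) + 1)] with x hx
  have hae : ∀ᵐ q ∂(μ ω).restrict B,
      ENNReal.ofReal (heatKernel (x - q.1) q.2.1 * |q.2.2|) ≤ (M : ℝ≥0∞) := by
    rw [ae_restrict_iff' hB]
    have hnull : ∀ᵐ q ∂(μ ω), q ∉ D M := by rw [ae_iff]; simpa using hM0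
    filter_upwards [hnull] with q hq hqB
    have h2 : max q.1 |q.2.2| ≤ M := by
      by_contra hcon
      exact hq ⟨hqB, not_le.1 hcon⟩
    obtain ⟨h3, h4⟩ := max_le_iff.1 h2
    rw [← ENNReal.ofReal_natCast]
    apply ENNReal.ofReal_le_ofReal
    calc heatKernel (x - q.1) q.2.1 * |q.2.2| ≤ 1 * M :=
          mul_le_mul (heatKernel_le_one (by linarith) _) h4 (abs_nonneg _) zero_le_one
      _ = M := one_mul _
  refine (lintegral_mono_ae hae).trans ?_
  rw [lintegral_const, Measure.restrict_apply_univ, hk]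
  simp

end Large

/-! ### Convergent series: concentration on short time windows -/

section Window

variable {d : ℕ} {lam : Measure ℝ}

lemma exp_sub_one_le_mul_exp (x : ℝ) : Real.exp x - 1 ≤ x * Real.exp x := by
  have h1 := Real.add_one_le_exp (-x)
  have h2 : Real.exp (-x) * Real.exp x = 1 := by rw [← Real.exp_add]; simp
  nlinarith [Real.exp_pos x]

/-- The linear term keeps its exact coefficient one, which is needed for the sharp mean. The
remainder has order only `1 + ε`, matching the available moment. -/
lemma exp_sub_one_le_add {x ε : ℝ} (hx : 0 ≤ x) (hε : 0 ≤ ε) (hε1 : ε ≤ 1) :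
    Real.exp x - 1 ≤ x + x ^ (1 + ε) * Real.exp x := by
  have h1 := exp_sub_one_le_mul_exp x
  rcases hx.eq_or_lt with rfl | hx0
  · simp only [Real.exp_zero, sub_self, zero_add, mul_one]
    positivity
  rcases le_total x 1 with h | h
  · have h2 : x ^ (2 : ℝ) ≤ x ^ (1 + ε) :=
      Real.rpow_le_rpow_of_exponent_ge hx0 h (by linarith)
    rw [Real.rpow_two] at h2
    have h3 : Real.exp x - 1 - x ≤ x * (Real.exp x - 1) := by linarith
    have h4 : x * (Real.exp x - 1) ≤ x * (x * Real.exp x) := mul_le_mul_of_nonneg_left h1 hx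
    have h5 : x ^ 2 * Real.exp x ≤ x ^ (1 + ε) * Real.exp x := by gcongr
    nlinarith
  · have h2 : x ^ (1 : ℝ) ≤ x ^ (1 + ε) := Real.rpow_le_rpow_of_exponent_le h (by linarith)
    rw [Real.rpow_one] at h2
    have h5 : x * Real.exp x ≤ x ^ (1 + ε) * Real.exp x := by gcongr
    linarith

/-- A bound, uniform over `x ∈ [σ, σ + a]`, for the contribution of a jump to the sum at time `x`,
relative to the weight `F`. -/
noncomputable def windowBound (e σ a F : ℝ) (q : JumpSpace d) : ℝ :=
  if q.1 < σ - a / e then (1 + e) ^ d * heatKernel (σ + a - q.1) q.2.1 * |q.2.2| / F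
  else if q.1 < σ + a then kernelBound d q.2.1 * |q.2.2| else 0

lemma measurable_windowBound (e σ a F : ℝ) :
    Measurable (windowBound (d := d) e σ a F) := by
  unfold windowBound
  refine Measurable.ite (measurableSet_lt measurable_fst measurable_const) (by fun_prop) ?_
  exact Measurable.ite (measurableSet_lt measurable_fst measurable_const) (by fun_prop)
    measurable_const

lemma windowBound_nonneg {e σ a F : ℝ} (he : 0 < e) (hF : 0 < F) (q : JumpSpace d) :
    0 ≤ windowBound e σ a F q := by
  unfold windowBound
  split_ifs
  · have := heatKernel_nonneg (σ + a - q.1) q.2.1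
    positivity
  · have := kernelBound_nonneg q.2.1
    positivity
  · exact le_rfl

/-- Points older than `a / e` at the start of the window age by a factor of at most `1 + e` during
it, so the kernel at the end controls the whole window. Younger points have age at most `a + a / e ≤
1` and are bounded uniformly in time. -/
lemma contribution_le_windowBound {e σ a F G x δ : ℝ} (he : 0 < e) (ha : 0 < a) (hF : 1 ≤ F)
    (hae : a + a / e ≤ 1) (hx1 : σ ≤ x) (hx2 : x ≤ σ + a) (hFG : F ≤ G) {q : JumpSpace d}
    (hq : q.2.1 ≠ 0) (hδ : heatKernel (x - q.1) q.2.1 * |q.2.2| ≤ δ * G) :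
    ENNReal.ofReal (heatKernel (x - q.1) q.2.1 * |q.2.2|) ≤
      ENNReal.ofReal G * ENNReal.ofReal (min δ (windowBound e σ a F q)) := by
  have hG : 0 < G := by linarith
  rw [← ENNReal.ofReal_mul hG.le]
  apply ENNReal.ofReal_le_ofReal
  rw [mul_min_of_nonneg _ _ hG.le]
  refine le_min (by linarith) ?_
  have hk := heatKernel_nonneg (x - q.1) q.2.1
  unfold windowBound
  split_ifs with h1 h2
  · have hu : a / e ≤ x - q.1 := by linarith
    have hae0 : 0 < a / e := div_pos ha he
    have hu' : a ≤ e * (x - q.1) := by rw [div_le_iff₀ he] at hu; linarith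
    have h3 := heatKernel_le_mul (e := e) (u := x - q.1) (v := σ + a - q.1) (by linarith)
      (by linarith) (by linarith) he.le q.2.1
    have h4 := heatKernel_nonneg (σ + a - q.1) q.2.1
    calc heatKernel (x - q.1) q.2.1 * |q.2.2| ≤
          (1 + e) ^ d * heatKernel (σ + a - q.1) q.2.1 * |q.2.2| := by gcongr
      _ = F * ((1 + e) ^ d * heatKernel (σ + a - q.1) q.2.1 * |q.2.2| / F) := by field_simp
      _ ≤ _ := by gcongr
  · have h3 := heatKernel_le_kernelBound (u := x - q.1) (by linarith) hq
    have h4 := kernelBound_nonneg q.2.1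
    calc heatKernel (x - q.1) q.2.1 * |q.2.2| ≤ 1 * (kernelBound d q.2.1 * |q.2.2|) := by
          rw [one_mul]; gcongr
      _ ≤ _ := by gcongr; linarith
  · rw [heatKernel_of_nonpos (by linarith)]; simp

/-- The first summand is the linear part, which yields the mean. The others are errors: the
superlinear remainder at ages above one, where `g ^ (1 + ε) ≤ g`; old points of age at most one,
where the kernel may be large; and the young points. -/
lemma exp_windowBound_le {e σ a F δ θ ε : ℝ} (he : 0 < e) (hF : 1 ≤ F)
    (hδ : 0 < δ) (hδ1 : δ ≤ 1) (hθ : 0 ≤ θ) (hε : 0 ≤ ε) (hε1 : ε ≤ 1) (q : JumpSpace d) :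
    Real.exp (θ * min δ (windowBound e σ a F q)) - 1 ≤
      heatKernel (σ + a - q.1) q.2.1 * (θ * (1 + e) ^ d / F * |q.2.2|) +
      heatKernel (σ + a - q.1) q.2.1 *
        ((θ * (1 + e) ^ d / F) ^ (1 + ε) * Real.exp (θ * δ) * |q.2.2| ^ (1 + ε)) +
      (Set.Ici (σ + a - 1)).indicator 1 q.1 * heatKernel (σ + a - q.1) q.2.1 *
        (θ * (1 + e) ^ d / F * Real.exp (θ * δ) * |q.2.2|) +
      (Set.Ico (σ - a / e) (σ + a)).indicator 1 q.1 * (θ * Real.exp (θ * δ)) *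
        min 1 (kernelBound d q.2.1 * |q.2.2|) := by
  have hF0 : 0 < F := by linarith
  have hk := heatKernel_nonneg (σ + a - q.1) q.2.1
  have hkb := kernelBound_nonneg q.2.1
  have hw := windowBound_nonneg (σ := σ) (a := a) he hF0 q
  set x := θ * min δ (windowBound e σ a F q) with hx
  set α := θ * (1 + e) ^ d / F with hα
  set E := Real.exp (θ * δ) with hE
  have hα0 : 0 ≤ α := by positivity
  have hE0 : 0 < E := Real.exp_pos _
  have hx0 : 0 ≤ x := mul_nonneg hθ (le_min hδ.le hw)
  have hxE : Real.exp x ≤ E := Real.exp_le_exp.2 (mul_le_mul_of_nonneg_left (min_le_left _ _) hθ)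
  have hx1 := exp_sub_one_le_mul_exp x
  have hi1 : 0 ≤ (Set.Ici (σ + a - 1)).indicator (1 : ℝ → ℝ) q.1 :=
    Set.indicator_nonneg (fun _ _ => zero_le_one) _
  have hi2 : 0 ≤ (Set.Ico (σ - a / e) (σ + a)).indicator (1 : ℝ → ℝ) q.1 :=
    Set.indicator_nonneg (fun _ _ => zero_le_one) _
  have t1 : 0 ≤ heatKernel (σ + a - q.1) q.2.1 * (α * |q.2.2|) := by positivity
  have t2 : 0 ≤ heatKernel (σ + a - q.1) q.2.1 * (α ^ (1 + ε) * E * |q.2.2| ^ (1 + ε)) := by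
    positivity
  have t3 : 0 ≤ (Set.Ici (σ + a - 1)).indicator 1 q.1 * heatKernel (σ + a - q.1) q.2.1 *
      (α * E * |q.2.2|) := by positivity
  have hmin : 0 ≤ min 1 (kernelBound d q.2.1 * |q.2.2|) := le_min zero_le_one (by positivity)
  have t4 : 0 ≤ (Set.Ico (σ - a / e) (σ + a)).indicator 1 q.1 * (θ * E) *
      min 1 (kernelBound d q.2.1 * |q.2.2|) := by positivity
  by_cases h1 : q.1 < σ - a / e
  · have hxX : x ≤ heatKernel (σ + a - q.1) q.2.1 * (α * |q.2.2|) := by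
      rw [hx, windowBound, if_pos h1, hα]
      refine (mul_le_mul_of_nonneg_left (min_le_right _ _) hθ).trans (le_of_eq ?_)
      ring
    by_cases h2 : σ + a - 1 ≤ q.1
    · have h3 : x * Real.exp x ≤ heatKernel (σ + a - q.1) q.2.1 * (α * |q.2.2|) * E :=
        mul_le_mul hxX hxE (Real.exp_pos _).le t1
      have h4 : (Set.Ici (σ + a - 1)).indicator (1 : ℝ → ℝ) q.1 = 1 :=
        Set.indicator_of_mem (show q.1 ∈ Set.Ici (σ + a - 1) from h2) _
      rw [h4] at t3 ⊢
      nlinarith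
    · have hk1 : heatKernel (σ + a - q.1) q.2.1 ≤ 1 := heatKernel_le_one (by linarith) _
      have h3 := exp_sub_one_le_add hx0 hε hε1
      have h5 : x ^ (1 + ε) ≤ heatKernel (σ + a - q.1) q.2.1 * (α ^ (1 + ε) * |q.2.2| ^ (1 + ε)) := by
        calc x ^ (1 + ε) ≤ (heatKernel (σ + a - q.1) q.2.1 * (α * |q.2.2|)) ^ (1 + ε) := by gcongr
          _ = heatKernel (σ + a - q.1) q.2.1 ^ (1 + ε) * (α ^ (1 + ε) * |q.2.2| ^ (1 + ε)) := by
              rw [Real.mul_rpow hk (by positivity), Real.mul_rpow hα0 (abs_nonneg _)]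
          _ ≤ heatKernel (σ + a - q.1) q.2.1 ^ (1 : ℝ) * (α ^ (1 + ε) * |q.2.2| ^ (1 + ε)) := by
              gcongr ?_ * _
              rcases hk.eq_or_lt with h0 | h0
              · rw [← h0, Real.zero_rpow (by linarith), Real.rpow_one]
              · exact Real.rpow_le_rpow_of_exponent_ge h0 hk1 (by linarith)
          _ = _ := by rw [Real.rpow_one]
      have h6 : x ^ (1 + ε) * Real.exp x ≤
          heatKernel (σ + a - q.1) q.2.1 * (α ^ (1 + ε) * |q.2.2| ^ (1 + ε)) * E :=
        mul_le_mul h5 hxE (Real.exp_pos _).le (by positivity)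
      nlinarith
  · by_cases h2 : q.1 < σ + a
    · have h4 : (Set.Ico (σ - a / e) (σ + a)).indicator (1 : ℝ → ℝ) q.1 = 1 :=
        Set.indicator_of_mem (show q.1 ∈ Set.Ico (σ - a / e) (σ + a) from ⟨not_lt.1 h1, h2⟩) _
      have hxX : x ≤ θ * min 1 (kernelBound d q.2.1 * |q.2.2|) := by
        rw [hx, windowBound, if_neg h1, if_pos h2]
        gcongr
      have h3 : x * Real.exp x ≤ θ * min 1 (kernelBound d q.2.1 * |q.2.2|) * E :=
        mul_le_mul hxX hxE (Real.exp_pos _).le (by positivity)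
      rw [h4] at t4 ⊢
      nlinarith
    · have hx' : x = 0 := by
        rw [hx, windowBound, if_neg h1, if_neg h2, min_eq_right hδ.le, mul_zero]
      rw [hx', Real.exp_zero]
      linarith

/-- The four summands are integrated in turn, the first three by the unit mass of the kernel and the
last by the finiteness of `hK`, where the short window enters as a factor. -/
lemma lintegral_exp_windowBound_le [SigmaFinite lam] (hint : Integrable (fun z : ℝ => z) lam)
    {e σ a F δ θ ε : ℝ} (hε : 0 ≤ ε) (hε1 : ε ≤ 1)
    (hmom : Integrable (fun z : ℝ => |z| ^ (1 + ε)) lam)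
    (hK : ∫⁻ y : Space d, ∫⁻ z, ENNReal.ofReal (min 1 (kernelBound d y * |z|)) ∂lam < ∞)
    (he : 0 < e) (ha : 0 < a) (hσ : 0 ≤ σ) (hF : 1 ≤ F)
    (hδ : 0 < δ) (hδ1 : δ ≤ 1) (hθ : 0 ≤ θ) :
    ∫⁻ q : JumpSpace d, ENNReal.ofReal (Real.exp (θ * min δ (windowBound e σ a F q)) - 1)
        ∂(intensity d lam) ≤
      ENNReal.ofReal ((σ + a) * (θ * (1 + e) ^ d / F * absMean lam) +
        (σ + a) * ((θ * (1 + e) ^ d / F) ^ (1 + ε) * Real.exp (θ * δ) *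
          ∫ z, |z| ^ (1 + ε) ∂lam) +
        θ * (1 + e) ^ d / F * Real.exp (θ * δ) * absMean lam +
        (a + a / e) * (θ * Real.exp (θ * δ)) *
          (∫⁻ y : Space d, ∫⁻ z, ENNReal.ofReal (min 1 (kernelBound d y * |z|)) ∂lam).toReal) := by
  have hF0 : 0 < F := by linarith
  set α := θ * (1 + e) ^ d / F with hα
  set E := Real.exp (θ * δ) with hE
  have hα0 : 0 ≤ α := by positivity
  have hE0 : 0 < E := Real.exp_pos _
  have hm0 := absMean_nonneg lam
  have hmε : 0 ≤ ∫ z, |z| ^ (1 + ε) ∂lam := integral_nonneg fun z => by positivity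
  have hI1 : Measurable ((Set.Ici (σ + a - 1)).indicator (1 : ℝ → ℝ≥0∞)) :=
    measurable_one.indicator measurableSet_Ici
  have hI2 : Measurable ((Set.Ico (σ - a / e) (σ + a)).indicator (1 : ℝ → ℝ≥0∞)) :=
    measurable_one.indicator measurableSet_Ico
  have hI0 : Measurable ((Set.univ : Set ℝ).indicator (1 : ℝ → ℝ≥0∞)) :=
    measurable_one.indicator MeasurableSet.univ
  have hofInd : ∀ (A : Set ℝ) s, ENNReal.ofReal (A.indicator (1 : ℝ → ℝ) s) =
      A.indicator (1 : ℝ → ℝ≥0∞) s := by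
    intro A s
    by_cases hs : s ∈ A <;> simp [hs]
  have hpt : ∀ q : JumpSpace d,
      ENNReal.ofReal (Real.exp (θ * min δ (windowBound e σ a F q)) - 1) ≤
      (Set.univ : Set ℝ).indicator 1 q.1 * ENNReal.ofReal (heatKernel (σ + a - q.1) q.2.1) *
          ENNReal.ofReal (α * |q.2.2|) +
      (Set.univ : Set ℝ).indicator 1 q.1 * ENNReal.ofReal (heatKernel (σ + a - q.1) q.2.1) *
          ENNReal.ofReal (α ^ (1 + ε) * E * |q.2.2| ^ (1 + ε)) +
      (Set.Ici (σ + a - 1)).indicator 1 q.1 * ENNReal.ofReal (heatKernel (σ + a - q.1) q.2.1) *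
        ENNReal.ofReal (α * E * |q.2.2|) +
      (Set.Ico (σ - a / e) (σ + a)).indicator 1 q.1 * (ENNReal.ofReal (θ * E) *
        ENNReal.ofReal (min 1 (kernelBound d q.2.1 * |q.2.2|))) := by
    intro q
    have hk := heatKernel_nonneg (σ + a - q.1) q.2.1
    have hkb := kernelBound_nonneg q.2.1
    have hi1 : 0 ≤ (Set.Ici (σ + a - 1)).indicator (1 : ℝ → ℝ) q.1 :=
      Set.indicator_nonneg (fun _ _ => zero_le_one) _
    have hi2 : 0 ≤ (Set.Ico (σ - a / e) (σ + a)).indicator (1 : ℝ → ℝ) q.1 :=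
      Set.indicator_nonneg (fun _ _ => zero_le_one) _
    have hmin : 0 ≤ min 1 (kernelBound d q.2.1 * |q.2.2|) := le_min zero_le_one (by positivity)
    refine (ENNReal.ofReal_le_ofReal
      (exp_windowBound_le (σ := σ) (a := a) he hF hδ hδ1 hθ hε hε1 q)).trans (le_of_eq ?_)
    rw [ENNReal.ofReal_add (by positivity) (by positivity),
      ENNReal.ofReal_add (by positivity) (by positivity),
      ENNReal.ofReal_add (by positivity) (by positivity),
      ENNReal.ofReal_mul hk, ENNReal.ofReal_mul hk,
      ENNReal.ofReal_mul (mul_nonneg hi1 hk), ENNReal.ofReal_mul hi1,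
      ENNReal.ofReal_mul (mul_nonneg hi2 (by positivity)), ENNReal.ofReal_mul hi2, hofInd, hofInd]
    simp [mul_assoc, hα, hE]
  refine (lintegral_mono hpt).trans ?_
  rw [lintegral_add_left (by fun_prop), lintegral_add_left (by fun_prop),
    lintegral_add_left (by fun_prop),
    lintegral_intensity_heatKernel (σ + a) MeasurableSet.univ
      (w := fun z => ENNReal.ofReal (α * |z|)) (by fun_prop),
    lintegral_intensity_heatKernel (σ + a) MeasurableSet.univ
      (w := fun z => ENNReal.ofReal (α ^ (1 + ε) * E * |z| ^ (1 + ε))) (by fun_prop),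
    lintegral_intensity_heatKernel (σ + a) measurableSet_Ici
      (w := fun z => ENNReal.ofReal (α * E * |z|)) (by fun_prop)]
  have hmean : ∀ c : ℝ, 0 ≤ c → ∫⁻ z, ENNReal.ofReal (c * |z|) ∂lam =
      ENNReal.ofReal (c * absMean lam) := by
    intro c hc
    simp_rw [ENNReal.ofReal_mul hc]
    rw [lintegral_const_mul' _ _ ENNReal.ofReal_ne_top, lintegral_abs hint]
  have hmeanε : ∫⁻ z, ENNReal.ofReal (α ^ (1 + ε) * E * |z| ^ (1 + ε)) ∂lam =
      ENNReal.ofReal (α ^ (1 + ε) * E * ∫ z, |z| ^ (1 + ε) ∂lam) := by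
    have hc : 0 ≤ α ^ (1 + ε) * E := by positivity
    simp_rw [ENNReal.ofReal_mul hc]
    rw [lintegral_const_mul' _ _ ENNReal.ofReal_ne_top,
      ofReal_integral_eq_lintegral_ofReal hmom (ae_of_all _ fun z => by positivity)]
  rw [hmean α hα0, hmean (α * E) (by positivity), hmeanε, Set.univ_inter, Real.volume_Ioo, sub_zero]
  set K := ∫⁻ y : Space d, ∫⁻ z, ENNReal.ofReal (min 1 (kernelBound d y * |z|)) ∂lam with hKdef
  have h4 : ∫⁻ q : JumpSpace d, (Set.Ico (σ - a / e) (σ + a)).indicator 1 q.1 *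
      (ENNReal.ofReal (θ * E) * ENNReal.ofReal (min 1 (kernelBound d q.2.1 * |q.2.2|)))
        ∂(intensity d lam) ≤ ENNReal.ofReal ((a + a / e) * (θ * E) * K.toReal) := by
    rw [lintegral_intensity (by fun_prop)]
    have hinner : ∀ s, ∫⁻ y : Space d, ∫⁻ z, (Set.Ico (σ - a / e) (σ + a)).indicator 1 s *
        (ENNReal.ofReal (θ * E) * ENNReal.ofReal (min 1 (kernelBound d y * |z|))) ∂lam =
        (Set.Ico (σ - a / e) (σ + a)).indicator 1 s * (ENNReal.ofReal (θ * E) * K) := by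
      intro s
      have hm : Measurable fun y : Space d =>
          ∫⁻ z, ENNReal.ofReal (min 1 (kernelBound d y * |z|)) ∂lam :=
        Measurable.lintegral_prod_right' (f := fun p : Space d × ℝ =>
          ENNReal.ofReal (min 1 (kernelBound d p.1 * |p.2|))) (by fun_prop)
      simp_rw [← mul_assoc]
      rw [hKdef, ← lintegral_const_mul _ hm]
      refine lintegral_congr fun y => ?_
      rw [lintegral_const_mul _ (by fun_prop)]
    simp_rw [hinner]
    rw [lintegral_mul_const _ hI2, lintegral_indicator_one measurableSet_Ico,
      mul_assoc, ENNReal.ofReal_mul (p := a + a / e) (by positivity),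
      ENNReal.ofReal_mul (p := θ * E) (by positivity), ENNReal.ofReal_toReal hK.ne]
    gcongr
    refine (Measure.restrict_apply_le _ _).trans ?_
    rw [Real.volume_Ico]
    exact ENNReal.ofReal_le_ofReal (by linarith)
  have h3 : volume (Set.Ici (σ + a - 1) ∩ Set.Ioo 0 (σ + a)) ≤ 1 := by
    calc volume (Set.Ici (σ + a - 1) ∩ Set.Ioo 0 (σ + a)) ≤ volume (Set.Icc (σ + a - 1) (σ + a)) :=
          measure_mono fun s hs => ⟨hs.1, hs.2.2.le⟩
      _ = 1 := by rw [Real.volume_Icc]; simp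
  have hT : 0 ≤ σ + a := by linarith
  have hKr : 0 ≤ K.toReal := ENNReal.toReal_nonneg
  have n1 : 0 ≤ α * absMean lam := by positivity
  have n2 : 0 ≤ α ^ (1 + ε) * E * ∫ z, |z| ^ (1 + ε) ∂lam := by positivity
  have n3 : 0 ≤ α * E * absMean lam := by positivity
  rw [ENNReal.ofReal_add (add_nonneg (add_nonneg (mul_nonneg hT n1) (mul_nonneg hT n2)) n3)
      (by positivity),
    ENNReal.ofReal_add (add_nonneg (mul_nonneg hT n1) (mul_nonneg hT n2)) n3,
    ENNReal.ofReal_add (mul_nonneg hT n1) (mul_nonneg hT n2),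
    ENNReal.ofReal_mul hT, ENNReal.ofReal_mul hT]
  refine add_le_add (add_le_add le_rfl ?_) h4
  calc volume (Set.Ici (σ + a - 1) ∩ Set.Ioo 0 (σ + a)) * ENNReal.ofReal (α * E * absMean lam) ≤
        1 * ENNReal.ofReal (α * E * absMean lam) := by gcongr
    _ = _ := one_mul _

end Window

/-! ### Convergent series: upper bound for the jump sums -/

section Upper

variable {d : ℕ} {lam : Measure ℝ}

/-- With `log F ≤ F ^ s / s` and `s = η / 2`, each of the three error terms is a constant times a
power of `F` with nonpositive exponent; `2η ≤ ε` and `2η ≤ p` are what this needs. -/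
lemma window_remainder_le {A η ε p e c R M₁ M₂ M₃ : ℝ} (hA : 0 ≤ A) (hη : 0 < η)
    (hε : 2 * η ≤ ε) (hε1 : ε ≤ 1) (hp : 2 * η ≤ p) (he : 0 < e) (hc : 0 ≤ c) (hR : 0 ≤ R)
    (hM₁ : 0 ≤ M₁) (hM₂ : 0 ≤ M₂) (hM₃ : 0 ≤ M₃) :
    ∃ C, 0 ≤ C ∧ ∀ F σ : ℝ, 1 ≤ F → 0 ≤ σ → σ ≤ R * F →
      (σ + F ^ (-p)) * ((A * Real.log F * c / F) ^ (1 + ε) * F ^ η * M₁) +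
        A * Real.log F * c / F * F ^ η * M₂ +
        (F ^ (-p) + F ^ (-p) / e) * (A * Real.log F * F ^ η) * M₃ ≤ C := by
  set s := η / 2 with hs
  have hs0 : 0 < s := by positivity
  refine ⟨(R + 1) * ((A * c / s) ^ (1 + ε) * M₁) + A * c / s * M₂ + (1 + 1 / e) * (A / s) * M₃,
    by positivity, fun F σ hF hσ hσR => ?_⟩
  have hF0 : 0 < F := by linarith
  have hlog : Real.log F ≤ F ^ s / s := Real.log_le_rpow_div hF0.le hs0
  have hlog0 : 0 ≤ Real.log F := Real.log_nonneg hF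
  have hone : ∀ x : ℝ, x ≤ 0 → F ^ x ≤ 1 := fun x hx => Real.rpow_le_one_of_one_le_of_nonpos hF hx
  have hFp : F ^ (-p) ≤ 1 := hone _ (by linarith)
  have hFp0 : 0 < F ^ (-p) := Real.rpow_pos_of_pos hF0 _
  have b1 : (σ + F ^ (-p)) * ((A * Real.log F * c / F) ^ (1 + ε) * F ^ η) ≤
      (R + 1) * (A * c / s) ^ (1 + ε) := by
    have hle : A * Real.log F * c / F ≤ (A * c / s) * F ^ (s - 1) := by
      rw [Real.rpow_sub_one hF0.ne']
      calc A * Real.log F * c / F ≤ A * (F ^ s / s) * c / F := by gcongr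
        _ = _ := by ring
    calc (σ + F ^ (-p)) * ((A * Real.log F * c / F) ^ (1 + ε) * F ^ η)
        ≤ (R * F + F) * (((A * c / s) * F ^ (s - 1)) ^ (1 + ε) * F ^ η) := by
          have : 0 ≤ 1 + ε := by linarith
          gcongr; linarith
      _ = (R + 1) * (A * c / s) ^ (1 + ε) * F ^ (1 + (s - 1) * (1 + ε) + η) := by
          rw [Real.mul_rpow (by positivity) (by positivity), ← Real.rpow_mul hF0.le,
            Real.rpow_add hF0, Real.rpow_add hF0, Real.rpow_one]
          ring
      _ ≤ (R + 1) * (A * c / s) ^ (1 + ε) * 1 := by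
          gcongr
          apply hone
          nlinarith
      _ = _ := mul_one _
  have b2 : A * Real.log F * c / F * F ^ η ≤ A * c / s := by
    calc A * Real.log F * c / F * F ^ η ≤ A * (F ^ s / s) * c / F * F ^ η := by gcongr
      _ = A * c / s * F ^ (s - 1 + η) := by
          rw [Real.rpow_add hF0, Real.rpow_sub_one hF0.ne']; ring
      _ ≤ A * c / s * 1 := by
          gcongr
          apply hone
          linarith
      _ = _ := mul_one _
  have b3 : (F ^ (-p) + F ^ (-p) / e) * (A * Real.log F * F ^ η) ≤ (1 + 1 / e) * (A / s) := by
    calc (F ^ (-p) + F ^ (-p) / e) * (A * Real.log F * F ^ η)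
        ≤ (F ^ (-p) + F ^ (-p) / e) * (A * (F ^ s / s) * F ^ η) := by gcongr
      _ = (1 + 1 / e) * (A / s) * F ^ (-p + s + η) := by
          rw [Real.rpow_add hF0, Real.rpow_add hF0]; ring
      _ ≤ (1 + 1 / e) * (A / s) * 1 := by
          gcongr
          apply hone
          linarith
      _ = _ := mul_one _
  calc _ = (σ + F ^ (-p)) * ((A * Real.log F * c / F) ^ (1 + ε) * F ^ η) * M₁ +
        A * Real.log F * c / F * F ^ η * M₂ +
        (F ^ (-p) + F ^ (-p) / e) * (A * Real.log F * F ^ η) * M₃ := by ring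
    _ ≤ (R + 1) * (A * c / s) ^ (1 + ε) * M₁ + A * c / s * M₂ + (1 + 1 / e) * (A / s) * M₃ := by
        gcongr
    _ = _ := by ring

/-- The Chebyshev parameter is `θ = A log F`. The cap `δ = η / A` keeps `exp (θδ) = F ^ η` small
enough for a bounded remainder, while `A ≥ (1 + p) / δ'` makes the gain `exp (-θδ')` at most `F ^
(-(1 + p))`. -/
lemma measure_windowBound_gt_le [SigmaFinite lam] (hint : Integrable (fun z : ℝ => z) lam)
    {ε : ℝ} (hε : 0 < ε) (hε1 : ε ≤ 1) (hmom : Integrable (fun z : ℝ => |z| ^ (1 + ε)) lam)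
    (hK : ∫⁻ y : Space d, ∫⁻ z, ENNReal.ofReal (min 1 (kernelBound d y * |z|)) ∂lam < ∞)
    {Ω : Type*} [MeasurableSpace Ω] {P : Measure Ω} [IsProbabilityMeasure P]
    {μ : Ω → Measure (JumpSpace d)}
    (hμ : IsPoissonRandomMeasure P (intensity d lam) μ) {e p R δ' : ℝ} (he : 0 < e) (hp : 0 < p)
    (hR : 0 ≤ R) (hδ' : 0 < δ') :
    ∃ δ C : ℝ, 0 < δ ∧ 0 ≤ C ∧ ∀ F σ : ℝ, 1 < F → 0 ≤ σ → σ ≤ R * F →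
      P {ω | ENNReal.ofReal ((σ + F ^ (-p)) * ((1 + e) ^ d / F * absMean lam) + δ') <
        ∫⁻ q, ENNReal.ofReal (min δ (windowBound e σ (F ^ (-p)) F q)) ∂(μ ω)} ≤
      ENNReal.ofReal (C * F ^ (-(1 + p))) := by
  set η := min ε p / 2 with hη
  have hη0 : 0 < η := by have := lt_min hε hp; positivity
  have hηε : 2 * η ≤ ε := by rw [hη]; linarith [min_le_left ε p]
  have hηp : 2 * η ≤ p := by rw [hη]; linarith [min_le_right ε p]
  set A := max ((1 + p) / δ') η with hA
  have hA0 : 0 < A := lt_of_lt_of_le hη0 (le_max_right _ _)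
  have hAδ' : 1 + p ≤ A * δ' := by
    rw [← div_le_iff₀ hδ']; exact le_max_left _ _
  set K := (∫⁻ y : Space d, ∫⁻ z, ENNReal.ofReal (min 1 (kernelBound d y * |z|)) ∂lam).toReal
  have hm0 := absMean_nonneg lam
  have hmε : 0 ≤ ∫ z, |z| ^ (1 + ε) ∂lam := integral_nonneg fun z => by positivity
  obtain ⟨C, hC0, hC⟩ := window_remainder_le hA0.le hη0 hηε hε1 hηp he
    (c := (1 + e) ^ d) (by positivity) hR hmε hm0 (ENNReal.toReal_nonneg : 0 ≤ K)
  have hδ : 0 < η / A := by positivity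
  have hδ1 : η / A ≤ 1 := (div_le_one hA0).2 (le_max_right _ _)
  refine ⟨η / A, Real.exp C, hδ, (Real.exp_pos _).le, fun F σ hF hσ hσR => ?_⟩
  have hF0 : 0 < F := by linarith
  set θ := A * Real.log F with hθ
  have hθ0 : 0 < θ := mul_pos hA0 (Real.log_pos hF)
  have hE : Real.exp (θ * (η / A)) = F ^ η := by
    rw [Real.rpow_def_of_pos hF0]; congr 1; rw [hθ]; field_simp
  set a := F ^ (-p) with ha
  have ha0 : 0 < a := Real.rpow_pos_of_pos hF0 _
  have hI := lintegral_exp_windowBound_le (d := d) hint hε.le hε1 hmom hK he ha0 hσ hF.le hδ hδ1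
    hθ0.le
  rw [hE] at hI
  set X := (σ + a) * (θ * (1 + e) ^ d / F * absMean lam) with hX
  set r := (σ + a) * ((θ * (1 + e) ^ d / F) ^ (1 + ε) * F ^ η * ∫ z, |z| ^ (1 + ε) ∂lam) +
    θ * (1 + e) ^ d / F * F ^ η * absMean lam + (a + a / e) * (θ * F ^ η) * K with hr
  have hXr : X + (σ + a) * ((θ * (1 + e) ^ d / F) ^ (1 + ε) * F ^ η * ∫ z, |z| ^ (1 + ε) ∂lam) +
    θ * (1 + e) ^ d / F * F ^ η * absMean lam + (a + a / e) * (θ * F ^ η) * K = X + r := by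
    rw [hr]; ring
  rw [hXr] at hI
  have hrC : r ≤ C := hC F σ hF.le hσ hσR
  have hX0 : 0 ≤ X := by positivity
  have hw : ∀ q : JumpSpace d, 0 ≤ θ * min (η / A) (windowBound e σ a F q) := fun q =>
    mul_nonneg hθ0.le (le_min hδ.le (windowBound_nonneg he hF0 q))
  have hev := hμ.measure_lintegral_gt_le
    (h := fun q => ENNReal.ofReal (θ * min (η / A) (windowBound e σ a F q)))
    (by have := measurable_windowBound (d := d) e σ a F; fun_prop) (fun q => ENNReal.ofReal_ne_top)
    (C := X + C) (by positivity)
    (by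
      simp_rw [ENNReal.toReal_ofReal (hw _)]
      exact hI.trans (ENNReal.ofReal_le_ofReal (by linarith))) (X + θ * δ')
  refine (measure_mono fun ω hω => ?_).trans (hev.trans (ENNReal.ofReal_le_ofReal ?_))
  · simp only [Set.mem_ofPred_eq, ENNReal.ofReal_mul hθ0.le] at hω ⊢
    rw [lintegral_const_mul' _ _ ENNReal.ofReal_ne_top]
    have : X + θ * δ' = θ * ((σ + a) * ((1 + e) ^ d / F * absMean lam) + δ') := by
      rw [hX]; ring
    rw [this, ENNReal.ofReal_mul hθ0.le]
    exact ENNReal.mul_lt_mul_right (by simpa using hθ0) ENNReal.ofReal_ne_top hω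
  · rw [Real.rpow_def_of_pos hF0, ← Real.exp_add]
    apply Real.exp_le_exp.2
    have hl := Real.log_pos hF
    have : (1 + p) * Real.log F ≤ A * δ' * Real.log F := by gcongr
    rw [hθ]
    nlinarith

lemma exists_pos_measure_abs_ge (hm : absMean lam ≠ 0) :
    ∃ z₀ : ℝ, 0 < z₀ ∧ z₀ ≤ 1 ∧ lam {z | z₀ ≤ |z|} ≠ 0 := by
  by_contra! hcon
  apply hm
  have hall : ∀ᵐ z ∂lam, ∀ k : ℕ, ¬ (1 / ((k : ℝ) + 1) ≤ |z|) := by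
    rw [ae_all_iff]
    intro k
    have := hcon (1 / ((k : ℝ) + 1)) (by positivity) (by
      rw [div_le_one (by positivity)]; linarith [(Nat.cast_nonneg k : (0 : ℝ) ≤ k)])
    rw [ae_iff]
    simpa using this
  have hz : (fun z : ℝ => |z|) =ᵐ[lam] 0 := by
    filter_upwards [hall] with z hz
    by_contra hne
    have hpos : 0 < |z| := lt_of_le_of_ne (abs_nonneg z) (Ne.symm hne)
    obtain ⟨k, hk⟩ := exists_nat_one_div_lt hpos
    exact hz k hk.le
  rw [absMean, integral_congr_ae hz]
  simp

/-- Jumps of size at least some `z₀` already bound the series below by a multiple of `∑ min (F ^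
(-p)) Δt / F`, with `p = 2 / d`. The greedy comparison turns this into a sum over windows of length
`F ^ (-p)`, whose terms are the failure probabilities to be summed. -/
lemma tsum_greedy_rpow_lt_top {t F : ℕ → ℝ} (h : IsAdmissible t F) (hm : absMean lam ≠ 0)
    (hd : 1 ≤ d) (hser : levySeries d lam F t < ∞) {N : ℕ} (hN : 1 ≤ N) {n : ℕ → ℕ}
    (hn : IsGreedy t (fun k => F k ^ (-(2 / (d : ℝ)))) N n) :
    ∑' j, ENNReal.ofReal (F (n j) ^ (-(1 + 2 / (d : ℝ)))) < ∞ := by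
  obtain ⟨z₀, hz0, hz1, hzm⟩ := exists_pos_measure_abs_ge hm
  have hd0 : (0 : ℝ) < d := by exact_mod_cast hd
  set p := 2 / (d : ℝ) with hp
  have hp0 : 0 < p := by positivity
  have hpos : ∀ k, N ≤ k → 0 < F k := fun k hk => h.weight_pos k (hN.trans hk)
  have ha : ∀ k, N ≤ k → 0 < F k ^ (-p) := fun k hk => Real.rpow_pos_of_pos (hpos k hk) _
  have haa : ∀ k l, N ≤ k → k ≤ l → F l ^ (-p) ≤ F k ^ (-p) := fun k l hk hkl =>
    Real.rpow_le_rpow_of_nonpos (hpos k hk) (h.weight_mono k l (hN.trans hk) hkl) (by linarith)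
  have hwa : ∀ k l, N ≤ k → k ≤ l → (F l)⁻¹ ≤ (F k)⁻¹ := fun k l hk hkl =>
    inv_anti₀ (hpos k hk) (h.weight_mono k l (hN.trans hk) hkl)
  have hw : ∀ k, N ≤ k → 0 ≤ (F k)⁻¹ := fun k hk => (inv_pos.2 (hpos k hk)).le
  have hprod : ∀ k, N ≤ k → F k ^ (-p) * (F k)⁻¹ = F k ^ (-(1 + p)) := fun k hk => by
    rw [← Real.rpow_neg_one (F k), ← Real.rpow_add (hpos k hk)]; congr 1; ring
  set b : ℝ≥0∞ := lam {z | z₀ ≤ |z|} * ENNReal.ofReal (z₀ ^ (1 + p)) with hb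
  have hb0 : b ≠ 0 := mul_ne_zero hzm (by simpa using Real.rpow_pos_of_pos hz0 _)
  have hterm : ∀ k, N ≤ k → b * ENNReal.ofReal
      (min (F (k + 1) ^ (-p)) (t (k + 1) - t k) * (F (k + 1))⁻¹) ≤
      ∫⁻ z, ENNReal.ofReal (min ((|z| / F (k + 1)) ^ p) (t (k + 1) - t k) *
        (|z| / F (k + 1))) ∂lam := by
    intro k hk
    have hFk := hpos (k + 1) (by omega)
    have hΔ : 0 ≤ t (k + 1) - t k := sub_nonneg.2 (h.mono (Nat.le_succ k))
    have hms : MeasurableSet {z : ℝ | z₀ ≤ |z|} := measurableSet_le measurable_const (by fun_prop)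
    refine le_trans ?_ (setLIntegral_le_lintegral {z : ℝ | z₀ ≤ |z|} _)
    refine le_trans (le_of_eq ?_) (setLIntegral_mono' (f := fun _ => ENNReal.ofReal
      (z₀ ^ (1 + p) * (min (F (k + 1) ^ (-p)) (t (k + 1) - t k) * (F (k + 1))⁻¹))) hms ?_)
    · rw [setLIntegral_const, ENNReal.ofReal_mul (p := z₀ ^ (1 + p)) (by positivity), hb,
        mul_right_comm, mul_comm]
      simp only [mul_comm, mul_assoc]
    · intro z hz
      apply ENNReal.ofReal_le_ofReal
      have hzz : z₀ ≤ |z| := hz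
      have hzp : z₀ ^ p ≤ 1 := Real.rpow_le_one hz0.le hz1 hp0.le
      have hzp0 : 0 ≤ z₀ ^ p := by positivity
      have h1 : z₀ ^ p * min (F (k + 1) ^ (-p)) (t (k + 1) - t k) ≤
          min ((|z| / F (k + 1)) ^ p) (t (k + 1) - t k) := by
        refine le_min ?_ ?_
        · calc z₀ ^ p * min (F (k + 1) ^ (-p)) (t (k + 1) - t k) ≤ z₀ ^ p * F (k + 1) ^ (-p) := by
                gcongr; exact min_le_left _ _
            _ = (z₀ / F (k + 1)) ^ p := by
                rw [Real.div_rpow hz0.le hFk.le, Real.rpow_neg hFk.le]; rfl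
            _ ≤ _ := by gcongr
        · calc z₀ ^ p * min (F (k + 1) ^ (-p)) (t (k + 1) - t k) ≤ 1 * (t (k + 1) - t k) := by
                gcongr; exact min_le_right _ _
            _ = _ := one_mul _
      have hmin0 : 0 ≤ min (F (k + 1) ^ (-p)) (t (k + 1) - t k) := le_min (by positivity) hΔ
      calc z₀ ^ (1 + p) * (min (F (k + 1) ^ (-p)) (t (k + 1) - t k) * (F (k + 1))⁻¹)
          = (z₀ ^ p * min (F (k + 1) ^ (-p)) (t (k + 1) - t k)) * (z₀ / F (k + 1)) := by
            rw [Real.rpow_add hz0, Real.rpow_one]; ring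
        _ ≤ _ := by gcongr
  have hbound : ∀ J, b * ∑ j ∈ Finset.range J, ENNReal.ofReal (F (n (j + 1)) ^ (-(1 + p))) ≤
      levySeries d lam F t := by
    intro J
    have hle := hn.le_apply h.mono ha
    have hnn : ∀ k ∈ Finset.Ico N (n J),
        0 ≤ min (F (k + 1) ^ (-p)) (t (k + 1) - t k) * (F (k + 1))⁻¹ := fun k hk => by
      have hk' := (Finset.mem_Ico.1 hk).1
      have := ha (k + 1) (by omega)
      have := hw (k + 1) (by omega)
      exact mul_nonneg (le_min (by positivity) (sub_nonneg.2 (h.mono (Nat.le_succ k)))) this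
    calc b * ∑ j ∈ Finset.range J, ENNReal.ofReal (F (n (j + 1)) ^ (-(1 + p)))
        = b * ENNReal.ofReal (∑ j ∈ Finset.range J,
            F (n (j + 1)) ^ (-p) * (F (n (j + 1)))⁻¹) := by
          rw [← ENNReal.ofReal_sum_of_nonneg fun j _ =>
            (Real.rpow_pos_of_pos (hpos _ (hle (j + 1))) _).le]
          congr 2
          exact Finset.sum_congr rfl fun j _ => (hprod _ (hle _)).symm
      _ ≤ b * ENNReal.ofReal (∑ k ∈ Finset.Ico N (n J),
            min (F (k + 1) ^ (-p)) (t (k + 1) - t k) * (F (k + 1))⁻¹) := by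
          gcongr
          exact hn.sum_le_sum (w := fun k => (F k)⁻¹) h.mono ha haa hw hwa J
      _ = ∑ k ∈ Finset.Ico N (n J), b * ENNReal.ofReal
            (min (F (k + 1) ^ (-p)) (t (k + 1) - t k) * (F (k + 1))⁻¹) := by
          rw [ENNReal.ofReal_sum_of_nonneg hnn, Finset.mul_sum]
      _ ≤ ∑ k ∈ Finset.Ico N (n J), ∫⁻ z, ENNReal.ofReal (min ((|z| / F (k + 1)) ^ p)
            (t (k + 1) - t k) * (|z| / F (k + 1))) ∂lam :=
          Finset.sum_le_sum fun k hk => hterm k (Finset.mem_Ico.1 hk).1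
      _ ≤ levySeries d lam F t := ENNReal.sum_le_tsum _
  have hsum : b * ∑' j, ENNReal.ofReal (F (n (j + 1)) ^ (-(1 + p))) < ∞ := by
    refine lt_of_le_of_lt ?_ hser
    rw [ENNReal.tsum_eq_iSup_nat, ENNReal.mul_iSup]
    exact iSup_le hbound
  -- The greedy comparison starts at the index `n 1`; the first term is finite by itself.
  rw [tsum_eq_zero_add' ENNReal.summable]
  exact ENNReal.add_lt_top.2 ⟨ENNReal.ofReal_lt_top,
    ENNReal.lt_top_of_mul_ne_top_right hsum.ne hb0⟩

end Upper

/-! ### Almost sure upper bounds along the sequence. -/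

section Upper

variable {d : ℕ} {lam : Measure ℝ} {Ω : Type*} [MeasurableSpace Ω] {P : Measure Ω}
  {μ : Ω → Measure (JumpSpace d)}

/-- Off the union of `bigJumps`, contributions at time `t k` are below `δ * F k`, which justifies
the cap in the window bound. -/
lemma jumpSum_le_of_window {t F : ℕ → ℝ} {N : Measure (JumpSpace d)}
    (hN : ∀ᵐ q ∂N, q.2.1 ≠ 0) {e σ a G δ : ℝ} {k : ℕ} (hk : 1 ≤ k) (he : 0 < e) (ha : 0 < a)
    (hG : 1 ≤ G) (hae : a + a / e ≤ 1) (h1 : σ ≤ t k) (h2 : t k ≤ σ + a) (hGk : G ≤ F k) :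
    jumpSum N (t k) ≤
      (∫⁻ q in ⋃ k ∈ Set.Ici 1, bigJumps d F t δ k,
        ENNReal.ofReal (heatKernel (t k - q.1) q.2.1 * |q.2.2|) ∂N) +
      ENNReal.ofReal (F k) * ∫⁻ q, ENNReal.ofReal (min δ (windowBound e σ a G q)) ∂N := by
  have hB : MeasurableSet (⋃ k ∈ Set.Ici 1, bigJumps d F t δ k) :=
    MeasurableSet.biUnion (Set.to_countable _) fun k _ => measurableSet_bigJumps F t δ k
  rw [jumpSum, ← lintegral_add_compl _ hB, ← lintegral_const_mul' _ _ ENNReal.ofReal_ne_top]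
  refine add_le_add le_rfl ?_
  refine le_trans ?_ (setLIntegral_le_lintegral (⋃ k ∈ Set.Ici 1, bigJumps d F t δ k)ᶜ _)
  refine lintegral_mono_ae ?_
  filter_upwards [ae_restrict_of_ae hN, ae_restrict_mem hB.compl] with q hq hqB
  refine contribution_le_windowBound he ha hG hae h1 h2 hGk hq ?_
  by_contra hlt
  exact hqB (Set.mem_biUnion (show k ∈ Set.Ici 1 from hk) (not_le.1 hlt).le)

/-- Borel–Cantelli over the greedy windows, with failure probabilities summable by
`tsum_greedy_rpow_lt_top`, handles the capped contributions; the uncapped ones stay bounded by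
`ae_exists_setLIntegral_le`. -/
lemma ae_eventually_jumpSum_le_mul [SigmaFinite lam] [IsProbabilityMeasure P] (hd : 1 ≤ d)
    (hint : Integrable (fun z : ℝ => z) lam) {ε : ℝ} (hε : 0 < ε) (hε1 : ε ≤ 1)
    (hmom : Integrable (fun z : ℝ => |z| ^ (1 + ε)) lam)
    (hlog : IntegrableOn (fun z : ℝ => |z * Real.log z|) (Set.Icc (-1) 1) lam)
    {t F : ℕ → ℝ} (h : IsAdmissible t F) (hF : Tendsto F atTop atTop) {κ : ℝ} (hκ0 : 0 ≤ κ)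
    (hκ : Tendsto (fun n => t n / F n) atTop (𝓝 κ)) (hser : levySeries d lam F t < ∞)
    (hμ : IsPoissonRandomMeasure P (intensity d lam) μ) (hm : absMean lam ≠ 0)
    {c : ℝ} (hc : κ * absMean lam < c) :
    ∀ᵐ ω ∂P, ∀ᶠ n in atTop, jumpSum (μ ω) (t n) ≤ ENNReal.ofReal (c * F n) := by
  have hm0 := absMean_nonneg lam
  have hc0 : 0 < c := lt_of_le_of_lt (by positivity) hc
  obtain ⟨e, he, he1, hec⟩ := exists_small_param hc d
  have hec' : (1 + e) ^ d * (κ * absMean lam) < c := by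
    refine hec.trans_le ?_
    have : (1 - e) ^ 2 ≤ 1 := by nlinarith
    nlinarith
  set c₀ := (1 + e) ^ d * (κ * absMean lam) with hc₀
  -- One third each for the convergence of the means, the fluctuation in a window, and the large
  -- jumps.
  set δ' := (c - c₀) / 3 with hδ'def
  have hδ' : 0 < δ' := by rw [hδ'def]; linarith
  have hd0 : (0 : ℝ) < d := by exact_mod_cast hd
  set p := 2 / (d : ℝ) with hp
  have hp0 : 0 < p := by positivity
  obtain ⟨δ, C, hδ, hC0, hprob⟩ := measure_windowBound_gt_le hint hε hε1 hmom
    (lintegral_min_kernelBound_lt_top hd hint hlog) hμ he hp0 (R := κ + 1) (by linarith) hδ'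
  have hFp : Tendsto (fun n => F n ^ (-p)) atTop (𝓝 0) :=
    (tendsto_rpow_neg_atTop hp0).comp hF
  have hX : Tendsto (fun n => (t n + F n ^ (-p)) * ((1 + e) ^ d / F n * absMean lam)) atTop
      (𝓝 c₀) := by
    have h1 : Tendsto (fun n => (1 + e) ^ d * ((t n / F n + F n ^ (-p) * (F n)⁻¹) * absMean lam))
        atTop (𝓝 ((1 + e) ^ d * ((κ + 0 * 0) * absMean lam))) :=
      ((hκ.add (hFp.mul (tendsto_inv_atTop_zero.comp hF))).mul_const _).const_mul _
    rw [mul_zero, add_zero] at h1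
    refine h1.congr fun n => ?_
    ring
  have hev : ∀ᶠ n in atTop, 1 ≤ n ∧ 1 < F n ∧ F n ^ (-p) + F n ^ (-p) / e ≤ 1 ∧
      (t n + F n ^ (-p)) * ((1 + e) ^ d / F n * absMean lam) ≤ c₀ + δ' ∧
      t n ≤ (κ + 1) * F n := by
    have h3 : Tendsto (fun n => F n ^ (-p) + F n ^ (-p) / e) atTop (𝓝 (0 + 0 / e)) :=
      hFp.add (hFp.div_const e)
    filter_upwards [eventually_ge_atTop 1, hF.eventually_gt_atTop 1,
      h3.eventually_le_const (show (0 + 0 / e : ℝ) < 1 by simp),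
      hX.eventually_le_const (show c₀ < c₀ + δ' by linarith),
      hκ.eventually_le_const (show κ < κ + 1 by linarith)] with n h1 h2 h3 h4 h5
    exact ⟨h1, h2, h3, h4, (div_le_iff₀ (by linarith)).1 h5⟩
  obtain ⟨N, hN⟩ := eventually_atTop.1 hev
  have hN1 : 1 ≤ N := (hN N le_rfl).1
  obtain ⟨n, hn⟩ := exists_isGreedy (a := fun k => F k ^ (-p)) h.tendsto N
  have ha : ∀ k, N ≤ k → 0 < F k ^ (-p) := fun k hk =>
    Real.rpow_pos_of_pos (by linarith [(hN k hk).2.1]) _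
  have hle := hn.le_apply h.mono ha
  have hsum := tsum_greedy_rpow_lt_top h hm hd hser hN1 hn
  have hBC : ∀ᵐ ω ∂P, ∀ᶠ j in atTop, ¬ ENNReal.ofReal ((t (n j) + F (n j) ^ (-p)) *
      ((1 + e) ^ d / F (n j) * absMean lam) + δ') <
      ∫⁻ q, ENNReal.ofReal (min δ (windowBound e (t (n j)) (F (n j) ^ (-p)) (F (n j)) q))
        ∂(μ ω) := by
    refine ae_eventually_notMem (s := fun j => {ω | ENNReal.ofReal ((t (n j) + F (n j) ^ (-p)) *
      ((1 + e) ^ d / F (n j) * absMean lam) + δ') <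
      ∫⁻ q, ENNReal.ofReal (min δ (windowBound e (t (n j)) (F (n j) ^ (-p)) (F (n j)) q))
        ∂(μ ω)}) (ne_of_lt ?_)
    calc _ ≤ ∑' j, ENNReal.ofReal (C * F (n j) ^ (-(1 + p))) := by
          refine ENNReal.tsum_le_tsum fun j => ?_
          obtain ⟨g1, g2, -, -, g5⟩ := hN _ (hle j)
          exact hprob _ _ g2 (h.pos _ g1).le g5
      _ = ENNReal.ofReal C * ∑' j, ENNReal.ofReal (F (n j) ^ (-(1 + p))) := by
          simp_rw [ENNReal.ofReal_mul hC0]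
          rw [ENNReal.tsum_mul_left]
      _ < ∞ := ENNReal.mul_lt_top ENNReal.ofReal_lt_top hsum
  have hB : MeasurableSet (⋃ k ∈ Set.Ici 1, bigJumps d F t δ k) :=
    MeasurableSet.biUnion (Set.to_countable _) fun k _ => measurableSet_bigJumps F t δ k
  -- Almost surely no jump sits at the origin, where `kernelBound` is not a bound.
  have hy : ∀ᵐ q ∂(intensity d lam), q.2.1 ≠ 0 := by
    have : Nonempty (Fin d) := ⟨⟨0, hd⟩⟩
    have hs : MeasurableSet {q : JumpSpace d | q.2.1 = 0} :=
      (measurableSet_singleton (0 : Space d)).preimage (by fun_prop)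
    rw [ae_iff]
    simp only [not_not]
    rw [← lintegral_indicator_one hs, lintegral_intensity (measurable_one.indicator hs)]
    have h0 : ∀ s : ℝ, ∫⁻ y : Space d, ∫⁻ z,
        ({q : JumpSpace d | q.2.1 = 0}.indicator 1 (s, y, z) : ℝ≥0∞) ∂lam = 0 := by
      intro s
      have hae : ∀ᵐ y : Space d, y ≠ 0 := by
        rw [ae_iff]; simp
      rw [lintegral_congr_ae (g := fun _ => 0), lintegral_zero]
      filter_upwards [hae] with y hy0
      simp [Set.indicator, hy0]
    simp [h0]
  filter_upwards [hBC, hμ.ae_ae hy, ae_exists_setLIntegral_le hμ hB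
    (intensity_iUnion_bigJumps_lt_top hd h hδ hser)] with ω hω hωy ⟨M, hM⟩
  obtain ⟨J, hJ⟩ := eventually_atTop.1 hω
  filter_upwards [eventually_ge_atTop (n J), h.tendsto.eventually hM,
    hF.eventually_ge_atTop (M / δ')] with k hkJ hkM hkF
  have hNk : N ≤ k := (hle J).trans hkJ
  -- Every late index lies in the window opened by a greedy index, where the weight is no larger.
  obtain ⟨j, hj1, hj2⟩ := hn.exists_mem_block h.mono ha hNk
  have hJj : J ≤ j := by
    have := (hn.strictMono h.mono ha).lt_iff_lt.1 (hkJ.trans_lt hj2)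
    omega
  obtain ⟨g1, g2, g3, g4, g5⟩ := hN _ (hle j)
  have hFk := (hN k hNk).2.1
  refine (jumpSum_le_of_window (δ := δ) hωy (hN k hNk).1 he (ha _ (hle j)) g2.le g3 (h.mono hj1)
    (hn.le_of_lt j k hj2) (h.weight_mono _ _ g1 hj1)).trans ?_
  have hMF : (M : ℝ≥0∞) ≤ ENNReal.ofReal (δ' * F k) := by
    rw [← ENNReal.ofReal_coe_nnreal]
    apply ENNReal.ofReal_le_ofReal
    rw [div_le_iff₀ hδ'] at hkF
    linarith
  calc _ ≤ ENNReal.ofReal (δ' * F k) + ENNReal.ofReal (F k) * ENNReal.ofReal (c₀ + δ' + δ') := by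
        refine add_le_add (hkM.trans hMF) ?_
        gcongr
        exact (not_lt.1 (hJ j hJj)).trans (ENNReal.ofReal_le_ofReal (by linarith))
    _ = ENNReal.ofReal (c * F k) := by
        have : 0 ≤ c₀ := by positivity
        rw [← ENNReal.ofReal_mul (by linarith), ← ENNReal.ofReal_add (by positivity) (by positivity)]
        congr 1
        rw [hδ'def]
        ring

lemma integrable_rpow_min (hint : Integrable (fun z : ℝ => z) lam) {ε : ℝ} (hε : 0 < ε)
    (hmom : Integrable (fun z : ℝ => |z| ^ (1 + ε)) lam) :
    Integrable (fun z : ℝ => |z| ^ (1 + min ε 1)) lam := by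
  refine (hint.abs.add hmom).mono'
    (measurable_norm.pow_const _).aestronglyMeasurable (ae_of_all _ fun z => ?_)
  have hmin : 0 < min ε 1 := lt_min hε one_pos
  rw [Real.norm_of_nonneg (by positivity)]
  simp only [Pi.add_apply]
  have h2 : 0 ≤ |z| ^ (1 + ε) := by positivity
  rcases le_total |z| 1 with hz | hz
  · have h1 : |z| ^ (1 + min ε 1) ≤ |z| ^ (1 : ℝ) := by
      rcases (abs_nonneg z).eq_or_lt with h0 | h0
      · rw [← h0, Real.zero_rpow (by linarith), Real.zero_rpow one_ne_zero]
      · exact Real.rpow_le_rpow_of_exponent_ge h0 hz (by linarith)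
    rw [Real.rpow_one] at h1
    linarith
  · have h1 : |z| ^ (1 + min ε 1) ≤ |z| ^ (1 + ε) :=
      Real.rpow_le_rpow_of_exponent_le hz (by linarith [min_le_left ε 1])
    linarith [abs_nonneg z]

/-- If the series converges, the jump sums along `t` eventually stay below `c * F` for every
`c` larger than the limiting ratio of mean and weight. -/
theorem ae_eventually_jumpSum_le [SigmaFinite lam] [IsProbabilityMeasure P] (hd : 1 ≤ d)
    (hint : Integrable (fun z : ℝ => z) lam) {ε : ℝ} (hε : 0 < ε)
    (hmom : Integrable (fun z : ℝ => |z| ^ (1 + ε)) lam)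
    (hlog : IntegrableOn (fun z : ℝ => |z * Real.log z|) (Set.Icc (-1) 1) lam)
    {t F : ℕ → ℝ} (h : IsAdmissible t F) (hF : Tendsto F atTop atTop) {κ : ℝ} (hκ0 : 0 ≤ κ)
    (hκ : Tendsto (fun n => t n / F n) atTop (𝓝 κ)) (hser : levySeries d lam F t < ∞)
    (hμ : IsPoissonRandomMeasure P (intensity d lam) μ) :
    ∀ᵐ ω ∂P, ∀ c, κ * absMean lam < c →
      ∀ᶠ n in atTop, jumpSum (μ ω) (t n) ≤ ENNReal.ofReal (c * F n) := by
  by_cases hm : absMean lam = 0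
  · have h0 : ∀ᵐ ω ∂P, ∀ n, jumpSum (μ ω) (t n) = 0 := by
      rw [ae_all_iff]
      intro n
      refine (lintegral_eq_zero_iff (measurable_jumpSum hμ (t n))).1 ?_
      rw [lintegral_jumpSum hint hμ, hm, mul_zero, ENNReal.ofReal_zero]
    filter_upwards [h0] with ω hω c _
    exact Eventually.of_forall fun n => by rw [hω n]; exact zero_le
  have hrat : ∀ᵐ ω ∂P, ∀ r : ℚ, κ * absMean lam < r →
      ∀ᶠ n in atTop, jumpSum (μ ω) (t n) ≤ ENNReal.ofReal (r * F n) := by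
    rw [ae_all_iff]
    intro r
    by_cases hr : κ * absMean lam < r
    · filter_upwards [ae_eventually_jumpSum_le_mul hd hint (lt_min hε one_pos) (min_le_right _ _)
        (integrable_rpow_min hint hε hmom) hlog h hF hκ0 hκ hser hμ hm hr] with ω hω _ using hω
    · exact ae_of_all _ fun ω hlt => absurd hlt hr
  filter_upwards [hrat] with ω hω c hc
  obtain ⟨r, hr1, hr2⟩ := exists_rat_btwn hc
  filter_upwards [hω r hr1, hF.eventually_ge_atTop 0] with n hn hFn
  exact hn.trans (ENNReal.ofReal_le_ofReal (by gcongr))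

end Upper

/-! ### Decomposition of the mild solution -/

section Decomposition

variable {d : ℕ} {lam : Measure ℝ}

lemma setIntegral_heatKernel {t : ℝ} (ht : 0 ≤ t) :
    ∫ p in (Set.Ioi (0 : ℝ)) ×ˢ (Set.univ : Set (Space d)), heatKernel (t - p.1) (0 - p.2) = t := by
  simp_rw [heatKernel_zero_sub]
  rw [integral_eq_lintegral_of_nonneg_ae (ae_of_all _ fun p => heatKernel_nonneg _ _)
    (Measurable.aestronglyMeasurable (by fun_prop)), Measure.volume_eq_prod,
    ← Measure.prod_restrict, Measure.restrict_univ, lintegral_prod _ (by fun_prop)]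
  have h1 : ∀ s : ℝ, ∫⁻ y : Space d, ENNReal.ofReal (heatKernel (t - s) y) =
      (Set.Iio t).indicator 1 s := by
    intro s
    by_cases hs : s < t
    · rw [lintegral_heatKernel (by linarith), Set.indicator_of_mem (Set.mem_Iio.2 hs)]; rfl
    · rw [Set.indicator_of_notMem (by simpa using hs)]
      simp [heatKernel_of_nonpos (show t - s ≤ 0 by linarith)]
  simp_rw [h1]
  rw [lintegral_indicator_one measurableSet_Iio, Measure.restrict_apply measurableSet_Iio,
    Set.inter_comm, Set.Ioi_inter_Iio, Real.volume_Ioo, sub_zero, ENNReal.toReal_ofReal ht]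

/-- The jumps with sizes in `S`. -/
noncomputable def restrictJumps (N : Measure (JumpSpace d)) (S : Set ℝ) : Measure (JumpSpace d) :=
  N.restrict {q | q.2.2 ∈ S}

lemma measurableSet_jumps {S : Set ℝ} (hS : MeasurableSet S) :
    MeasurableSet {q : JumpSpace d | q.2.2 ∈ S} :=
  hS.preimage (measurable_snd.comp measurable_snd)

lemma IsPoissonRandomMeasure.restrictJumps [SigmaFinite lam] {Ω : Type*} [MeasurableSpace Ω]
    {P : Measure Ω} {μ : Ω → Measure (JumpSpace d)}
    (hμ : IsPoissonRandomMeasure P (intensity d lam) μ) {S : Set ℝ} (hS : MeasurableSet S) :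
    IsPoissonRandomMeasure P (intensity d (lam.restrict S))
      fun ω => LevySHE.restrictJumps (μ ω) S := by
  rw [intensity_restrict]
  exact hμ.restrict (measurableSet_jumps hS)

lemma jumpSum_restrictJumps (N : Measure (JumpSpace d)) {S : Set ℝ} (hS : MeasurableSet S)
    (t : ℝ) : jumpSum (restrictJumps N S) t = ∫⁻ q, {q : JumpSpace d | q.2.2 ∈ S}.indicator
      (fun q => ENNReal.ofReal (heatKernel (t - q.1) q.2.1 * |q.2.2|)) q ∂N := by
  rw [lintegral_indicator (measurableSet_jumps hS)]; rfl

/-- Finiteness of both sums makes the integrand integrable, so the Bochner integral is not its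
default value and splits into positive and negative parts. -/
lemma mildSolution_zero {m : ℝ} {N : Measure (JumpSpace d)} {t : ℝ} (ht : 0 ≤ t)
    (hpos : jumpSum (restrictJumps N (Set.Ioi 0)) t < ∞)
    (hneg : jumpSum (restrictJumps N (Set.Iio 0)) t < ∞) :
    mildSolution m lam N t 0 = drift m lam * t + (jumpSum (restrictJumps N (Set.Ioi 0)) t).toReal -
      (jumpSum (restrictJumps N (Set.Iio 0)) t).toReal := by
  rw [mildSolution, noiseIntegral, setIntegral_heatKernel ht, add_sub_assoc]
  congr 1
  simp_rw [heatKernel_zero_sub]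
  rw [jumpSum_restrictJumps N measurableSet_Ioi] at hpos ⊢
  rw [jumpSum_restrictJumps N measurableSet_Iio] at hneg ⊢
  have hp : ∀ q : JumpSpace d, {q : JumpSpace d | q.2.2 ∈ Set.Ioi 0}.indicator
      (fun q => ENNReal.ofReal (heatKernel (t - q.1) q.2.1 * |q.2.2|)) q =
      ENNReal.ofReal (heatKernel (t - q.1) q.2.1 * q.2.2) := by
    intro q
    have hk := heatKernel_nonneg (t - q.1) q.2.1
    rcases lt_or_ge 0 q.2.2 with hz | hz
    · rw [Set.indicator_of_mem (show q ∈ {q : JumpSpace d | q.2.2 ∈ Set.Ioi 0} from hz),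
        abs_of_pos hz]
    · rw [Set.indicator_of_notMem (show q ∉ {q : JumpSpace d | q.2.2 ∈ Set.Ioi 0} from
        not_lt.2 hz), ENNReal.ofReal_of_nonpos (mul_nonpos_of_nonneg_of_nonpos hk hz)]
  have hn : ∀ q : JumpSpace d, {q : JumpSpace d | q.2.2 ∈ Set.Iio 0}.indicator
      (fun q => ENNReal.ofReal (heatKernel (t - q.1) q.2.1 * |q.2.2|)) q =
      ENNReal.ofReal (-(heatKernel (t - q.1) q.2.1 * q.2.2)) := by
    intro q
    have hk := heatKernel_nonneg (t - q.1) q.2.1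
    rcases lt_or_ge q.2.2 0 with hz | hz
    · rw [Set.indicator_of_mem (show q ∈ {q : JumpSpace d | q.2.2 ∈ Set.Iio 0} from hz),
        abs_of_neg hz, mul_neg]
    · rw [Set.indicator_of_notMem (show q ∉ {q : JumpSpace d | q.2.2 ∈ Set.Iio 0} from
        not_lt.2 hz), ENNReal.ofReal_of_nonpos (neg_nonpos.2 (mul_nonneg hk hz))]
  simp_rw [hp] at hpos ⊢
  simp_rw [hn] at hneg ⊢
  have hm : Measurable fun q : JumpSpace d => heatKernel (t - q.1) q.2.1 * q.2.2 := by fun_prop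
  refine integral_eq_lintegral_pos_part_sub_lintegral_neg_part ⟨hm.aestronglyMeasurable, ?_⟩
  rw [hasFiniteIntegral_iff_norm]
  calc ∫⁻ q, ENNReal.ofReal ‖heatKernel (t - q.1) q.2.1 * q.2.2‖ ∂N
      ≤ ∫⁻ q, (ENNReal.ofReal (heatKernel (t - q.1) q.2.1 * q.2.2) +
        ENNReal.ofReal (-(heatKernel (t - q.1) q.2.1 * q.2.2))) ∂N := by
        refine lintegral_mono fun q => ?_
        rw [Real.norm_eq_abs]
        rcases abs_cases (heatKernel (t - q.1) q.2.1 * q.2.2) with ⟨h, -⟩ | ⟨h, -⟩ <;> rw [h]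
        · exact le_self_add
        · exact le_add_self
    _ < ∞ := by
        rw [lintegral_add_left (by fun_prop)]
        exact ENNReal.add_lt_top.2 ⟨hpos, hneg⟩

lemma drift_eq (m : ℝ) (hint : Integrable (fun z : ℝ => z) lam) :
    drift m lam =
      m - absMean (lam.restrict (Set.Ioi 0)) + absMean (lam.restrict (Set.Iio 0)) := by
  have h1 : ∫ z in Set.Ioi (0 : ℝ), z ∂lam = absMean (lam.restrict (Set.Ioi 0)) :=
    setIntegral_congr_fun measurableSet_Ioi fun z hz => (abs_of_pos hz).symm
  have h2 : ∫ z in Set.Iic (0 : ℝ), z ∂lam = -absMean (lam.restrict (Set.Iio 0)) := by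
    have h3 : ∫ z in Set.Iio (0 : ℝ), z ∂lam = ∫ z in Set.Iic (0 : ℝ), z ∂lam := by
      refine setIntegral_eq_of_subset_of_forall_sdiff_eq_zero measurableSet_Iic Set.Iio_subset_Iic_self
        (fun z hz => ?_) |>.symm
      exact le_antisymm hz.1 (not_lt.1 hz.2)
    rw [← h3, absMean, ← integral_neg]
    exact setIntegral_congr_fun measurableSet_Iio fun z hz => by
      simp [abs_of_neg (Set.mem_Iio.1 hz)]
  rw [drift, ← integral_add_compl measurableSet_Ioi hint, Set.compl_Ioi, h1, h2]
  ring

end Decomposition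

/-! ### Divergent series: combining both signs of the jumps -/

section Divergent

lemma measurableSet_eventually_imp {k c : ℕ → ℝ≥0∞} :
    MeasurableSet {p : (ℕ → ℝ≥0∞) × (ℕ → ℝ≥0∞) | ∀ᶠ n in atTop, k n ≤ p.1 n → c n < p.2 n} := by
  have : {p : (ℕ → ℝ≥0∞) × (ℕ → ℝ≥0∞) | ∀ᶠ n in atTop, k n ≤ p.1 n → c n < p.2 n} =
      ⋃ N, ⋂ n, ⋂ (_ : N ≤ n), ({p | k n ≤ p.1 n}ᶜ ∪ {p | c n < p.2 n}) := by
    ext p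
    simp [eventually_atTop, imp_iff_not_or]
  rw [this]
  refine MeasurableSet.iUnion fun N => MeasurableSet.iInter fun n => MeasurableSet.iInter fun _ => ?_
  exact (measurableSet_le measurable_const (by fun_prop)).compl.union
    (measurableSet_lt measurable_const (by fun_prop))

/-- By independence `X` may be frozen at a typical `x`, for which `k n ≤ x n` infinitely often. The
event for `Y` is then an increasing union over starting indices, and each member lies in `{c n < Y
n}` for some large `n`. -/
lemma measure_eventually_imp_le {Ω : Type*} [MeasurableSpace Ω] {P : Measure Ω}
    [IsProbabilityMeasure P] {X Y : Ω → ℕ → ℝ≥0∞} (hX : Measurable X) (hY : Measurable Y)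
    (hXY : IndepFun X Y P) {k c : ℕ → ℝ≥0∞} {δ : ℝ≥0∞}
    (hk : ∀ᵐ ω ∂P, ∃ᶠ n in atTop, k n ≤ X ω n)
    (hc : ∀ᶠ n in atTop, P {ω | c n < Y ω n} ≤ δ) :
    P {ω | ∀ᶠ n in atTop, k n ≤ X ω n → c n < Y ω n} ≤ δ := by
  have hmap := (indepFun_iff_map_prod_eq_prod_map_map hX.aemeasurable hY.aemeasurable).1 hXY
  have : IsProbabilityMeasure (P.map X) := Measure.isProbabilityMeasure_map hX.aemeasurable
  have : IsProbabilityMeasure (P.map Y) := Measure.isProbabilityMeasure_map hY.aemeasurable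
  have hset := measurableSet_eventually_imp (k := k) (c := c)
  have hPset : P {ω | ∀ᶠ n in atTop, k n ≤ X ω n → c n < Y ω n} =
      ∫⁻ x, (P.map Y) {y | ∀ᶠ n in atTop, k n ≤ x n → c n < y n} ∂(P.map X) := by
    rw [show {ω | ∀ᶠ n in atTop, k n ≤ X ω n → c n < Y ω n} = (fun ω => (X ω, Y ω)) ⁻¹'
      {p : (ℕ → ℝ≥0∞) × (ℕ → ℝ≥0∞) | ∀ᶠ n in atTop, k n ≤ p.1 n → c n < p.2 n} from rfl,
      ← Measure.map_apply (hX.prodMk hY) hset, hmap, Measure.prod_apply hset]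
    rfl
  have hfreq : MeasurableSet {x : ℕ → ℝ≥0∞ | ∃ᶠ n in atTop, k n ≤ x n} := by
    have : {x : ℕ → ℝ≥0∞ | ∃ᶠ n in atTop, k n ≤ x n} =
        ⋂ N, ⋃ n, ⋃ (_ : N ≤ n), {x | k n ≤ x n} := by
      ext x
      simp [frequently_atTop]
    rw [this]
    exact MeasurableSet.iInter fun N => MeasurableSet.iUnion fun n => MeasurableSet.iUnion fun _ =>
      measurableSet_le measurable_const (by fun_prop)
  have hae : ∀ᵐ x ∂(P.map X), ∃ᶠ n in atTop, k n ≤ x n :=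
    (ae_map_iff hX.aemeasurable hfreq).2 hk
  rw [hPset]
  calc ∫⁻ x, (P.map Y) {y | ∀ᶠ n in atTop, k n ≤ x n → c n < y n} ∂(P.map X)
      ≤ ∫⁻ _, δ ∂(P.map X) := by
        refine lintegral_mono_ae ?_
        filter_upwards [hae] with x hx
        have hU : {y : ℕ → ℝ≥0∞ | ∀ᶠ n in atTop, k n ≤ x n → c n < y n} =
            ⋃ N, {y | ∀ n, N ≤ n → k n ≤ x n → c n < y n} := by
          ext y; simp [eventually_atTop]
        have hmono : Monotone fun N => {y : ℕ → ℝ≥0∞ | ∀ n, N ≤ n → k n ≤ x n → c n < y n} :=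
          fun N N' hN y hy n hn => hy n (hN.trans hn)
        rw [hU, hmono.measure_iUnion]
        refine iSup_le fun N => ?_
        obtain ⟨n, hkn, hcn, hNn⟩ := (hx.and_eventually (hc.and (eventually_ge_atTop N))).exists
        refine le_trans ?_ hcn
        rw [show {ω | c n < Y ω n} = Y ⁻¹' {y | c n < y n} from rfl,
          ← Measure.map_apply hY (measurableSet_lt measurable_const (by fun_prop))]
        exact measure_mono fun y hy => hy n hNn hkn
    _ = δ := by simp

variable {d : ℕ} {lam : Measure ℝ} {Ω : Type*} [MeasurableSpace Ω] {P : Measure Ω}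
  {μ : Ω → Measure (JumpSpace d)}

lemma indepFun_jumpSum [IsProbabilityMeasure P] [SigmaFinite lam]
    (hμ : IsPoissonRandomMeasure P (intensity d lam) μ) {S T : Set ℝ} (hS : MeasurableSet S)
    (hT : MeasurableSet T) (hST : Disjoint S T) (t : ℕ → ℝ) :
    IndepFun (fun ω n => jumpSum (restrictJumps (μ ω) S) (t n))
      (fun ω n => jumpSum (restrictJumps (μ ω) T) (t n)) P := by
  have hΦ : Measurable fun (N : Measure (JumpSpace d)) (n : ℕ) => jumpSum N (t n) :=
    measurable_pi_iff.2 fun n => Measure.measurable_lintegral (measurable_jumpSum_integrand (t n))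
  exact (hμ.indepFun_restrict (measurableSet_jumps hS) (measurableSet_jumps hT)
    (hST.preimage fun q : JumpSpace d => q.2.2)).comp hΦ hΦ

/-- Markov's inequality; the mean `s * absMean lam` is at most a constant times `F`, so the bound
vanishes as `C` grows. -/
lemma measure_mul_lt_jumpSum_le [SigmaFinite lam] (hint : Integrable (fun z : ℝ => z) lam)
    (hμ : IsPoissonRandomMeasure P (intensity d lam) μ) {s c C F : ℝ} (hc : 0 < c) (hC : 0 < C)
    (hF : 0 < F) (hs : c * s ≤ F) :
    P {ω | ENNReal.ofReal (C * F) < jumpSum (μ ω) s} ≤ ENNReal.ofReal (absMean lam / c / C) := by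
  have hCF : 0 < C * F := mul_pos hC hF
  have hm := absMean_nonneg lam
  have h1 := mul_meas_ge_le_lintegral (μ := P) (measurable_jumpSum hμ s) (ENNReal.ofReal (C * F))
  rw [lintegral_jumpSum hint hμ] at h1
  calc P {ω | ENNReal.ofReal (C * F) < jumpSum (μ ω) s}
      ≤ P {ω | ENNReal.ofReal (C * F) ≤ jumpSum (μ ω) s} :=
        measure_mono fun ω hω => (show ENNReal.ofReal (C * F) < jumpSum (μ ω) s from hω).le
    _ ≤ ENNReal.ofReal (s * absMean lam) / ENNReal.ofReal (C * F) := by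
        rw [ENNReal.le_div_iff_mul_le (Or.inl (by simpa using hCF)) (Or.inl ENNReal.ofReal_ne_top),
          mul_comm]
        exact h1
    _ = ENNReal.ofReal (s * absMean lam / (C * F)) := (ENNReal.ofReal_div_of_pos hCF).symm
    _ ≤ _ := by
        apply ENNReal.ofReal_le_ofReal
        rw [div_div, div_le_div_iff₀ hCF (by positivity)]
        nlinarith [mul_le_mul_of_nonneg_right hs (mul_nonneg hm hC.le)]

/-- If the series of one family of jumps diverges, an independent family of jumps and a drift
cannot compensate it. -/
lemma ae_frequently_le_sub [IsProbabilityMeasure P] {lam₁ lam₂ : Measure ℝ} [SigmaFinite lam₁]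
    [SigmaFinite lam₂] {μ₁ μ₂ : Ω → Measure (JumpSpace d)} (hd : 1 ≤ d)
    (hint₁ : Integrable (fun z : ℝ => z) lam₁) (hint₂ : Integrable (fun z : ℝ => z) lam₂)
    {ε : ℝ} (hε : 0 < ε) (hmom : Integrable (fun z : ℝ => |z| ^ (1 + ε)) lam₁)
    (hμ₁ : IsPoissonRandomMeasure P (intensity d lam₁) μ₁)
    (hμ₂ : IsPoissonRandomMeasure P (intensity d lam₂) μ₂) {t F : ℕ → ℝ}
    (hind : IndepFun (fun ω n => jumpSum (μ₁ ω) (t n)) (fun ω n => jumpSum (μ₂ ω) (t n)) P)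
    (h : IsAdmissible t F) {c : ℝ} (hc : 0 < c) (hF : ∀ n, 1 ≤ n → c * t n ≤ F n)
    (hser : levySeries d lam₁ F t = ∞) (D : ℝ) :
    ∀ᵐ ω ∂P, ∀ K : ℝ, ∃ᶠ n in atTop, K * F n ≤
      D * t n + (jumpSum (μ₁ ω) (t n)).toReal - (jumpSum (μ₂ ω) (t n)).toReal := by
  have hfreq := ae_frequently_le_jumpSum hd hint₁ hε hmom h hc hF hser hμ₁
  have hfin₁ := ae_jumpSum_lt_top hint₁ hμ₁ t
  have hm := absMean_nonneg lam₂
  have hcore : ∀ k : ℕ, ∀ᵐ ω ∂P, ∃ᶠ n in atTop, k * F n ≤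
      D * t n + (jumpSum (μ₁ ω) (t n)).toReal - (jumpSum (μ₂ ω) (t n)).toReal := by
    intro k
    rw [ae_iff]
    -- The failure event is bounded by a quantity depending on a free parameter `C` and tending to
    -- zero as `C` grows; hence it is null, although no zero-one law is invoked.
    refine le_antisymm (ge_of_tendsto (f := fun C : ℝ => ENNReal.ofReal (absMean lam₂ / c / C))
      (x := atTop) ?_ ?_) zero_le
    · rw [← ENNReal.ofReal_zero]
      exact ENNReal.tendsto_ofReal (tendsto_const_nhds.div_atTop tendsto_id)
    filter_upwards [eventually_gt_atTop 0] with C hC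
    have hYm : Measurable fun ω (n : ℕ) => jumpSum (μ₂ ω) (t n) :=
      measurable_pi_iff.2 fun n => measurable_jumpSum hμ₂ (t n)
    have hXm : Measurable fun ω (n : ℕ) => jumpSum (μ₁ ω) (t n) :=
      measurable_pi_iff.2 fun n => measurable_jumpSum hμ₁ (t n)
    have hbound := measure_eventually_imp_le hXm hYm hind
      -- The level pays for the target `k * F`, for opposite jumps up to `C * F`, and for the drift,
      -- since `|D| * t ≤ (|D| / c) * F`.
      (k := fun n => ENNReal.ofReal ((k + C + |D| / c) * F n))
      (c := fun n => ENNReal.ofReal (C * F n)) (δ := ENNReal.ofReal (absMean lam₂ / c / C))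
      (by filter_upwards [hfreq] with ω hω using hω _)
      (by
        filter_upwards [eventually_ge_atTop 1] with n hn
        exact measure_mul_lt_jumpSum_le hint₂ hμ₂ hc hC (h.weight_pos n hn) (hF n hn))
    refine le_trans (measure_mono_ae ?_) hbound
    filter_upwards [hfin₁] with ω hω₁ hω
    have hω' : ∀ᶠ n in atTop, ¬ (k * F n ≤
      D * t n + (jumpSum (μ₁ ω) (t n)).toReal - (jumpSum (μ₂ ω) (t n)).toReal) :=
      not_frequently.1 hω
    change ∀ᶠ n in atTop, _ → _
    filter_upwards [hω', eventually_ge_atTop 1] with n hn hn1 hk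
    by_contra hlt
    apply hn
    have hFn := h.weight_pos n hn1
    have htn := h.pos n hn1
    have h1 : (k + C + |D| / c) * F n ≤ (jumpSum (μ₁ ω) (t n)).toReal :=
      (ENNReal.ofReal_le_iff_le_toReal (hω₁ n).ne).1 hk
    have h2 : (jumpSum (μ₂ ω) (t n)).toReal ≤ C * F n :=
      ENNReal.toReal_le_of_le_ofReal (by positivity) (not_lt.1 hlt)
    have h3 : -(|D| / c * F n) ≤ D * t n := by
      have h4 : |D| * t n ≤ |D| / c * F n := by
        rw [div_mul_eq_mul_div, le_div_iff₀ hc]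
        nlinarith [hF n hn1, abs_nonneg D]
      have h5 : -|D| * t n ≤ D * t n := by
        gcongr
        exact neg_abs_le D
      linarith
    nlinarith
  filter_upwards [ae_all_iff.2 hcore] with ω hω K
  obtain ⟨k, hk⟩ := exists_nat_ge K
  refine ((hω k).and_eventually (eventually_ge_atTop 1)).mono fun n hn => ?_
  have := h.weight_pos n hn.2
  exact le_trans (by gcongr) hn.1

end Divergent

/-! ### Upper limits of real sequences in the extended reals -/

section Limsup

variable {x : ℕ → ℝ}

lemma limsup_coe_eq {L : ℝ} (h₁ : ∀ c, L < c → ∀ᶠ n in atTop, x n ≤ c)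
    (h₂ : ∀ c, c < L → ∃ᶠ n in atTop, c ≤ x n) :
    limsup (fun n => (x n : EReal)) atTop = L := by
  refine le_antisymm (EReal.le_of_forall_lt_iff_le.1 fun c hc => ?_)
    (EReal.ge_of_forall_gt_iff_ge.1 fun c hc => ?_)
  · exact limsup_le_of_le (h := (h₁ c (by exact_mod_cast hc)).mono fun n hn => by exact_mod_cast hn)
  · exact le_limsup_of_frequently_le'
      ((h₂ c (by exact_mod_cast hc)).mono fun n hn => by exact_mod_cast hn)

lemma limsup_coe_eq_top (h : ∀ K : ℝ, ∃ᶠ n in atTop, K ≤ x n) :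
    limsup (fun n => (x n : EReal)) atTop = ⊤ :=
  EReal.eq_top_iff_forall_lt _ |>.2 fun K => lt_of_lt_of_le
    (show (K : EReal) < ((K + 1 : ℝ) : EReal) by exact_mod_cast lt_add_one K)
    (le_limsup_of_frequently_le' ((h (K + 1)).mono fun n hn => by exact_mod_cast hn))

lemma limsup_coe_eq_bot (h : ∀ K : ℝ, ∀ᶠ n in atTop, x n ≤ K) :
    limsup (fun n => (x n : EReal)) atTop = ⊥ :=
  EReal.eq_bot_iff_forall_lt _ |>.2 fun K => lt_of_le_of_lt
    (limsup_le_of_le (h := (h (K - 1)).mono fun n hn => by exact_mod_cast hn))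
    (show ((K - 1 : ℝ) : EReal) < (K : EReal) by exact_mod_cast sub_one_lt K)

/-- The quotient is `(y / t) * (t / F)` with a second factor tending to infinity, so the sign of `m`
decides. -/
lemma limsup_div_of_tendsto_atTop {y t F : ℕ → ℝ} {m : ℝ} (hm : m ≠ 0)
    (ht : ∀ᶠ n in atTop, 0 < t n)
    (hF : Tendsto (fun n => t n / F n) atTop atTop)
    (h₁ : ∀ c, m < c → ∀ᶠ n in atTop, y n / t n ≤ c)
    (h₂ : ∀ c, c < m → ∃ᶠ n in atTop, c ≤ y n / t n) :
    limsup (fun n => ((y n / F n : ℝ) : EReal)) atTop = ⊤ * (m : EReal) := by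
  have hy : ∀ n, 0 < t n → y n / F n = y n / t n * (t n / F n) := fun n hn => by
    rw [div_mul_div_cancel₀ hn.ne']
  rcases lt_or_gt_of_ne hm with hneg | hpos
  · rw [EReal.top_mul_coe_of_neg hneg]
    refine limsup_coe_eq_bot fun K => ?_
    filter_upwards [h₁ (m / 2) (by linarith), ht, hF.eventually_ge_atTop (|K| / (-(m / 2)))]
      with n hn htn hFn
    rw [hy n htn]
    have hm2 : 0 < -(m / 2) := by linarith
    rw [div_le_iff₀ hm2] at hFn
    have h0 : 0 ≤ t n / F n := by
      by_contra h
      nlinarith [abs_nonneg K]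
    have := mul_le_mul_of_nonneg_right hn h0
    linarith [neg_abs_le K]
  · rw [EReal.top_mul_coe_of_pos hpos]
    refine limsup_coe_eq_top fun K => ?_
    refine ((h₂ (m / 2) (by linarith)).and_eventually
      (ht.and (hF.eventually_ge_atTop (|K| / (m / 2))))).mono ?_
    rintro n ⟨hn, htn, hFn⟩
    rw [hy n htn]
    have hm2 : 0 < m / 2 := by linarith
    rw [div_le_iff₀ hm2] at hFn
    have h0 : 0 ≤ t n / F n := by
      by_contra h
      nlinarith [abs_nonneg K]
    have := mul_le_mul_of_nonneg_right hn h0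
    linarith [le_abs_self K]

lemma eventually_lt_div_of_eventually_mul_le {v t F : ℕ → ℝ} {κ b : ℝ}
    (hF : ∀ᶠ n in atTop, 0 < F n) (hκ : Tendsto (fun n => t n / F n) atTop (𝓝 κ))
    (h : ∀ c < b, ∀ᶠ n in atTop, c * t n ≤ v n) {c : ℝ} (hc : c < κ * b) :
    ∀ᶠ n in atTop, c < v n / F n := by
  have hcont : Tendsto (fun r => κ * r) (𝓝[<] b) (𝓝 (κ * b)) :=
    (tendsto_id.const_mul κ).mono_left nhdsWithin_le_nhds
  obtain ⟨r, hr1, hr2⟩ := ((hcont.eventually_const_lt hc).and self_mem_nhdsWithin).exists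
  have hlim : Tendsto (fun n => r * (t n / F n)) atTop (𝓝 (r * κ)) := hκ.const_mul r
  filter_upwards [h r hr2, hF, hlim.eventually_const_lt (show c < r * κ by linarith)]
    with n h1 h2 h3
  refine h3.trans_le ?_
  rw [← mul_div_assoc]
  gcongr

/-- An upper limit needs two-sided control of `u`, but for `v` only a lower bound and smallness
infinitely often. This is why the series of the opposite jumps plays no role. -/
lemma limsup_bounds_of_tendsto_sub {u v t F : ℕ → ℝ} {κ a b D : ℝ}
    (hF : ∀ᶠ n in atTop, 0 < F n) (hκ : Tendsto (fun n => t n / F n) atTop (𝓝 κ))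
    (hu₁ : ∀ c < a, ∀ᶠ n in atTop, c * t n ≤ u n)
    (hu₂ : ∀ c, κ * a < c → ∀ᶠ n in atTop, u n ≤ c * F n)
    (hv₁ : ∀ c < b, ∀ᶠ n in atTop, c * t n ≤ v n)
    (hv₂ : ∀ c, κ * b < c → ∃ᶠ n in atTop, v n ≤ c * F n) :
    (∀ c, κ * (D + a - b) < c → ∀ᶠ n in atTop, (D * t n + u n - v n) / F n ≤ c) ∧
      ∀ c, c < κ * (D + a - b) → ∃ᶠ n in atTop, c ≤ (D * t n + u n - v n) / F n := by
  have hsplit : ∀ n, (D * t n + u n - v n) / F n = D * (t n / F n) + u n / F n - v n / F n :=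
    fun n => by ring
  have hD : Tendsto (fun n => D * (t n / F n)) atTop (𝓝 (D * κ)) := hκ.const_mul D
  constructor
  · intro c hc
    set η := (c - κ * (D + a - b)) / 3 with hη
    have hη0 : 0 < η := by rw [hη]; linarith
    filter_upwards [hF, hu₂ (κ * a + η) (by linarith),
      eventually_lt_div_of_eventually_mul_le hF hκ hv₁ (show κ * b - η < κ * b by linarith),
      hD.eventually_le_const (show D * κ < D * κ + η by linarith)] with n h1 h2 h3 h4
    rw [hsplit]
    rw [← div_le_iff₀ h1] at h2
    linarith
  · intro c hc
    set η := (κ * (D + a - b) - c) / 3 with hη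
    have hη0 : 0 < η := by rw [hη]; linarith
    refine ((hv₂ (κ * b + η) (by linarith)).and_eventually (hF.and
      ((eventually_lt_div_of_eventually_mul_le hF hκ hu₁ (show κ * a - η < κ * a by linarith)).and
      (hD.eventually_const_le (show D * κ - η < D * κ by linarith))))).mono ?_
    rintro n ⟨h2, h1, h3, h4⟩
    rw [hsplit]
    rw [← div_le_iff₀ h1] at h2
    linarith

end Limsup

/-! ### Convergent series: combining both signs of the jumps -/

section Convergent

variable {d : ℕ} {Ω : Type*} [MeasurableSpace Ω] {P : Measure Ω}

/-- The summands decrease in the weight. The finitely many indices where the weights are not ordered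
cost a finite amount by the first moment. -/
lemma levySeries_lt_top_of_le {lam : Measure ℝ} (hint : Integrable (fun z : ℝ => z) lam)
    {t F G : ℕ → ℝ} (hF : IsAdmissible t F) (hG : IsAdmissible t G)
    (hFG : ∀ᶠ n in atTop, F n ≤ G n) (hser : levySeries d lam F t < ∞) :
    levySeries d lam G t < ∞ := by
  obtain ⟨N, hN⟩ := eventually_atTop.1 hFG
  have hΔ : ∀ n, 0 ≤ t (n + 1) - t n := fun n => sub_nonneg.2 (hF.mono (Nat.le_succ n))
  let T : (ℕ → ℝ) → ℕ → ℝ≥0∞ := fun H n => ∫⁻ z, ENNReal.ofReal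
    (min ((|z| / H (n + 1)) ^ (2 / (d : ℝ))) (t (n + 1) - t n) * (|z| / H (n + 1))) ∂lam
  have hfin : ∀ n, T G n < ∞ := by
    intro n
    have hGn := hG.weight_pos (n + 1) (by omega)
    calc T G n ≤ ∫⁻ z, ENNReal.ofReal ((t (n + 1) - t n) / G (n + 1)) * ENNReal.ofReal |z| ∂lam := by
          refine lintegral_mono fun z => ?_
          rw [← ENNReal.ofReal_mul (div_nonneg (hΔ n) hGn.le)]
          apply ENNReal.ofReal_le_ofReal
          calc _ ≤ (t (n + 1) - t n) * (|z| / G (n + 1)) := by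
                gcongr; exact min_le_right _ _
            _ = _ := by ring
      _ < ∞ := by
          rw [lintegral_const_mul' _ _ ENNReal.ofReal_ne_top, lintegral_abs hint]
          exact ENNReal.mul_lt_top ENNReal.ofReal_lt_top ENNReal.ofReal_lt_top
  have hle : ∀ n, T G (n + N) ≤ T F (n + N) := by
    intro n
    refine lintegral_mono fun z => ENNReal.ofReal_le_ofReal ?_
    have hFn := hF.weight_pos (n + N + 1) (by omega)
    have hFG' := hN (n + N + 1) (by omega)
    have hdiv : |z| / G (n + N + 1) ≤ |z| / F (n + N + 1) := by gcongr
    have hG0 : 0 ≤ |z| / G (n + N + 1) := div_nonneg (abs_nonneg z) (hFn.le.trans hFG')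
    exact mul_le_mul (min_le_min_right _ (Real.rpow_le_rpow hG0 hdiv (by positivity))) hdiv hG0
      (le_min (by positivity) (hΔ _))
  change ∑' n, T G n < ∞
  rw [← ENNReal.summable.sum_add_tsum_nat_add' (f := T G) (k := N)]
  refine ENNReal.add_lt_top.2 ⟨ENNReal.sum_lt_top.2 fun n _ => hfin n, ?_⟩
  exact ((ENNReal.tsum_le_tsum hle).trans
    (ENNReal.tsum_comp_le_tsum_of_injective (add_left_injective N) (T F))).trans_lt hser

variable {lam₁ lam₂ : Measure ℝ} [SigmaFinite lam₁] [SigmaFinite lam₂]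
  {μ₁ μ₂ : Ω → Measure (JumpSpace d)}

/-- The series enters only through the upper bound for the first family. The other three inputs are
the law of large numbers from below for both families and Fatou's lemma for the second. -/
lemma ae_limsup_bounds [IsProbabilityMeasure P] (hd : 1 ≤ d)
    (hint₁ : Integrable (fun z : ℝ => z) lam₁) (hint₂ : Integrable (fun z : ℝ => z) lam₂)
    {ε : ℝ} (hε : 0 < ε) (hmom : Integrable (fun z : ℝ => |z| ^ (1 + ε)) lam₁)
    (hlog : IntegrableOn (fun z : ℝ => |z * Real.log z|) (Set.Icc (-1) 1) lam₁)
    (hμ₁ : IsPoissonRandomMeasure P (intensity d lam₁) μ₁)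
    (hμ₂ : IsPoissonRandomMeasure P (intensity d lam₂) μ₂) {t F : ℕ → ℝ}
    (h : IsAdmissible t F) (hF : Tendsto F atTop atTop) {κ : ℝ} (hκ0 : 0 ≤ κ)
    (hκ : Tendsto (fun n => t n / F n) atTop (𝓝 κ)) (hser : levySeries d lam₁ F t < ∞) (D : ℝ) :
    ∀ᵐ ω ∂P,
      (∀ c, κ * (D + absMean lam₁ - absMean lam₂) < c → ∀ᶠ n in atTop,
        (D * t n + (jumpSum (μ₁ ω) (t n)).toReal - (jumpSum (μ₂ ω) (t n)).toReal) / F n ≤ c) ∧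
      ∀ c, c < κ * (D + absMean lam₁ - absMean lam₂) → ∃ᶠ n in atTop,
        c ≤ (D * t n + (jumpSum (μ₁ ω) (t n)).toReal - (jumpSum (μ₂ ω) (t n)).toReal) / F n := by
  have hF0 := hF.eventually_gt_atTop 0
  have hm₁ := absMean_nonneg lam₁
  have hm₂ := absMean_nonneg lam₂
  filter_upwards [ae_eventually_jumpSum_le hd hint₁ hε hmom hlog h hF hκ0 hκ hser hμ₁,
    ae_eventually_le_jumpSum hint₁ hμ₁, ae_eventually_le_jumpSum hint₂ hμ₂,
    ae_frequently_jumpSum_lt hint₂ hμ₂ hκ0 hF0 h.tendsto hκ,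
    ae_jumpSum_lt_top hint₁ hμ₁ t, ae_jumpSum_lt_top hint₂ hμ₂ t] with ω g1 g2 g3 g4 g5 g6
  refine limsup_bounds_of_tendsto_sub hF0 hκ (fun c hc => ?_) (fun c hc => ?_) (fun c hc => ?_)
    (fun c hc => ?_)
  · filter_upwards [h.tendsto.eventually (g2 c hc)] with n hn
    exact (ENNReal.ofReal_le_iff_le_toReal (g5 n).ne).1 hn
  · have hc0 : 0 ≤ c := le_trans (by positivity) hc.le
    filter_upwards [g1 c hc, hF0] with n hn hFn
    exact ENNReal.toReal_le_of_le_ofReal (by positivity) hn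
  · filter_upwards [h.tendsto.eventually (g3 c hc)] with n hn
    exact (ENNReal.ofReal_le_iff_le_toReal (g6 n).ne).1 hn
  · have hc0 : 0 ≤ c := le_trans (by positivity) hc.le
    refine ((g4 c hc).and_eventually hF0).mono fun n hn => ?_
    have := hn.2
    exact ENNReal.toReal_le_of_le_ofReal (by positivity) hn.1.le

/-- The upper limit when the series of the jumps that enter positively converges. -/
lemma ae_limsup_eq [IsProbabilityMeasure P] (hd : 1 ≤ d)
    (hint₁ : Integrable (fun z : ℝ => z) lam₁) (hint₂ : Integrable (fun z : ℝ => z) lam₂)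
    {ε : ℝ} (hε : 0 < ε) (hmom : Integrable (fun z : ℝ => |z| ^ (1 + ε)) lam₁)
    (hlog : IntegrableOn (fun z : ℝ => |z * Real.log z|) (Set.Icc (-1) 1) lam₁)
    (hμ₁ : IsPoissonRandomMeasure P (intensity d lam₁) μ₁)
    (hμ₂ : IsPoissonRandomMeasure P (intensity d lam₂) μ₂) {t F : ℕ → ℝ}
    (h : IsAdmissible t F) (hF : Tendsto F atTop atTop) {κ : ℝ≥0∞}
    (hκ : Tendsto (fun n => ((t n / F n : ℝ) : EReal)) atTop (𝓝 (κ : EReal)))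
    (hser : levySeries d lam₁ F t < ∞) {m D : ℝ} (hD : D + absMean lam₁ - absMean lam₂ = m)
    (hm : m = 0 → κ ≠ ∞) :
    ∀ᵐ ω ∂P, limsup (fun n => (((D * t n + (jumpSum (μ₁ ω) (t n)).toReal -
      (jumpSum (μ₂ ω) (t n)).toReal) / F n : ℝ) : EReal)) atTop = (κ : EReal) * (m : EReal) := by
  have hF0 := hF.eventually_gt_atTop 0
  have ht0 := h.tendsto.eventually_gt_atTop 0
  by_cases hκtop : κ = ∞
  · rw [hκtop, EReal.coe_ennreal_top] at hκ ⊢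
    rw [EReal.tendsto_coe_nhds_top_iff] at hκ
    -- For `κ = ∞` the weights are eventually below `t`, so the series with weight `t` converges
    -- too. The result for ratio one gives the limit of `y / t`, which is then multiplied by `t /
    -- F`.
    have htt : IsAdmissible t t :=
      ⟨h.zero, h.pos, h.mono, h.tendsto, h.pos, fun k l _ hkl => h.mono hkl⟩
    have hone : Tendsto (fun n => t n / t n) atTop (𝓝 1) :=
      tendsto_const_nhds.congr' (ht0.mono fun n hn => (div_self hn.ne').symm)
    have hle : ∀ᶠ n in atTop, F n ≤ t n := by
      filter_upwards [hF0, hκ.eventually_ge_atTop 1] with n h1 h2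
      rwa [le_div_iff₀ h1, one_mul] at h2
    filter_upwards [ae_limsup_bounds hd hint₁ hint₂ hε hmom hlog hμ₁ hμ₂ htt h.tendsto zero_le_one
      hone (levySeries_lt_top_of_le hint₁ h htt hle hser) D] with ω hω
    rw [one_mul, hD] at hω
    exact limsup_div_of_tendsto_atTop (fun h0 => hm h0 hκtop) ht0 hκ hω.1 hω.2
  · lift κ to ℝ≥0 using hκtop
    rw [EReal.coe_nnreal_eq_coe_real] at hκ ⊢
    rw [EReal.tendsto_coe] at hκ
    filter_upwards [ae_limsup_bounds hd hint₁ hint₂ hε hmom hlog hμ₁ hμ₂ h hF κ.coe_nonneg hκ hser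
      D] with ω hω
    rw [hD] at hω
    rw [← EReal.coe_mul]
    exact limsup_coe_eq hω.1 hω.2

end Convergent

/-! ### From the weight function to weights along the sequence. -/

lemma isAdmissible_comp {f : ℝ → ℝ} (hf_pos : ∀ s, 0 < s → 0 < f s)
    (hf_mono : MonotoneOn f (Set.Ioi 0)) {t : ℕ → ℝ} (ht_zero : t 0 = 0)
    (ht_pos : ∀ n, 1 ≤ n → 0 < t n) (ht_mono : Monotone t) (ht_lim : Tendsto t atTop atTop) :
    IsAdmissible t fun n => f (t n) where
  zero := ht_zero
  pos := ht_pos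
  mono := ht_mono
  tendsto := ht_lim
  weight_pos n hn := hf_pos _ (ht_pos n hn)
  weight_mono k l hk hkl := hf_mono (ht_pos k hk) (ht_pos l (hk.trans hkl)) (ht_mono hkl)

lemma tendsto_comp_atTop {f : ℝ → ℝ} (hf_mono : MonotoneOn f (Set.Ioi 0))
    (hf : ¬ BddAbove (f '' Set.Ioi 0)) {t : ℕ → ℝ} (ht_lim : Tendsto t atTop atTop) :
    Tendsto (fun n => f (t n)) atTop atTop := by
  refine tendsto_atTop.2 fun b => ?_
  obtain ⟨_, ⟨s, hs, rfl⟩, hb⟩ := not_bddAbove_iff.1 hf b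
  filter_upwards [ht_lim.eventually_ge_atTop s] with n hn
  exact hb.le.trans (hf_mono hs (lt_of_lt_of_le hs hn) hn)

/-- The lower limit settles large indices. The finitely many others have `F n ≥ F 1` and `t n ≤ t (N
+ 1)`. -/
lemma exists_mul_le_of_liminf_pos {t F : ℕ → ℝ} (h : IsAdmissible t F)
    (hlim : (0 : EReal) < liminf (fun n => ((F n / t n : ℝ) : EReal)) atTop) :
    ∃ c, 0 < c ∧ ∀ n, 1 ≤ n → c * t n ≤ F n := by
  obtain ⟨c, hc0, hc⟩ := EReal.lt_iff_exists_real_btwn.1 hlim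
  have hc0' : 0 < c := by exact_mod_cast hc0
  obtain ⟨N, hN⟩ := eventually_atTop.1 (eventually_lt_of_lt_liminf hc)
  have ht : 0 < t (N + 1) := h.pos _ (by omega)
  have hF1 := h.weight_pos 1 le_rfl
  refine ⟨min c (F 1 / t (N + 1)), lt_min hc0' (by positivity), fun n hn => ?_⟩
  have htn := h.pos n hn
  rcases le_total N n with hNn | hNn
  · have h1 : c < F n / t n := by exact_mod_cast hN n hNn
    rw [lt_div_iff₀ htn] at h1
    exact (mul_le_mul_of_nonneg_right (min_le_left _ _) htn.le).trans h1.le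
  · calc min c (F 1 / t (N + 1)) * t n ≤ F 1 / t (N + 1) * t (N + 1) := by
          gcongr
          · exact min_le_right _ _
          · exact h.mono (by omega)
      _ = F 1 := div_mul_cancel₀ _ ht.ne'
      _ ≤ F n := h.weight_mono 1 n le_rfl hn

end LevySHE

/-! ### The main theorem. -/

open LevySHE in
theorem mainTheorem2 {Ω : Type*} [MeasurableSpace Ω] (P : Measure Ω) [IsProbabilityMeasure P]
    (d : ℕ) (hd : 1 ≤ d)
    -- the Lévy noise with mean `m`, Lévy measure `lam` and jump measure `μ`
    (m : ℝ) (lam : Measure ℝ) (hlam : LevySHE.IsLevyMeasure lam) (hlam_ne : lam ≠ 0)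
    (hlam_int : Integrable (fun z : ℝ => z) lam)
    (μ : Ω → Measure (LevySHE.JumpSpace d))
    (hμ : LevySHE.IsPoissonRandomMeasure P (LevySHE.intensity d lam) μ)
    -- the moment condition on the Lévy measure
    (hlam_moment : ∃ ε : ℝ, 0 < ε ∧ Integrable (fun z : ℝ => |z| ^ (1 + ε)) lam)
    (hlam_log : IntegrableOn (fun z : ℝ => |z * Real.log z|) (Set.Icc (-1) 1) lam)
    -- the weight function `f : (0, ∞) → (0, ∞)`
    (f : ℝ → ℝ) (hf_pos : ∀ s, 0 < s → 0 < f s) (hf_mono : MonotoneOn f (Set.Ioi 0))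
    -- the sequence `0 = t₀ < t₁ ≤ t₂ ≤ …`
    (t : ℕ → ℝ) (ht_zero : t 0 = 0) (ht_pos : ∀ n, 1 ≤ n → 0 < t n) (ht_mono : Monotone t)
    (ht_lim : Tendsto t atTop atTop) :
    -- divergent series
    ((0 : EReal) < liminf (fun n => ((f (t n) / t n : ℝ) : EReal)) atTop →
      (LevySHE.jumpSeries d lam f t (Set.Ioi 0) = ∞ →
        ∀ᵐ ω ∂P, limsup (fun n =>
          ((LevySHE.mildSolution m lam (μ ω) (t n) 0 / f (t n) : ℝ) : EReal)) atTop = ⊤) ∧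
      (LevySHE.jumpSeries d lam f t (Set.Iio 0) = ∞ →
        ∀ᵐ ω ∂P, liminf (fun n =>
          ((LevySHE.mildSolution m lam (μ ω) (t n) 0 / f (t n) : ℝ) : EReal)) atTop = ⊥)) ∧
    -- convergent series
    (∀ κ : ℝ≥0∞, ¬ BddAbove (f '' Set.Ioi 0) →
      Tendsto (fun n => ((t n / f (t n) : ℝ) : EReal)) atTop (𝓝 (κ : EReal)) →
      (m = 0 → κ ≠ ∞) →
      (LevySHE.jumpSeries d lam f t (Set.Ioi 0) < ∞ →
        ∀ᵐ ω ∂P, limsup (fun n =>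
          ((LevySHE.mildSolution m lam (μ ω) (t n) 0 / f (t n) : ℝ) : EReal)) atTop
            = (κ : EReal) * (m : EReal)) ∧
      (LevySHE.jumpSeries d lam f t (Set.Iio 0) < ∞ →
        ∀ᵐ ω ∂P, liminf (fun n =>
          ((LevySHE.mildSolution m lam (μ ω) (t n) 0 / f (t n) : ℝ) : EReal)) atTop
            = (κ : EReal) * (m : EReal))) := by
  obtain ⟨ε, hε, hmom⟩ := hlam_moment
  have : SigmaFinite lam := sigmaFinite_of_integrable hlam.zero hlam_int
  have h := isAdmissible_comp hf_pos hf_mono ht_zero ht_pos ht_mono ht_lim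
  have ht0 : ∀ n, 0 ≤ t n := fun n => ht_zero ▸ ht_mono (Nat.zero_le n)
  have hint : ∀ S : Set ℝ, Integrable (fun z : ℝ => z) (lam.restrict S) := fun S =>
    hlam_int.restrict
  have hmomS : ∀ S : Set ℝ, Integrable (fun z : ℝ => |z| ^ (1 + ε)) (lam.restrict S) := fun S =>
    hmom.restrict
  have hlogS : ∀ S : Set ℝ, IntegrableOn (fun z : ℝ => |z * Real.log z|) (Set.Icc (-1) 1)
      (lam.restrict S) := fun S => hlam_log.mono_measure Measure.restrict_le_self
  have hpos := hμ.restrictJumps (S := Set.Ioi 0) measurableSet_Ioi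
  have hneg := hμ.restrictJumps (S := Set.Iio 0) measurableSet_Iio
  have hdisj : Disjoint (Set.Ioi (0 : ℝ)) (Set.Iio 0) :=
    Set.disjoint_left.2 fun z h1 h2 => lt_asymm (Set.mem_Ioi.1 h1) (Set.mem_Iio.1 h2)
  have hdrift := drift_eq m hlam_int
  have hmild : ∀ᵐ ω ∂P, ∀ n, mildSolution m lam (μ ω) (t n) 0 = drift m lam * t n +
      (jumpSum (restrictJumps (μ ω) (Set.Ioi 0)) (t n)).toReal -
      (jumpSum (restrictJumps (μ ω) (Set.Iio 0)) (t n)).toReal := by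
    filter_upwards [ae_jumpSum_lt_top (hint _) hpos t, ae_jumpSum_lt_top (hint _) hneg t]
      with ω h1 h2 n using mildSolution_zero (ht0 n) (h1 n) (h2 n)
  -- Reflection: the negative of the solution has drift `-drift m lam` and the two families of jumps
  -- exchanged, so each statement on lower limits becomes one on upper limits with mean `-m`.
  have hmild_neg : ∀ᵐ ω ∂P,
      (fun n => ((mildSolution m lam (μ ω) (t n) 0 / f (t n) : ℝ) : EReal)) =
      -fun n => (((-drift m lam * t n +
        (jumpSum (restrictJumps (μ ω) (Set.Iio 0)) (t n)).toReal -
        (jumpSum (restrictJumps (μ ω) (Set.Ioi 0)) (t n)).toReal) / f (t n) : ℝ) : EReal) := by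
    filter_upwards [hmild] with ω hω
    funext n
    rw [Pi.neg_apply, ← EReal.coe_neg, hω n]
    congr 1
    ring
  refine ⟨fun hlim => ?_, fun κ hf hκ hm => ?_⟩
  · obtain ⟨c, hc, hcF⟩ := exists_mul_le_of_liminf_pos h hlim
    have hdiv : ∀ {y : ℕ → ℝ}, (∀ K : ℝ, ∃ᶠ n in atTop, K * f (t n) ≤ y n) →
        limsup (fun n => ((y n / f (t n) : ℝ) : EReal)) atTop = ⊤ := fun {y} hy =>
      limsup_coe_eq_top fun K => ((hy K).and_eventually (eventually_ge_atTop 1)).mono fun n hn =>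
        (le_div_iff₀ (h.weight_pos n hn.2)).2 hn.1
    refine ⟨fun hser => ?_, fun hser => ?_⟩
    · filter_upwards [hmild, ae_frequently_le_sub hd (hint _) (hint _) hε (hmomS _) hpos hneg
        (indepFun_jumpSum hμ measurableSet_Ioi measurableSet_Iio hdisj t) h hc hcF hser
        (drift m lam)] with ω h1 h2
      simp_rw [h1]
      exact hdiv h2
    · filter_upwards [hmild_neg, ae_frequently_le_sub hd (hint _) (hint _) hε (hmomS _) hneg hpos
        (indepFun_jumpSum hμ measurableSet_Iio measurableSet_Ioi hdisj.symm t) h hc hcF hser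
        (-drift m lam)] with ω h1 h2
      rw [h1, EReal.liminf_neg, hdiv h2, EReal.neg_top]
  · have hF := tendsto_comp_atTop hf_mono hf ht_lim
    refine ⟨fun hser => ?_, fun hser => ?_⟩
    · filter_upwards [hmild, ae_limsup_eq hd (hint _) (hint _) hε (hmomS _) (hlogS _) hpos hneg h hF
        hκ hser (show drift m lam + _ - _ = m by rw [hdrift]; ring) hm] with ω h1 h2
      simp_rw [h1]
      exact h2
    · filter_upwards [hmild_neg, ae_limsup_eq hd (hint _) (hint _) hε (hmomS _) (hlogS _) hneg hpos
        h hF hκ hser (show -drift m lam + _ - _ = -m by rw [hdrift]; ring)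
        (fun h0 => hm (neg_eq_zero.1 h0))] with ω h1 h2
      rw [h1, EReal.liminf_neg, h2, EReal.coe_neg, mul_neg, neg_neg]
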